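/- **Graveyard hashing.** Consider an ordered linear-probing hash table with $n$ slots (positions modulo $n$), each of which is free, holds a key, or holds a tombstone; let $h:U\to[n]$ be the hash function. A tombstone keeps the hash of the deleted key. In each run, keys and tombstones are stored in the (cyclic) order of their hashes. * A *query* for $u$ examines positions $h(u),h(u)+1,\dots$ until it finds $u$, a key with hash greater than $h(u)$, or a free slot. * A *deletion* of $u$ performs a query for $u$ and, if it finds $u$, replaces it by a tombstone with hash $h(u)$. * An *insertion* of $u$ examines positions $h(u),h(u)+1,\dots$ until it finds the position $j$ where $u$ belongs (the first one that is free or holds a key or tombstone with hash at least $h(u)$), puts $u$ there, and shifts the contents of $j,j+1,\dots$ to the right by one until it reaches a tombstone or a free slot, which is overwritten. The running time of an operation is the number of slots from $h(u)$ through the last slot that it examines. The load factor is the number of keys divided by $n$, and is written $1-1/x$. A *rebuild* at load factor $1-1/x$ removes all tombstones, creates $\lfloor n/(2x)\rfloor$ new ones with the hashes $\lfloor 2ix\rfloor$ for $1\le i\le n/(2x)$ (modulo $n$), and lays out the keys and the new tombstones in the order of their hashes; this is done by bucketing them by hash and sweeping over the array twice, and its time is the number of steps of this procedure. The next rebuild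 takes place $\max(1,\lfloor n/(4x)\rfloor)$ operations later. (Insertions and deletions count as operations here; the theorem holds both if queries count and if they do not.) The table is initially empty and freshly rebuilt. A workload is a finite sequence of insertions, deletions and queries, fixed independently of $h$, in which only absent keys are inserted, and only while there are fewer than $n$ keys. **Theorem.** There is an absolute constant $C>0$ such that the following holds for every $n\ge1$, every universe $U$ and every workload. 1. If $h$ is fully random (the hashes of the keys are independent and uniform on $[n]$), then each insertion, query or deletion that is performed at a load factor $1-1/x$, where $x\ge 1$ is finite, takes expected time at most $Cx$ (not counting rebuilds). 2. Rebuilds cost amortized time $O(x)$ per operation: for every $h$, if the $t$-th operation of the workload is performed at load factor $1-1/x_t$ with $x_t\ge 1$ finite, for all $t$, then the total time of all rebuilds that are triggered by the workload is at most $C\sum_t x_t$. -/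

import Mathlib

namespace Graveyard

/-- A slot is free, or holds a key, or holds a tombstone. A tombstone remembers its hash. -/
inductive Slot (n : ℕ) (U : Type*) where
  | free : Slot n U
  | key (u : U) : Slot n U
  | tomb (g : Fin n) : Slot n U

/-- The operations of a workload. -/
inductive Op (U : Type*) where
  | insert (u : U) : Op U
  | delete (u : U) : Op U
  | query (u : U) : Op U

/-- The array of `n` slots. Positions live in `Fin n`, whose arithmetic is modulo `n`
(the table wraps around). -/
abbrev Table (n : ℕ) (U : Type*) := Fin n → Slot n U

section Operations

variable {n : ℕ} [NeZero n] {U : Type*} [DecidableEq U]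

/-- The `k`-th position examined by an operation on `u`: `h u, h u + 1, …`, cyclically. -/
def probe (h : U → Fin n) (u : U) (k : ℕ) : Fin n := h u + Fin.ofNat n k

/-- The cyclic distance from the hash `g` to the position `q`. -/
def dist (g q : Fin n) : ℕ := (q - g).val

/-- A query for `u` stops at the `k`-th examined position if this is free, or holds `u`, or holds
a key whose hash is greater than `h u`. A key `v` seen in the `k`-th examined position has a
greater hash than `u` in the cyclic order of the run iff it is less than `k` away from its hash. -/
def queryStops (h : U → Fin n) (T : Table n U) (u : U) (k : ℕ) : Bool :=
  match T (probe h u k) with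
  | .free => true
  | .key v => decide (v = u) || decide (dist (h v) (probe h u k) < k)
  | .tomb _ => false

/-- The offset at which the query for `u` stops (if it does so within one turn). -/
def queryOffset (h : U → Fin n) (T : Table n U) (u : U) : Option ℕ :=
  (List.range n).find? (queryStops h T u)

/-- The running time of a query: the number of examined positions. -/
def queryTime (h : U → Fin n) (T : Table n U) (u : U) : ℕ :=
  match queryOffset h T u with
  | some k => k + 1
  | none => n

/-- A deletion performs a query and replaces the key, if found, by a tombstone of the same hash. -/
def deleteKey (h : U → Fin n) (T : Table n U) (u : U) : Table n U :=
  match queryOffset h T u with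
  | none => T
  | some k =>
    match T (probe h u k) with
    | .key v => if v = u then Function.update T (probe h u k) (.tomb (h u)) else T
    | _ => T

/-- `u` belongs in the first examined position that is free or holds a key or tombstone whose
hash is at least `h u` in the cyclic order of the run. -/
def belongs (h : U → Fin n) (T : Table n U) (u : U) (k : ℕ) : Bool :=
  match T (probe h u k) with
  | .free => true
  | .key v => decide (dist (h v) (probe h u k) ≤ k)
  | .tomb g => decide (dist g (probe h u k) ≤ k)

/-- Slots that hold no key can absorb an insertion. -/
def Slot.usable {n : ℕ} {U : Type*} : Slot n U → Bool
  | .free => true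
  | .key _ => false
  | .tomb _ => true

/-- The offset `j` at which the insertion puts `u`, and the offset `k` of the free slot or
tombstone of which it makes use (the first one at or after `j`). -/
def insertOffsets (h : U → Fin n) (T : Table n U) (u : U) : Option (ℕ × ℕ) :=
  match (List.range n).find? (belongs h T u) with
  | none => none
  | some j =>
    match (List.range n).find? (fun k => decide (j ≤ k) && (T (probe h u k)).usable) with
    | none => none
    | some k => some (j, k)

/-- The running time of an insertion: the number of positions from `h u` to the slot that the
insertion makes use of. -/
def insertTime (h : U → Fin n) (T : Table n U) (u : U) : ℕ :=
  match insertOffsets h T u with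
  | some (_, k) => k + 1
  | none => n

/-- An insertion puts `u` at offset `j` and shifts the slots at offsets `j, …, k - 1` to the right
by one, overwriting the free slot or tombstone at offset `k`. -/
def insertKey (h : U → Fin n) (T : Table n U) (u : U) : Table n U :=
  match insertOffsets h T u with
  | none => T
  | some (j, k) => fun q =>
    if dist (h u) q < j ∨ k < dist (h u) q then T q
    else if dist (h u) q = j then .key u
    else T (q - 1)

/-- The running time of an operation, not counting rebuilds. -/
def opTime (h : U → Fin n) (T : Table n U) : Op U → ℕ
  | .insert u => insertTime h T u
  | .delete u => queryTime h T u
  | .query u => queryTime h T u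

/-- The effect of an operation on the array, not counting rebuilds. -/
def applyOp (h : U → Fin n) (T : Table n U) : Op U → Table n U
  | .insert u => insertKey h T u
  | .delete u => deleteKey h T u
  | .query _ => T

end Operations

section Rebuild

variable {n : ℕ} [NeZero n] {U : Type*}

/-- Does the slot hold a key? -/
def Slot.isKey {n : ℕ} {U : Type*} : Slot n U → Bool
  | .key _ => true
  | _ => false

/-- The number of slots that hold no key. If the load factor is `1 - 1 / x`, then this number is
`n / x`. -/
def spare (T : Table n U) : ℕ :=
  n - (Finset.univ.filter (fun q => (T q).isKey = true)).card

/-- The length of the rebuild window that starts when `f = n / x` slots hold no key: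
`n / (4 x) = f / 4`, rounded down, but at least one operation. -/
def windowLength (f : ℕ) : ℕ := max 1 (f / 4)

/-- The hashes of the new tombstones when `f = n / x` slots hold no key: the multiples
`2 i x = 2 i n / f` (rounded down, modulo `n`) for `1 ≤ i ≤ n / (2 x) = f / 2`. -/
def tombHashes (n : ℕ) [NeZero n] (f : ℕ) : List (Fin n) :=
  (List.range (f / 2)).map (fun i => Fin.ofNat n (2 * (i + 1) * n / f))

/-- For each hash, a linked list of keys and tombstones with this hash. -/
abbrev Buckets (n : ℕ) (U : Type*) := Fin n → List (Slot n U)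

/-- Put an entry into the bucket of the hash `g`. -/
def push (B : Buckets n U) (g : Fin n) (s : Slot n U) : Buckets n U :=
  Function.update B g (s :: B g)

/-- Scan the array, dropping all tombstones and putting each key into the bucket of its hash.
The second component counts steps: one for each scanned slot. -/
def gather (h : U → Fin n) (T : Table n U) (B : Buckets n U × ℕ) : Buckets n U × ℕ :=
  (List.finRange n).foldl
    (fun a q =>
      match T q with
      | .key u => (push a.1 (h u) (.key u), a.2 + 1)
      | _ => (a.1, a.2 + 1)) B

/-- Put a new tombstone into the bucket of each of the given hashes, one step for each. -/
def plant (L : List (Fin n)) (B : Buckets n U × ℕ) : Buckets n U × ℕ :=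
  L.foldl (fun a g => (push a.1 g (.tomb g), a.2 + 1)) B

/-- The state of a sweep: the queue of entries that wait for a slot, the array, the step count. -/
structure Sweep (n : ℕ) (U : Type*) where
  queue : List (Slot n U)
  table : Table n U
  steps : ℕ

/-- Sweep over the array once. At each position, the entries with this hash join the queue (one
step each), and the first entry of the queue, if any, is written into the slot (one step). -/
def sweep (B : Buckets n U) (s : Sweep n U) : Sweep n U :=
  (List.finRange n).foldl
    (fun a q =>
      { queue := (a.queue ++ B q).tail
        table := Function.update a.table q ((a.queue ++ B q).headD .free)
        steps := a.steps + (B q).length + 1 }) s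

/-- A rebuild of the array, with its number of steps: `n` steps to count the keys, `n` steps to
create the empty buckets, then the scan that removes all tombstones and sorts the keys by their
hash, then the new tombstones, then two sweeps, the second of which starts with the entries that
ran off the end of the array in the first one (wrap-around). -/
def rebuild (h : U → Fin n) (T : Table n U) : Table n U × ℕ :=
  let B := plant (tombHashes n (spare T)) (gather h T (fun _ => [], n + n))
  let s₁ := sweep B.1 { queue := [], table := fun _ => .free, steps := B.2 }
  let s₂ := sweep B.1 s₁
  (s₂.table, s₂.steps)

end Rebuild

section Execution

variable {n : ℕ} [NeZero n] {U : Type*} [DecidableEq U]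

/-- The state of a graveyard hash table: the array, the number of operations counted since the
last rebuild, and the length of the current rebuild window. -/
structure State (n : ℕ) (U : Type*) where
  table : Table n U
  count : ℕ
  window : ℕ

/-- The state right after a rebuild of the array `T`. -/
def fresh (h : U → Fin n) (T : Table n U) : State n U where
  table := (rebuild h T).1
  count := 0
  window := windowLength (spare T)

/-- Insertions and deletions count towards the length of a rebuild window; `cq` says whether
queries count, too. -/
def weight (cq : Bool) : Op U → ℕ
  | .query _ => if cq then 1 else 0
  | _ => 1

/-- Is a rebuild due after the operation `o`? -/
def rebuildDue (cq : Bool) (s : State n U) (o : Op U) : Bool :=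
  decide (s.window ≤ s.count + weight cq o)

/-- Perform an operation, followed by a rebuild if this is due. -/
def step (cq : Bool) (h : U → Fin n) (s : State n U) (o : Op U) : State n U :=
  if rebuildDue cq s o then fresh h (applyOp h s.table o)
  else { table := applyOp h s.table o, count := s.count + weight cq o, window := s.window }

/-- The state after a workload, starting from an empty table. -/
def run (cq : Bool) (h : U → Fin n) (S : List (Op U)) : State n U :=
  S.foldl (step cq h) (fresh h (fun _ => .free))

/-- The running time of the `t`-th operation of the workload `S` (rebuilds not included). -/
def timeAt (cq : Bool) (h : U → Fin n) (S : List (Op U)) (t : Fin S.length) : ℕ :=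
  opTime h (run cq h (S.take t)).table S[t]

/-- The number of steps of the rebuild that follows the `t`-th operation of the workload `S`
(zero if there is none). -/
def rebuildTimeAt (cq : Bool) (h : U → Fin n) (S : List (Op U)) (t : Fin S.length) : ℕ :=
  if rebuildDue cq (run cq h (S.take t)) S[t] then
    (rebuild h (applyOp h (run cq h (S.take t)).table S[t])).2
  else 0

end Execution

section Workload

variable {U : Type*} [DecidableEq U]

/-- The set of keys that are present after a workload, starting from the empty set. -/
def contents (S : List (Op U)) : Finset U :=
  S.foldl
    (fun A o =>
      match o with
      | .insert u => insert u A
      | .delete u => A.erase u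
      | .query _ => A) ∅

/-- The load factor at which the `t`-th operation of the workload `S` is performed. -/
noncomputable def loadAt (n : ℕ) (S : List (Op U)) (t : Fin S.length) : ℝ :=
  (contents (S.take t)).card / n

/-- A workload for a table of `n` slots: only absent keys are inserted, and only while there are
fewer than `n` keys. -/
def Admissible (n : ℕ) (S : List (Op U)) : Prop :=
  ∀ (t : Fin S.length) (u : U), S[t] = Op.insert u →
    u ∉ contents (S.take t) ∧ (contents (S.take t)).card < n

end Workload

/-- A fully random hash function: the hashes of the keys are independent and uniform. -/
structure FullyRandom {n : ℕ} {U Ω : Type*} [MeasurableSpace Ω]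
    (P : MeasureTheory.Measure Ω) (h : Ω → U → Fin n) : Prop where
  measurable : ∀ u, Measurable (fun ω => h ω u)
  uniform : ∀ u i, P.real {ω | h ω u = i} = 1 / n
  indep : ProbabilityTheory.iIndepFun (fun u ω => h ω u) P

end Graveyard

/-!
The hashes of the keys and tombstones of a table form a layout in which displacements grow by at
most one from a slot to the next (`Ordered`). Insertions and deletions preserve this, and so does a
rebuild: its two sweeps run a queue that is in its steady state from the second sweep on
(`queueAt_periodic`), so that the second sweep writes every entry exactly once and in the order of
the hashes (`rebuild_spec`).

**Bounds for a fixed hash function.** Which keys `A₀` were present at the last rebuild, which keys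
`J` have been inserted or deleted since then, and how many operations have been counted does not
depend on the hash function (`Phase`, `exists_tracks`). Let `f` be the number of slots without a key
at the last rebuild; then `J` has at most `f / 4` elements. The entries of a table with a given hash
are at most the new tombstones of this hash and the keys of `A₀ ∪ J` of this hash (`Good.item_le`).
In an ordered layout, an entry at offset `j` from `q` whose hash precedes `q` certifies an arc that
ends at `q` and contains over `j` more hashes of entries than positions (`Ordered.crossing`). Since
the new tombstones are evenly spread, with density `f / (2 n)`, the offset is bounded by the length at
`q` of a queue of the keys of `A₀ ∪ J` that is served at rate `1 - f / (2 n)` (`excess`,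
`Good.offset_le`). This bounds the number of entries with smaller hashes that an operation passes.
A query also passes keys with the same hash and tombstones; there are few of both
(`Good.queryTime_le`). An insertion also passes keys up to the first tombstone. Let `F g` be the
number of insertions that have crossed the hash `g`, i.e. keys with hashes before `g` that made use
of tombstones from `g` on. An insertion uses the first tombstone in the order of the hashes
(`InsertsAt.no_tomb`), hence `F` is positive only where all tombstones before were used up, and it
is bounded by the length of a queue of the keys of `J`, with density at most `f / (4 n)`, that is
served by the new tombstones, with density `f / (2 n)` (`Good.insert`, `flow_le`). So a stretch
without tombstones after the hash of the inserted key is short, in terms of queues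
(`Good.insertTime_le`).

**Expected queue lengths.** For a set of keys of density `λ < μ`, comparing the sum of the squares
of the queue lengths over all positions with itself, shifted by one, bounds the sum of the lengths
(`sum_excess_le`). The terms that involve the number of keys hashed to a position are sums of the
queue lengths at the hashes of the keys. As a key does not contribute to the queue at its own hash,
and as its hash is independent of the others and uniform, the expectation is that of an average
over all positions (`FullyRandom.integral_hash`). This shows that the expected queue length is
`O(1 / (μ - λ))` (`FullyRandom.integral_excess`), where `μ - λ` is at least a constant times `f / n`
for all queues involved. The queues of the touched keys have density `O(f / n)` themselves, so
their expected lengths are `O(1)`, and the factor `n / f` for the distance between tombstones leads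
to the total `O(n / f) = O(x)`, the number of slots without a key being at most `5 f / 4`.

**Amortized cost.** A rebuild takes at most `8 n` steps, and it is preceded by a window of more than
`f / 8` operations, each of which is performed at a load factor `1 - 1 / x` with `x` at least
`4 n / (5 f)` (`sum_rebuildTimeAt_le`).
-/

namespace Graveyard

open MeasureTheory ProbabilityTheory

/-! ### Cyclic distances -/

section Cyclic

variable {n : ℕ}

theorem dist_spec (g q : Fin n) :
    dist g q < n ∧ (g.val + dist g q = q.val ∨ g.val + dist g q = q.val + n) := by
  refine ⟨(q - g).isLt, ?_⟩
  have hg := g.isLt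
  have hq := q.isLt
  have h1 : dist g q = (n - g.val + q.val) % n := by simp [dist, Fin.sub_def]
  rcases Nat.lt_or_ge (n - g.val + q.val) n with h | h
  · rw [h1, Nat.mod_eq_of_lt h]; omega
  · rw [h1, Nat.mod_eq_sub_mod h, Nat.mod_eq_of_lt (by omega)]; omega

theorem dist_inj_left {g g' q : Fin n} (hd : dist g q = dist g' q) : g = g' := by
  have h1 := dist_spec g q
  have h2 := dist_spec g' q
  have := g.isLt
  have := g'.isLt
  apply Fin.ext
  omega

variable [NeZero n]

/-- The hash `k` steps after `g`, cyclically. -/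
def adv (g : Fin n) (k : ℕ) : Fin n := g + Fin.ofNat n k

theorem adv_spec (g : Fin n) {k : ℕ} (hk : k ≤ n) :
    g.val + k = (adv g k).val ∨ g.val + k = (adv g k).val + n := by
  have hg := g.isLt
  have h1 : (adv g k).val = (g.val + k) % n := by simp [adv, Fin.add_def]
  rcases Nat.lt_or_ge (g.val + k) n with h | h
  · rw [h1, Nat.mod_eq_of_lt h]; omega
  · rcases Nat.lt_or_ge (g.val + k - n) n with h' | h'
    · rw [h1, Nat.mod_eq_sub_mod h, Nat.mod_eq_of_lt (by omega)]; omega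
    · omega

theorem dist_adv (g : Fin n) {k : ℕ} (hk : k < n) : dist g (adv g k) = k := by
  have h1 := dist_spec g (adv g k)
  have h2 := adv_spec g hk.le
  have h3 := (adv g k).isLt
  omega

theorem adv_dist (g q : Fin n) : adv g (dist g q) = q := by
  have h1 := dist_spec g q
  have h2 := adv_spec g h1.1.le
  have h3 := (adv g (dist g q)).isLt
  have h4 := q.isLt
  apply Fin.ext
  omega

theorem adv_zero (g : Fin n) : adv g 0 = g := by simp [adv]

theorem adv_succ (g : Fin n) (k : ℕ) : adv g (k + 1) = adv g k + 1 := by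
  unfold adv
  rw [add_assoc]
  congr 1
  apply Fin.ext
  simp [Fin.add_def, Nat.add_mod]

theorem pred_spec (q : Fin n) :
    (q - 1).val + 1 = q.val ∨ (q.val = 0 ∧ (q - 1).val + 1 = n) := by
  have h0 : 0 < n := Nat.pos_of_ne_zero (NeZero.ne n)
  have h1 := adv_spec (q - 1) (k := 1) h0
  have h2 : adv (q - 1) 1 = q := by
    have := adv_succ (q - 1) 0
    rw [zero_add] at this
    rw [this, adv_zero]; simp
  rw [h2] at h1
  have := (q - 1).isLt
  have := q.isLt
  omega

theorem succ_spec (q : Fin n) :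
    q.val + 1 = (q + 1).val ∨ (q.val + 1 = n ∧ (q + 1).val = 0) := by
  have h1 := pred_spec (q + 1)
  have h2 : q + 1 - 1 = q := by simp
  rw [h2] at h1
  have := q.isLt
  omega

theorem dist_self (q : Fin n) : dist q q = 0 := by simp [dist]

theorem dist_eq_zero {g q : Fin n} (hd : dist g q = 0) : g = q := by
  have := adv_dist g q
  rw [hd, adv_zero] at this
  exact this

theorem dist_inj {g q q' : Fin n} (hd : dist g q = dist g q') : q = q' := by
  rw [← adv_dist g q, hd, adv_dist]

theorem dist_neg (g q : Fin n) : dist (-g) (-q) = dist q g := by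
  unfold dist; rw [neg_sub_neg]

end Cyclic

/-! ### Ordered layouts -/

section Layout

variable {n : ℕ} [NeZero n]

/-- A layout assigns to each slot the hash of its entry (`none` if the slot is free). It is ordered
if each entry that is displaced from its hash by `d > 0` follows an entry that is displaced by at
least `d - 1`; in particular all slots between the hash of an entry and the entry are occupied, and
the entries of a run are stored in the order of their hashes. -/
def Ordered (H : Fin n → Option (Fin n)) : Prop :=
  ∀ q g, H q = some g → 0 < dist g q →
    ∃ g', H (q - 1) = some g' ∧ dist g q ≤ dist g' (q - 1) + 1

/-- Going back from an entry towards its hash, the displacements decrease by at most one per slot.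
-/
theorem Ordered.back {H : Fin n → Option (Fin n)} (hH : Ordered H) {q g : Fin n}
    (hq : H q = some g) (r : Fin n) (hr : dist r q ≤ dist g q) :
    ∃ g', H r = some g' ∧ dist g q ≤ dist g' r + dist r q := by
  induction hi : dist r q generalizing r with
  | zero =>
    obtain rfl := dist_eq_zero hi
    exact ⟨g, hq, by omega⟩
  | succ i ih =>
    have e1 : dist (r + 1) q = i := by
      have h1 := dist_spec r q
      have h2 := dist_spec (r + 1) q
      have h3 := succ_spec r
      have := (r + 1).isLt
      have := q.isLt
      omega
    obtain ⟨g1, hg1, hd1⟩ := ih (r + 1) (by omega) e1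
    obtain ⟨g2, hg2, hd2⟩ := hH _ _ hg1 (by omega)
    rw [add_sub_cancel_right] at hg2 hd2
    exact ⟨g2, hg2, by omega⟩

/-- No free slot lies between the hash of an entry and the entry. -/
theorem Ordered.lt_dist_free {H : Fin n → Option (Fin n)} (hH : Ordered H) {p q g : Fin n}
    (hp : H p = none) (hq : H q = some g) : dist g q < dist p q := by
  by_contra hlt
  obtain ⟨g', hg', -⟩ := hH.back hq p (by omega)
  rw [hp] at hg'
  cases hg'

/-- An entry at offset `j` from `q` whose hash precedes `q` certifies an arc `[q - l, q)` of hashes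
that has `l + j + 1` entries: they fill the slots from the start of the run to that entry. -/
theorem Ordered.crossing {H : Fin n → Option (Fin n)} (hH : Ordered H) {p q g : Fin n} {j : ℕ}
    (hp : H p = none) (hj : j < n) (hg : H (adv q j) = some g) (hd : j < dist g (adv q j)) :
    ∃ l < n, l + j + 1 ≤
      (Finset.univ.filter (fun r => ∃ g', H r = some g' ∧ 1 ≤ dist g' q ∧ dist g' q ≤ l)).card := by
  classical
  -- all slots after the last free slot before the entry, up to the entry, hold entries with hashes
  -- between this free slot and `q`
  set y := adv q j with hy
  have hqy : dist q y = j := dist_adv q hj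
  obtain ⟨p, hp, hmin⟩ : ∃ p, H p = none ∧ ∀ p', H p' = none → dist p y ≤ dist p' y := by
    obtain ⟨p', h1, h2⟩ := Finset.exists_min_image (Finset.univ.filter (fun p => H p = none))
      (fun p => dist p y) ⟨p, by simp [hp]⟩
    exact ⟨p', by simpa using h1, fun p'' h => h2 p'' (by simpa using h)⟩
  have hpy := hH.lt_dist_free hp hg
  have hpyn := (dist_spec p y).1
  refine ⟨dist p y - 1 - j, by omega, ?_⟩
  have hl : dist p y - 1 - j + j + 1 = dist p y := by omega
  conv_lhs => rw [hl, ← Finset.card_range (dist p y)]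
  refine Finset.card_le_card_of_injOn (fun i => adv y (n - i)) ?_ ?_
  · intro i hi
    simp only [Finset.coe_range, Set.mem_Iio] at hi
    have hx : dist (adv y (n - i)) y = i := by
      have h1 := dist_spec (adv y (n - i)) y
      have h2 := adv_spec y (k := n - i) (by omega)
      have := (adv y (n - i)).isLt
      have := y.isLt
      omega
    simp only [Finset.coe_filter, Finset.mem_univ, true_and, Set.mem_ofPred_eq]
    generalize adv y (n - i) = x at hx ⊢
    rcases hHx : H x with _ | g'
    · have := hmin x hHx
      omega
    · refine ⟨g', rfl, ?_⟩
      have hf := hH.lt_dist_free hp hHx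
      have h0 : dist g y ≤ dist g' x + i := by
        rcases Nat.lt_or_ge (dist g y) i with hlt | hge
        · omega
        · obtain ⟨g'', h1, h2⟩ := hH.back hg x (by omega)
          rw [hHx] at h1
          cases h1
          omega
      have h1 := dist_spec g' x
      have h2 := dist_spec x y
      have h3 := dist_spec p x
      have h4 := dist_spec p y
      have h5 := dist_spec g' q
      have h6 := dist_spec q y
      have := x.isLt
      have := y.isLt
      have := p.isLt
      have := q.isLt
      have := g'.isLt
      omega
  · intro i hi i' hi' hii
    simp only [Finset.coe_range, Set.mem_Iio] at hi hi'
    have h1 := adv_spec y (k := n - i) (by omega)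
    have h2 := adv_spec y (k := n - i') (by omega)
    simp only at hii
    rw [hii] at h1
    have := (adv y (n - i')).isLt
    have := y.isLt
    omega

end Layout


/-! ### Weights of the slots of a table -/

section Totals

variable {n : ℕ} {U : Type*}

/-- The hash of the entry of a slot, `none` if the slot is free. -/
def slotHash (h : U → Fin n) : Slot n U → Option (Fin n)
  | .free => none
  | .key v => some (h v)
  | .tomb g => some g

/-- The hashes of the entries of a table, slot by slot. -/
def layout (h : U → Fin n) (T : Table n U) (q : Fin n) : Option (Fin n) := slotHash h (T q)

/-- The total weight of the slots of a table. -/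
def total (f : Slot n U → ℕ) (T : Table n U) : ℕ := ∑ q, f (T q)

theorem total_update (f : Slot n U → ℕ) (T : Table n U) (a : Fin n) (s : Slot n U) :
    total f (Function.update T a s) + f (T a) = total f T + f s := by
  classical
  unfold total
  rw [← Finset.add_sum_erase _ _ (Finset.mem_univ a),
    ← Finset.add_sum_erase Finset.univ (fun q => f (T q)) (Finset.mem_univ a)]
  have : ∑ x ∈ Finset.univ.erase a, f (Function.update T a s x)
      = ∑ x ∈ Finset.univ.erase a, f (T x) :=
    Finset.sum_congr rfl fun x hx => by rw [Function.update_of_ne (Finset.ne_of_mem_erase hx)]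
  rw [this, Function.update_self]
  ring

/-- Permuting the slots does not change the total weight. -/
theorem total_comp (f : Slot n U → ℕ) (T : Table n U) {σ : Fin n → Fin n}
    (hσ : Function.Bijective σ) : total f (T ∘ σ) = total f T :=
  Function.Bijective.sum_comp hσ (fun q => f (T q))

/-- Does the slot hold a tombstone of hash `g`? -/
def tombWeight (g : Fin n) : Slot n U → ℕ
  | .tomb g' => if g' = g then 1 else 0
  | _ => 0

/-- Does the slot hold an entry of hash `g`? -/
def itemWeight (h : U → Fin n) (g : Fin n) (s : Slot n U) : ℕ :=
  if slotHash h s = some g then 1 else 0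

theorem tombWeight_total_eq_zero {T : Table n U} {g : Fin n} :
    total (tombWeight g) T = 0 ↔ ∀ q, T q ≠ .tomb g := by
  unfold total
  rw [Finset.sum_eq_zero_iff]
  refine forall_congr' fun q => ?_
  rcases T q with _ | v | g' <;> simp [tombWeight]

variable [DecidableEq U]

/-- Does the slot hold the key `u`? -/
def keyWeight (u : U) : Slot n U → ℕ
  | .key v => if v = u then 1 else 0
  | _ => 0

/-- The keys of the table are those of `A`, and each of them is stored in only one slot. -/
def KeysAre (T : Table n U) (A : Finset U) : Prop :=
  ∀ u, total (keyWeight u) T = if u ∈ A then 1 else 0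

namespace KeysAre

variable {T : Table n U} {A : Finset U}

theorem mem (hT : KeysAre T A) {q : Fin n} {u : U} (hq : T q = .key u) : u ∈ A := by
  by_contra hu
  have h1 := hT u
  rw [if_neg hu, total, Finset.sum_eq_zero_iff] at h1
  have := h1 q (Finset.mem_univ q)
  simp [hq, keyWeight] at this

theorem exists_slot (hT : KeysAre T A) {u : U} (hu : u ∈ A) : ∃ q, T q = .key u := by
  by_contra! hne
  have h1 := hT u
  rw [if_pos hu] at h1
  have : total (keyWeight u) T = 0 := by
    unfold total
    refine Finset.sum_eq_zero fun q _ => ?_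
    have := hne q
    rcases hTq : T q with _ | v | g
    · rfl
    · rw [hTq] at this
      simp only [keyWeight]
      rw [if_neg]
      rintro rfl
      exact this rfl
    · rfl
  omega

theorem slot_unique (hT : KeysAre T A) {q q' : Fin n} {u : U} (hq : T q = .key u)
    (hq' : T q' = .key u) : q = q' := by
  by_contra hne
  have h1 := hT u
  have h2 : ∑ r ∈ {q, q'}, keyWeight u (T r) ≤ total (keyWeight u) T :=
    Finset.sum_le_sum_of_subset (Finset.subset_univ _)
  rw [Finset.sum_pair hne, hq, hq'] at h2
  simp only [keyWeight, if_true] at h2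
  split_ifs at h1 <;> omega

/-- A weight that only keys carry can be summed over the keys. -/
theorem total_eq (hT : KeysAre T A) (f : Slot n U → ℕ) (h1 : f .free = 0)
    (h2 : ∀ g, f (.tomb g) = 0) : total f T = ∑ v ∈ A, f (.key v) := by
  have e : ∀ q, f (T q) = ∑ v ∈ A, keyWeight v (T q) * f (.key v) := by
    intro q
    rcases hTq : T q with _ | v | g
    · simp [h1, keyWeight]
    · rw [Finset.sum_eq_single v]
      · simp [keyWeight]
      · intro w _ hw
        simp [keyWeight, hw.symm]
      · intro hv
        exact absurd (hT.mem hTq) hv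
    · simp [h2, keyWeight]
  unfold total
  simp_rw [e]
  rw [Finset.sum_comm]
  refine Finset.sum_congr rfl fun v hv => ?_
  rw [← Finset.sum_mul]
  have := hT v
  rw [if_pos hv] at this
  unfold total at this
  rw [this, one_mul]

theorem item_total (hT : KeysAre T A) (h : U → Fin n) (g : Fin n) :
    total (itemWeight h g) T = total (tombWeight g) T + (A.filter (fun v => h v = g)).card := by
  have e : total (itemWeight h g) T = total (tombWeight g) T +
      total (fun s => match s with | .key v => if h v = g then 1 else 0 | _ => 0) T := by
    unfold total
    rw [← Finset.sum_add_distrib]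
    refine Finset.sum_congr rfl fun q _ => ?_
    rcases T q with _ | v | g' <;> simp [itemWeight, tombWeight, slotHash]
  rw [e, Finset.card_filter]
  congr 1
  exact hT.total_eq _ rfl (fun _ => rfl)

theorem spare_eq (hT : KeysAre T A) : spare T = n - A.card := by
  have := hT.total_eq (fun s => if s.isKey = true then 1 else 0) rfl (fun _ => rfl)
  unfold total at this
  unfold spare
  rw [Finset.card_filter, this]
  simp [Slot.isKey]

theorem card_le (hT : KeysAre T A) : A.card ≤ n := by
  have h1 := hT.total_eq (fun s => if s.isKey = true then 1 else 0) rfl (fun _ => rfl)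
  have h2 : total (fun s => if s.isKey = true then 1 else 0) T ≤ n := by
    unfold total
    rw [← Finset.card_filter]
    exact (Finset.card_le_univ _).trans (by simp)
  rw [h1] at h2
  simpa [Slot.isKey] using h2

end KeysAre

omit [DecidableEq U] in
/-- Entries with hash in a set, counted by slots and by hashes. -/
theorem card_layout_eq (h : U → Fin n) (T : Table n U) (P : Fin n → Prop) [DecidablePred P]
    [DecidablePred fun r => ∃ g, layout h T r = some g ∧ P g] :
    (Finset.univ.filter (fun r => ∃ g, layout h T r = some g ∧ P g)).card
      = ∑ g ∈ Finset.univ.filter P, total (itemWeight h g) T := by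
  unfold total
  rw [Finset.sum_comm, Finset.card_filter]
  refine Finset.sum_congr rfl fun r _ => ?_
  unfold itemWeight
  change (if ∃ g, layout h T r = some g ∧ P g then 1 else 0)
    = ∑ g ∈ Finset.univ.filter P, if layout h T r = some g then 1 else 0
  obtain hr | ⟨g, hr⟩ : layout h T r = none ∨ ∃ g, layout h T r = some g := by
    cases layout h T r <;> simp
  · simp [hr]
  · by_cases hg : P g <;> simp [hr, hg, Finset.sum_ite_eq]

omit [DecidableEq U] in
theorem card_tomb_eq (T : Table n U) (P : Fin n → Prop) [DecidablePred P]
    [DecidablePred fun r => ∃ g, T r = .tomb g ∧ P g] :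
    (Finset.univ.filter (fun r => ∃ g, T r = .tomb g ∧ P g)).card
      = ∑ g ∈ Finset.univ.filter P, total (tombWeight g) T := by
  unfold total
  rw [Finset.sum_comm, Finset.card_filter]
  refine Finset.sum_congr rfl fun r _ => ?_
  obtain hr | ⟨v, hr⟩ | ⟨g, hr⟩ : T r = .free ∨ (∃ v, T r = .key v) ∨ ∃ g, T r = .tomb g := by
    cases T r <;> simp
  · simp [hr, tombWeight]
  · simp [hr, tombWeight]
  · by_cases hg : P g <;> simp [hr, hg, tombWeight, Finset.sum_ite_eq]

end Totals

/-! ### Queries and deletions -/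

section Queries

variable {n : ℕ} [NeZero n] {U : Type*} [DecidableEq U]

omit [DecidableEq U] in
theorem probe_eq (h : U → Fin n) (u : U) (k : ℕ) : probe h u k = adv (h u) k := rfl

/-- A query goes on past tombstones and past keys with hashes that are not greater. -/
theorem not_queryStops {h : U → Fin n} {T : Table n U} {u : U} {k : ℕ}
    (hk : ¬ queryStops h T u k = true) :
    (∃ v, T (adv (h u) k) = .key v ∧ v ≠ u ∧ k ≤ dist (h v) (adv (h u) k)) ∨
      ∃ g, T (adv (h u) k) = .tomb g := by
  unfold queryStops at hk
  rw [probe_eq] at hk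
  rcases hT : T (adv (h u) k) with _ | v | g
  · simp [hT] at hk
  · simp only [hT, Bool.or_eq_true, decide_eq_true_eq, not_or, not_lt] at hk
    exact Or.inl ⟨v, rfl, hk.1, hk.2⟩
  · exact Or.inr ⟨g, rfl⟩

theorem queryOffset_of_mem {h : U → Fin n} {T : Table n U} {A : Finset U}
    (hH : Ordered (layout h T)) (hT : KeysAre T A) {u : U} (hu : u ∈ A) :
    ∃ k < n, queryOffset h T u = some k ∧ T (adv (h u) k) = .key u := by
  obtain ⟨q, hq⟩ := hT.exists_slot hu
  have hlq : layout h T q = some (h u) := by simp [layout, hq, slotHash]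
  have hdn := (dist_spec (h u) q).1
  refine ⟨dist (h u) q, hdn, ?_, by rw [adv_dist, hq]⟩
  unfold queryOffset
  rw [List.find?_range_eq_some]
  refine ⟨?_, by simpa using hdn, ?_⟩
  · simp [queryStops, probe_eq, adv_dist, hq]
  · intro i hi
    have hne : adv (h u) i ≠ q := by
      intro he
      have := dist_adv (h u) (k := i) (by omega)
      rw [he] at this
      omega
    have hd : dist (adv (h u) i) q = dist (h u) q - i := by
      have h1 := dist_spec (adv (h u) i) q
      have h2 := adv_spec (h u) (k := i) (by omega)
      have h3 := dist_spec (h u) q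
      have := (adv (h u) i).isLt
      have := q.isLt
      have := (h u).isLt
      omega
    obtain ⟨g', hg', hd'⟩ := hH.back hlq (adv (h u) i) (by omega)
    unfold queryStops
    rw [probe_eq]
    rcases hTi : T (adv (h u) i) with _ | v | g
    · simp [layout, hTi, slotHash] at hg'
    · simp only [layout, hTi, slotHash, Option.some.injEq] at hg'
      have hv : v ≠ u := by
        rintro rfl
        exact hne (hT.slot_unique hTi hq)
      subst hg'
      simp only [hv, decide_false, Bool.false_or, Bool.not_eq_true', decide_eq_false_iff_not]
      omega
    · rfl

theorem deleteKey_of_mem {h : U → Fin n} {T : Table n U} {A : Finset U}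
    (hH : Ordered (layout h T)) (hT : KeysAre T A) {u : U} (hu : u ∈ A) :
    ∃ q, T q = .key u ∧ deleteKey h T u = Function.update T q (.tomb (h u)) := by
  obtain ⟨k, -, h1, h2⟩ := queryOffset_of_mem hH hT hu
  refine ⟨adv (h u) k, h2, ?_⟩
  unfold deleteKey
  simp [h1, probe_eq, h2]

theorem deleteKey_of_not_mem {h : U → Fin n} {T : Table n U} {A : Finset U}
    (hT : KeysAre T A) {u : U} (hu : u ∉ A) : deleteKey h T u = T := by
  unfold deleteKey
  rcases queryOffset h T u with _ | k
  · rfl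
  · simp only
    rcases hk : T (probe h u k) with _ | v | g
    · rfl
    · have : v ≠ u := by
        rintro rfl
        exact hu (hT.mem hk)
      simp [this]
    · rfl

/-- A tombstone keeps the hash of the deleted key. -/
theorem layout_deleteKey {h : U → Fin n} {T : Table n U} {A : Finset U}
    (hH : Ordered (layout h T)) (hT : KeysAre T A) (u : U) :
    layout h (deleteKey h T u) = layout h T := by
  by_cases hu : u ∈ A
  · obtain ⟨q, h1, h2⟩ := deleteKey_of_mem hH hT hu
    rw [h2]
    funext r
    unfold layout
    by_cases hr : r = q
    · subst hr
      simp [h1, slotHash]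
    · rw [Function.update_of_ne hr]
  · rw [deleteKey_of_not_mem hT hu]

theorem keysAre_deleteKey {h : U → Fin n} {T : Table n U} {A : Finset U}
    (hH : Ordered (layout h T)) (hT : KeysAre T A) (u : U) :
    KeysAre (deleteKey h T u) (A.erase u) := by
  by_cases hu : u ∈ A
  · obtain ⟨q, h1, h2⟩ := deleteKey_of_mem hH hT hu
    rw [h2]
    intro v
    have h3 := total_update (keyWeight v) T q (.tomb (h u))
    have h4 := hT v
    rw [h1] at h3
    simp only [keyWeight, Finset.mem_erase] at h3 ⊢
    by_cases hv : u = v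
    · subst hv
      simp [hu] at h3 h4 ⊢
      omega
    · have hv' : v ≠ u := fun e => hv e.symm
      simp only [hv, hv', if_false, ne_eq, not_false_eq_true, true_and] at h3 ⊢
      omega
  · rw [deleteKey_of_not_mem hT hu, Finset.erase_eq_of_notMem hu]
    exact hT

end Queries


/-! ### Insertions -/

section Insertion

variable {n : ℕ} [NeZero n] {U : Type*}

theorem dist_pred {s q : Fin n} (hq : 0 < dist s q) : dist s (q - 1) = dist s q - 1 := by
  have h1 := dist_spec s q
  have h2 := dist_spec s (q - 1)
  have h3 := pred_spec q
  have := q.isLt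
  have := (q - 1).isLt
  have := s.isLt
  omega

theorem dist_pred_self (s : Fin n) : dist s (s - 1) = n - 1 := by
  have h2 := dist_spec s (s - 1)
  have h3 := pred_spec s
  have := (s - 1).isLt
  have := s.isLt
  omega

theorem dist_eq_pred_add_one {g q : Fin n} (hq : dist g (q - 1) + 1 < n) :
    dist g q = dist g (q - 1) + 1 := by
  have h1 := dist_spec g q
  have h2 := dist_spec g (q - 1)
  have h3 := pred_spec q
  have := q.isLt
  have := (q - 1).isLt
  have := g.isLt
  omega

/-- The rotation of the arc from offset `j` to offset `k` after `s` that an insertion performs: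
the slot at offset `j` gets its contents from offset `k`, and the others of the arc from their
predecessors. -/
def rotation (s : Fin n) (j k : ℕ) (q : Fin n) : Fin n :=
  if dist s q < j ∨ k < dist s q then q else if dist s q = j then adv s k else q - 1

theorem dist_rotation (s : Fin n) {j k : ℕ} (hk : k < n) (q : Fin n) :
    dist s (rotation s j k q) =
      if dist s q < j ∨ k < dist s q then dist s q else if dist s q = j then k else dist s q - 1 := by
  unfold rotation
  split_ifs with h1 h2
  · rfl
  · exact dist_adv s hk
  · exact dist_pred (by omega)

theorem rotation_bijective (s : Fin n) {j k : ℕ} (hk : k < n) :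
    Function.Bijective (rotation s j k) := by
  rw [← Finite.injective_iff_bijective]
  intro q q' hqq
  have h1 := dist_rotation s (j := j) hk q
  have h2 := dist_rotation s (j := j) hk q'
  rw [hqq, h2] at h1
  apply dist_inj (g := s)
  split_ifs at h1 <;> omega

/-- The insertion of `u` puts `u` at offset `j` from its hash and makes use of the slot at offset
`k`. -/
structure InsertsAt (h : U → Fin n) (T : Table n U) (u : U) (j k : ℕ) : Prop where
  le : j ≤ k
  lt : k < n
  before : ∀ i < j, ∃ g, layout h T (adv (h u) i) = some g ∧ i < dist g (adv (h u) i)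
  place : ∀ g, layout h T (adv (h u) j) = some g → dist g (adv (h u) j) ≤ j
  between : ∀ i, j ≤ i → i < k → ∃ v, T (adv (h u) i) = .key v
  used : T (adv (h u) k) = .free ∨ ∃ g, T (adv (h u) k) = .tomb g

theorem not_belongs {h : U → Fin n} {T : Table n U} {u : U} {i : ℕ}
    (hi : belongs h T u i = false) :
    ∃ g, layout h T (adv (h u) i) = some g ∧ i < dist g (adv (h u) i) := by
  unfold belongs at hi
  rw [show probe h u i = adv (h u) i from rfl] at hi
  unfold layout
  rcases hT : T (adv (h u) i) with _ | v | g <;> simp [hT] at hi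
  · exact ⟨_, rfl, hi⟩
  · exact ⟨_, rfl, hi⟩

theorem exists_insertsAt {h : U → Fin n} {T : Table n U} {p : Fin n} (hp : T p = .free) (u : U) :
    ∃ j k, insertOffsets h T u = some (j, k) ∧ InsertsAt h T u j k := by
  have hpn := (dist_spec (h u) p).1
  have hpp : T (adv (h u) (dist (h u) p)) = .free := by rw [adv_dist, hp]
  have hbel : belongs h T u (dist (h u) p) = true := by
    unfold belongs
    rw [probe_eq, hpp]
  have huse : (T (probe h u (dist (h u) p))).usable = true := by
    rw [probe_eq, hpp]
    rfl
  obtain ⟨j, hj⟩ : ∃ j, (List.range n).find? (belongs h T u) = some j := by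
    rw [← Option.isSome_iff_exists, List.find?_isSome]
    exact ⟨dist (h u) p, by simpa using hpn, hbel⟩
  have hj' := List.find?_range_eq_some.1 hj
  have hjp : j ≤ dist (h u) p := by
    by_contra hlt
    have := hj'.2.2 (dist (h u) p) (by omega)
    simp [hbel] at this
  obtain ⟨k, hk⟩ : ∃ k, (List.range n).find?
      (fun k => decide (j ≤ k) && (T (probe h u k)).usable) = some k := by
    rw [← Option.isSome_iff_exists, List.find?_isSome]
    exact ⟨dist (h u) p, by simpa using hpn, by simp [huse, hjp]⟩
  have hk' := List.find?_range_eq_some.1 hk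
  simp only [Bool.and_eq_true, decide_eq_true_eq, List.mem_range, Bool.not_eq_true',
    Bool.and_eq_false_iff, decide_eq_false_iff_not] at hk' hj'
  refine ⟨j, k, by unfold insertOffsets; simp [hj, hk], hk'.1.1, hk'.2.1, ?_, ?_, ?_, ?_⟩
  · exact fun i hi => not_belongs (hj'.2.2 i hi)
  · intro g hg
    have h1 := hj'.1
    unfold belongs at h1
    rw [show probe h u j = adv (h u) j from rfl] at h1
    unfold layout at hg
    rcases hT : T (adv (h u) j) with _ | v | g' <;> simp [hT, slotHash] at hg h1 <;>
      subst hg <;> exact h1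
  · intro i hi hik
    have h1 := hk'.2.2 i hik
    rw [show probe h u i = adv (h u) i from rfl] at h1
    rcases hT : T (adv (h u) i) with _ | v | g' <;> simp [hT, Slot.usable, hi] at h1
    exact ⟨v, rfl⟩
  · have h1 := hk'.1.2
    rw [show probe h u k = adv (h u) k from rfl] at h1
    rcases hT : T (adv (h u) k) with _ | v | g' <;> simp [hT, Slot.usable] at h1 ⊢

/-- An insertion replaces the contents of the used slot by the new key and rotates. -/
theorem insertKey_eq {h : U → Fin n} {T : Table n U} {u : U} {j k : ℕ}
    (ho : insertOffsets h T u = some (j, k)) (hI : InsertsAt h T u j k) :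
    insertKey h T u =
      Function.update T (adv (h u) k) (.key u) ∘ rotation (h u) j k := by
  have hk := dist_adv (h u) hI.lt
  funext q
  unfold insertKey
  simp only [ho, Function.comp_apply]
  unfold rotation
  split_ifs with h1
  · rw [Function.update_of_ne]
    rintro rfl
    have := hI.le
    omega
  · rw [Function.update_self]
  · rw [Function.update_of_ne]
    intro he
    have := dist_pred (s := h u) (q := q) (by omega)
    rw [he] at this
    omega

theorem total_insertKey {h : U → Fin n} {T : Table n U} {u : U} {j k : ℕ}
    (ho : insertOffsets h T u = some (j, k)) (hI : InsertsAt h T u j k) (f : Slot n U → ℕ) :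
    total f (insertKey h T u) + f (T (adv (h u) k)) = total f T + f (.key u) := by
  rw [insertKey_eq ho hI, total_comp _ _ (rotation_bijective _ hI.lt), total_update]

namespace InsertsAt

variable {h : U → Fin n} {T : Table n U} {u : U} {j k : ℕ}

/-- The hash of an entry after the place of `u` does not precede that of `u`. -/
theorem dist_le (hI : InsertsAt h T u j k) (hH : Ordered (layout h T)) {x g : Fin n}
    (h1 : j ≤ dist (h u) x) (hg : layout h T x = some g) :
    dist g x ≤ dist (h u) x := by
  by_contra hlt
  have hjn : j < n := lt_of_le_of_lt hI.le hI.lt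
  have hr : dist (adv (h u) j) x = dist (h u) x - j := by
    have h3 := dist_spec (adv (h u) j) x
    have h4 := adv_spec (h u) (k := j) hjn.le
    have h5 := dist_spec (h u) x
    have := (adv (h u) j).isLt
    have := x.isLt
    have := (h u).isLt
    omega
  obtain ⟨g', hg', hd⟩ := hH.back hg (adv (h u) j) (by omega)
  have := hI.place g' hg'
  omega

theorem le_dist_free (hI : InsertsAt h T u j k) {p : Fin n} (hp : T p = .free) :
    k ≤ dist (h u) p := by
  by_contra hlt
  rcases Nat.lt_or_ge (dist (h u) p) j with h1 | h1
  · obtain ⟨g, hg, -⟩ := hI.before _ h1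
    rw [adv_dist] at hg
    simp [layout, hp, slotHash] at hg
  · obtain ⟨v, hv⟩ := hI.between _ h1 (by omega)
    rw [adv_dist, hp] at hv
    cases hv

end InsertsAt

theorem ordered_insertKey {h : U → Fin n} {T : Table n U} {u : U} {j k : ℕ} {p : Fin n}
    (hp : T p = .free) (hH : Ordered (layout h T)) (ho : insertOffsets h T u = some (j, k))
    (hI : InsertsAt h T u j k) : Ordered (layout h (insertKey h T u)) := by
  have hjk := hI.le
  have hkn := hI.lt
  set L := layout h T with hL
  set L' := layout h (insertKey h T u) with hL'
  have hout : ∀ q, dist (h u) q < j ∨ k < dist (h u) q → L' q = L q := by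
    intro q hq
    simp only [hL', hL, layout, insertKey, ho]
    rw [if_pos hq]
  have hat : ∀ q, dist (h u) q = j → L' q = some (h u) := by
    intro q hq
    simp only [hL', layout, insertKey, ho]
    rw [if_neg (by omega), if_pos hq]
    rfl
  have hin : ∀ q, j < dist (h u) q → dist (h u) q ≤ k → L' q = L (q - 1) := by
    intro q hq hq'
    simp only [hL', hL, layout, insertKey, ho]
    rw [if_neg (by omega), if_neg (by omega)]
  have hkey : ∀ x, j ≤ dist (h u) x → dist (h u) x < k → ∃ g, L x = some g := by
    intro x h1 h2
    obtain ⟨v, hv⟩ := hI.between _ h1 h2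
    rw [adv_dist] at hv
    exact ⟨h v, by simp [hL, layout, hv, slotHash]⟩
  intro q g hg hd
  have hqn := (dist_spec (h u) q).1
  rcases Nat.eq_zero_or_pos (dist (h u) q) with h0 | h0
  · -- the slot of the hash of `u`, whose predecessor is the last slot that can be examined
    obtain rfl := dist_eq_zero h0
    rcases Nat.eq_zero_or_pos j with hj | hj
    · rw [hat (h u) (by omega)] at hg
      cases hg
      omega
    · rw [hout (h u) (by omega)] at hg
      obtain ⟨g', hg', hd'⟩ := hH _ _ hg hd
      have hn1 := dist_pred_self (h u)
      rcases Nat.lt_or_ge k (n - 1) with hlt | hge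
      · exact ⟨g', by rw [hout _ (by omega), hg'], hd'⟩
      · have h1 := hI.le_dist_free hp
        have h2 := (dist_spec (h u) p).1
        have h3 : h u - 1 = p := dist_inj (g := h u) (by omega)
        rw [h3] at hg'
        simp [hL, layout, hp, slotHash] at hg'
  · have hpred := dist_pred h0
    rcases lt_trichotomy (dist (h u) q) j with hlt | heq | hgt
    · rw [hout q (by omega)] at hg
      obtain ⟨g', hg', hd'⟩ := hH _ _ hg hd
      exact ⟨g', by rw [hout _ (by omega), hg'], hd'⟩
    · rw [hat q heq] at hg
      cases hg
      obtain ⟨g', hg', hd'⟩ := hI.before (dist (h u) (q - 1)) (by omega)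
      rw [adv_dist] at hg' hd'
      exact ⟨g', by rw [hout _ (by omega)]; exact hg', by omega⟩
    · rcases Nat.lt_or_ge k (dist (h u) q) with hk | hk
      · rw [hout q (by omega)] at hg
        obtain ⟨g', hg', hd'⟩ := hH _ _ hg hd
        rcases Nat.lt_or_ge k (dist (h u) (q - 1)) with hk' | hk'
        · exact ⟨g', by rw [hout _ (by omega), hg'], hd'⟩
        · have hb := hI.dist_le hH (x := q - 1) (by omega) hg'
          rcases Nat.eq_or_lt_of_le hjk with hjk' | hjk'
          · exact ⟨h u, hat _ (by omega), by omega⟩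
          · have hpp := dist_pred (s := h u) (q := q - 1) (by omega)
            obtain ⟨g2, hg2⟩ := hkey (q - 1 - 1) (by omega) (by omega)
            have hb2 := hI.dist_le hH (x := q - 1 - 1) (by omega) hg2
            have he := dist_eq_pred_add_one (g := g2) (q := q - 1) (by omega)
            refine ⟨g2, by rw [hin _ (by omega) (by omega), hg2], ?_⟩
            rcases Nat.eq_zero_or_pos (dist g' (q - 1)) with h0' | h0'
            · omega
            · obtain ⟨g3, hg3, hd3⟩ := hH _ _ hg' h0'
              rw [hg2] at hg3
              cases hg3
              omega
      · rw [hin q hgt hk] at hg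
        have hb := hI.dist_le hH (x := q - 1) (by omega) hg
        have he := dist_eq_pred_add_one (g := g) (q := q) (by omega)
        rcases Nat.eq_or_lt_of_le (show j ≤ dist (h u) (q - 1) by omega) with hj | hj
        · exact ⟨h u, hat _ hj.symm, by omega⟩
        · have hpp := dist_pred (s := h u) (q := q - 1) (by omega)
          obtain ⟨g2, hg2⟩ := hkey (q - 1 - 1) (by omega) (by omega)
          have hb2 := hI.dist_le hH (x := q - 1 - 1) (by omega) hg2
          have he2 := dist_eq_pred_add_one (g := g2) (q := q - 1) (by omega)
          refine ⟨g2, by rw [hin _ (by omega) (by omega), hg2], ?_⟩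
          rcases Nat.eq_zero_or_pos (dist g (q - 1)) with h0' | h0'
          · omega
          · obtain ⟨g3, hg3, hd3⟩ := hH _ _ hg h0'
            rw [hg2] at hg3
            cases hg3
            omega

theorem keysAre_insertKey [DecidableEq U] {h : U → Fin n} {T : Table n U} {A : Finset U} {u : U}
    {j k : ℕ} (hT : KeysAre T A) (hu : u ∉ A) (ho : insertOffsets h T u = some (j, k))
    (hI : InsertsAt h T u j k) : KeysAre (insertKey h T u) (insert u A) := by
  intro v
  have h1 := total_insertKey ho hI (keyWeight v)
  have h2 := hT v
  have h3 : keyWeight v (T (adv (h u) k)) = 0 := by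
    rcases hI.used with hk | ⟨g, hk⟩ <;> rw [hk] <;> rfl
  rw [h3] at h1
  simp only [keyWeight, Finset.mem_insert] at h1 ⊢
  by_cases hv : u = v
  · subst hv
    simp [hu] at h1 h2 ⊢
    omega
  · have hv' : v ≠ u := fun e => hv e.symm
    simp only [hv, hv', if_false, false_or] at h1 ⊢
    omega

/-- Where the search of an insertion for a usable slot ends, as a hash: the hash of the tombstone
of which it makes use, or the position of the free slot. -/
def landing (h : U → Fin n) (T : Table n U) (u : U) (k : ℕ) : Fin n :=
  match T (adv (h u) k) with
  | .tomb g => g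
  | _ => adv (h u) k

namespace InsertsAt

variable {h : U → Fin n} {T : Table n U} {u : U} {j k : ℕ}

/-- The hash of the tombstone of which the insertion makes use does not precede that of `u`. -/
theorem landing_cases (hI : InsertsAt h T u j k) (hH : Ordered (layout h T)) :
    (T (adv (h u) k) = .free ∧ landing h T u k = adv (h u) k ∧ dist (h u) (landing h T u k) = k) ∨
    (∃ g, T (adv (h u) k) = .tomb g ∧ landing h T u k = g ∧ dist g (adv (h u) k) ≤ k ∧
      dist (h u) g = k - dist g (adv (h u) k)) := by
  have hk := dist_adv (h u) hI.lt
  rcases hI.used with hT | ⟨g, hT⟩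
  · have hl : landing h T u k = adv (h u) k := by simp [landing, hT]
    exact Or.inl ⟨hT, hl, by rw [hl, hk]⟩
  · have hb := hI.dist_le hH (x := adv (h u) k) (g := g) (by have := hI.le; omega)
      (by simp [layout, hT, slotHash])
    refine Or.inr ⟨g, hT, by simp [landing, hT], by omega, ?_⟩
    have h1 := dist_spec (h u) (adv (h u) k)
    have h2 := dist_spec g (adv (h u) k)
    have h3 := dist_spec (h u) g
    have := g.isLt
    have := (adv (h u) k).isLt
    have := (h u).isLt
    omega

theorem landing_le (hI : InsertsAt h T u j k) (hH : Ordered (layout h T)) :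
    dist (h u) (landing h T u k) ≤ k := by
  rcases hI.landing_cases hH with ⟨-, -, h1⟩ | ⟨g, -, h1, h2, h3⟩
  · omega
  · rw [h1]; omega

/-- There is no tombstone whose hash lies between the hash of `u` and the landing point: an
insertion makes use of the first tombstone in the order of the hashes. -/
theorem no_tomb (hI : InsertsAt h T u j k) (hH : Ordered (layout h T)) {p : Fin n}
    (hp : T p = .free) {r g : Fin n} (hr : T r = .tomb g) :
    dist (h u) (landing h T u k) ≤ dist (h u) g := by
  have hlg : layout h T r = some g := by simp [layout, hr, slotHash]
  have hpr := hH.lt_dist_free (p := p) (by simp [layout, hp, slotHash]) hlg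
  have hkp := hI.le_dist_free hp
  have hlk := hI.landing_le hH
  have hjk := hI.le
  have hkn := hI.lt
  have e1 := dist_spec (h u) r
  have e2 := dist_spec g r
  have e3 := dist_spec (h u) g
  have e4 := dist_spec p r
  have e5 := dist_spec (h u) p
  have b1 := g.isLt
  have b2 := r.isLt
  have b3 := (h u).isLt
  have b4 := p.isLt
  rcases Nat.lt_or_ge (dist (h u) r) j with h1 | h1
  · obtain ⟨g', hg', hd⟩ := hI.before _ h1
    rw [adv_dist, hlg] at hg'
    cases hg'
    rw [adv_dist] at hd
    omega
  · rcases Nat.lt_or_ge (dist (h u) r) k with h2 | h2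
    · obtain ⟨v, hv⟩ := hI.between _ h1 h2
      rw [adv_dist, hr] at hv
      cases hv
    · have ek := adv_spec (h u) hkn.le
      have bk := (adv (h u) k).isLt
      have e6 := dist_spec (adv (h u) k) r
      rcases hI.landing_cases hH with ⟨hf, -, h3⟩ | ⟨g', hg', h3, h4, h5⟩
      · have := hH.lt_dist_free (p := adv (h u) k) (by simp [layout, hf, slotHash]) hlg
        omega
      · rw [h3]
        rcases Nat.lt_or_ge (dist g r) (dist (adv (h u) k) r) with h6 | h6
        · omega
        · obtain ⟨g2, hg2, hd2⟩ := hH.back hlg _ h6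
          simp only [layout, hg', slotHash, Option.some.injEq] at hg2
          subst hg2
          omega

/-- The slots between the place of `u` and the used slot hold keys, the hashes of which lie between
the hash of `u` and the landing point. -/
theorem le_card [DecidableEq U] {A : Finset U} (hI : InsertsAt h T u j k)
    (hH : Ordered (layout h T)) (hT : KeysAre T A) :
    k ≤ j + (A.filter (fun v => dist (h u) (h v) ≤ dist (h u) (landing h T u k))).card := by
  have hkn := hI.lt
  have : (Finset.Ico j k).card ≤
      (A.filter (fun v => dist (h u) (h v) ≤ dist (h u) (landing h T u k))).card := by
    have hex : ∀ i ∈ Finset.Ico j k, ∃ v, T (adv (h u) i) = .key v := fun i hi =>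
      hI.between i (Finset.mem_Ico.1 hi).1 (Finset.mem_Ico.1 hi).2
    have : Nonempty U := ⟨u⟩
    choose! v hv using hex
    refine Finset.card_le_card_of_injOn v ?_ ?_
    · intro i hi
      have hvi := hv i hi
      simp only [Finset.coe_Ico, Set.mem_Ico] at hi
      have hi' := dist_adv (h u) (k := i) (by omega)
      have hli : layout h T (adv (h u) i) = some (h (v i)) := by simp [layout, hvi, slotHash]
      have hb := hI.dist_le hH (by omega) hli
      simp only [Finset.coe_filter, Set.mem_ofPred_eq]
      refine ⟨hT.mem hvi, ?_⟩
      have e1 := dist_spec (h u) (adv (h u) i)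
      have e2 := dist_spec (h (v i)) (adv (h u) i)
      have e3 := dist_spec (h u) (h (v i))
      have b1 := (h (v i)).isLt
      have b2 := (adv (h u) i).isLt
      have b3 := (h u).isLt
      rcases hI.landing_cases hH with ⟨-, -, h3⟩ | ⟨g', hg', h3, h4, h5⟩
      · omega
      · rw [h3]
        have ek := adv_spec (h u) hkn.le
        have bk := (adv (h u) k).isLt
        have e6 := dist_spec (adv (h u) i) (adv (h u) k)
        rcases Nat.lt_or_ge (dist g' (adv (h u) k)) (dist (adv (h u) i) (adv (h u) k)) with h6 | h6
        · omega
        · obtain ⟨g2, hg2, hd2⟩ := hH.back (q := adv (h u) k) (g := g')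
            (by simp [layout, hg', slotHash]) _ h6
          rw [hli] at hg2
          cases hg2
          omega
    · intro i hi i' hi' hii
      have h1 := hv i hi
      have h2 := hv i' hi'
      simp only [Finset.coe_Ico, Set.mem_Ico] at hi hi'
      rw [hii] at h1
      have := hT.slot_unique h1 h2
      rw [← dist_adv (h u) (k := i) (by omega), this, dist_adv (h u) (k := i') (by omega)]
  rw [Nat.card_Ico] at this
  omega

end InsertsAt

end Insertion


/-! ### The tombstones created by a rebuild -/

section Tombstones

variable {n : ℕ} [NeZero n]

theorem count_map_range {α : Type*} [DecidableEq α] (τ : ℕ → α) (m : ℕ) (a : α) :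
    ((List.range m).map τ).count a = ∑ i ∈ Finset.range m, if τ i = a then 1 else 0 := by
  induction m with
  | zero => simp
  | succ m ih =>
    rw [List.range_succ, List.map_append, List.count_append, ih, Finset.sum_range_succ]
    simp [List.count_singleton]

theorem sum_count_tombHashes (f : ℕ) (P : Fin n → Prop) [DecidablePred P] :
    ∑ g ∈ Finset.univ.filter P, (tombHashes n f).count g =
      ((Finset.range (f / 2)).filter (fun i => P (Fin.ofNat n (2 * (i + 1) * n / f)))).card := by
  unfold tombHashes
  simp_rw [count_map_range]
  rw [Finset.sum_comm, Finset.card_filter]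
  refine Finset.sum_congr rfl fun i _ => ?_
  rw [Finset.sum_ite_eq]
  simp

theorem sum_count_tombHashes_univ (f : ℕ) :
    ∑ g : Fin n, (tombHashes n f).count g = f / 2 := by
  have := sum_count_tombHashes (n := n) f (fun _ => True)
  simpa using this

/-- The hashes below `b` have `b f / (2 n)` new tombstones, up to an error of one. -/
theorem prefix_tombHashes {f b : ℕ} (hb : b ≤ n) :
    b * f ≤ 2 * n * (∑ g ∈ Finset.univ.filter (fun g : Fin n => g.val < b),
        (tombHashes n f).count g) + 2 * n ∧
      2 * n * (∑ g ∈ Finset.univ.filter (fun g : Fin n => g.val < b),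
        (tombHashes n f).count g) ≤ b * f + 2 * n := by
  have hn : 0 < n := Nat.pos_of_ne_zero (NeZero.ne n)
  rw [sum_count_tombHashes]
  rcases Nat.eq_zero_or_pos f with rfl | hf
  · simp
  set K := (b * f - 1) / (2 * n) with hK
  have hK1 : 2 * n * K ≤ b * f - 1 := Nat.mul_div_le _ _
  have hK2 : b * f - 1 < 2 * n * (K + 1) := Nat.lt_mul_div_succ _ (by omega)
  have hsub1 : Finset.range K ⊆ (Finset.range (f / 2)).filter
      (fun i => (Fin.ofNat n (2 * (i + 1) * n / f)).val < b) := by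
    intro i hi
    rw [Finset.mem_range] at hi
    have h1 : 2 * (i + 1) * n < b * f := by
      have : 2 * n * (i + 1) ≤ 2 * n * K := Nat.mul_le_mul_left _ hi
      have h3 : 2 * (i + 1) * n = 2 * n * (i + 1) := by ring
      have : 0 < 2 * n * (i + 1) := by positivity
      omega
    have h2 : 2 * (i + 1) < f := by
      have : 2 * (i + 1) * n < f * n := by
        calc _ < b * f := h1
          _ ≤ n * f := Nat.mul_le_mul_right _ hb
          _ = f * n := mul_comm _ _
      exact lt_of_mul_lt_mul_right this (Nat.zero_le _)
    have h3 : 2 * (i + 1) * n / f < b := (Nat.div_lt_iff_lt_mul hf).2 h1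
    rw [Finset.mem_filter, Finset.mem_range]
    refine ⟨by omega, ?_⟩
    simp only [Fin.val_ofNat]
    rw [Nat.mod_eq_of_lt (by omega)]
    exact h3
  have hsub2 : (Finset.range (f / 2)).filter
      (fun i => (Fin.ofNat n (2 * (i + 1) * n / f)).val < b) ⊆
        insert (f / 2 - 1) (Finset.range K) := by
    intro i hi
    rw [Finset.mem_filter, Finset.mem_range] at hi
    rw [Finset.mem_insert, Finset.mem_range]
    obtain ⟨h1, h2⟩ := hi
    simp only [Fin.val_ofNat] at h2
    by_cases h3 : i = f / 2 - 1
    · exact Or.inl h3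
    · right
      have h4 : 2 * (i + 1) < f := by omega
      have h5 : 2 * (i + 1) * n / f < n := by
        rw [Nat.div_lt_iff_lt_mul hf, mul_comm n f]
        exact Nat.mul_lt_mul_of_pos_right h4 hn
      rw [Nat.mod_eq_of_lt h5, Nat.div_lt_iff_lt_mul hf] at h2
      by_contra hiK
      have : 2 * n * (K + 1) ≤ 2 * n * (i + 1) := Nat.mul_le_mul_left _ (by omega)
      have h6 : 2 * (i + 1) * n = 2 * n * (i + 1) := by ring
      omega
  have hc1 := Finset.card_le_card hsub1
  have hc2 := (Finset.card_le_card hsub2).trans (Finset.card_insert_le _ _)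
  rw [Finset.card_range] at hc1 hc2
  set c := ((Finset.range (f / 2)).filter
      (fun i => (Fin.ofNat n (2 * (i + 1) * n / f)).val < b)).card
  have h1 : 2 * n * K ≤ 2 * n * c := Nat.mul_le_mul_left _ hc1
  have h2 : 2 * n * c ≤ 2 * n * (K + 1) := Nat.mul_le_mul_left _ hc2
  have h3 : 2 * n * (K + 1) = 2 * n * K + 2 * n := by ring
  omega

/-- An arc of `l` hashes has `l f / (2 n)` new tombstones, up to an error of three. -/
theorem arc_tombHashes {f l : ℕ} (s : Fin n) (hl : l ≤ n) :
    l * f ≤ 2 * n * (∑ g ∈ Finset.univ.filter (fun g : Fin n => dist s g < l),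
        (tombHashes n f).count g) + 6 * n ∧
      2 * n * (∑ g ∈ Finset.univ.filter (fun g : Fin n => dist s g < l),
        (tombHashes n f).count g) ≤ l * f + 6 * n := by
  have hs := s.isLt
  set t := fun b => ∑ g ∈ Finset.univ.filter (fun g : Fin n => g.val < b),
    (tombHashes n f).count g with ht
  set a := ∑ g ∈ Finset.univ.filter (fun g : Fin n => dist s g < l), (tombHashes n f).count g
    with ha
  have hpre : ∀ b ≤ n, b * f ≤ 2 * n * t b + 2 * n ∧ 2 * n * t b ≤ b * f + 2 * n :=
    fun b hb => prefix_tombHashes hb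
  rcases Nat.lt_or_ge n (s.val + l) with h | h
  · have key : a + t s = t n + t (s + l - n) := by
      simp only [ha, ht, Finset.sum_filter]
      rw [← Finset.sum_add_distrib, ← Finset.sum_add_distrib]
      refine Finset.sum_congr rfl fun g _ => ?_
      have h1 := dist_spec s g
      have := g.isLt
      split_ifs <;> omega
    have h1 := hpre s hs.le
    have h2 := hpre n le_rfl
    have h3 := hpre (s + l - n) (by omega)
    have h4 : (s + l - n) * f + n * f = s * f + l * f := by
      rw [← add_mul, ← add_mul]
      congr 1
      omega
    have h5 : 2 * n * a + 2 * n * t s = 2 * n * t n + 2 * n * t (s + l - n) := by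
      rw [← mul_add, ← mul_add, key]
    omega
  · have key : a + t s = t (s + l) := by
      simp only [ha, ht, Finset.sum_filter]
      rw [← Finset.sum_add_distrib]
      refine Finset.sum_congr rfl fun g _ => ?_
      have h1 := dist_spec s g
      have := g.isLt
      split_ifs <;> omega
    have h1 := hpre s hs.le
    have h3 := hpre (s + l) h
    have h4 : (s + l) * f = s * f + l * f := add_mul _ _ _
    have h5 : 2 * n * a + 2 * n * t s = 2 * n * t (s + l) := by rw [← mul_add, key]
    omega

end Tombstones


/-! ### The length of a queue with periodic arrivals -/

section QueueLength

variable {n : ℕ} {b L : ℕ → ℕ}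

theorem sum_range_periodic (hb : ∀ t, b (t + n) = b t) (t : ℕ) :
    ∑ i ∈ Finset.range n, b (t + i) = ∑ i ∈ Finset.range n, b i := by
  induction t with
  | zero => simp
  | succ t ih =>
    rw [← ih]
    have h1 := Finset.sum_range_succ (fun i => b (t + i)) n
    have h2 := Finset.sum_range_succ' (fun i => b (t + i)) n
    have h3 : ∑ i ∈ Finset.range n, b (t + 1 + i) = ∑ i ∈ Finset.range n, b (t + (i + 1)) :=
      Finset.sum_congr rfl fun i _ => by congr 1; ring
    have := hb t
    simp only [add_zero] at h2
    omega

/-- A queue that serves one entry at each time and receives at most `n` entries in any `n`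
consecutive steps never has more than `n` entries. The induction is over the bounds for the entries
that wait at time `t` or arrive in the next `k` steps, for all `k < n` at once. -/
theorem queue_add_le (hn : 0 < n) (hb : ∀ t, b (t + n) = b t)
    (hm : ∑ i ∈ Finset.range n, b i ≤ n) (h0 : L 0 = 0) (hL : ∀ t, L (t + 1) = L t + b t - 1)
    (t : ℕ) : L t + b t ≤ n := by
  have hwin : ∀ t k, k < n → ∑ i ∈ Finset.range (k + 1), b (t + i) ≤ n := by
    intro t k hk
    calc _ ≤ ∑ i ∈ Finset.range n, b (t + i) :=
          Finset.sum_le_sum_of_subset (Finset.range_subset_range.2 hk)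
      _ = ∑ i ∈ Finset.range n, b i := sum_range_periodic hb t
      _ ≤ n := hm
  have key : ∀ t k, k < n → L t + ∑ i ∈ Finset.range (k + 1), b (t + i) ≤ n + k := by
    intro t
    induction t with
    | zero =>
      intro k hk
      have := hwin 0 k hk
      omega
    | succ t ih =>
      intro k hk
      rcases Nat.eq_zero_or_pos (L (t + 1)) with h | h
      · have := hwin (t + 1) k hk
        omega
      · have h1 := Finset.sum_range_succ' (fun i => b (t + i)) (k + 1)
        have h3 : ∑ i ∈ Finset.range (k + 1), b (t + 1 + i)
            = ∑ i ∈ Finset.range (k + 1), b (t + (i + 1)) :=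
          Finset.sum_congr rfl fun i _ => by congr 1; ring
        simp only [add_zero] at h1
        have h4 := hL t
        rcases Nat.lt_or_ge (k + 1) n with h5 | h5
        · have := ih (k + 1) h5
          omega
        · obtain rfl : n = k + 1 := by omega
          have h6 := ih 0 hn
          simp only [zero_add, Finset.sum_range_one, add_zero] at h6
          have h7 := Finset.sum_range_succ (fun i => b (t + i)) (k + 1)
          have h8 := sum_range_periodic hb t
          have h9 := hb t
          omega
  have := key t 0 hn
  simpa using this

/-- After one period the queue is in its steady state. -/
theorem queue_periodic (hb : ∀ t, b (t + n) = b t)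
    (hm : ∑ i ∈ Finset.range n, b i ≤ n) (h0 : L 0 = 0) (hL : ∀ t, L (t + 1) = L t + b t - 1) :
    L (n + n) = L n := by
  have h1 : ∀ s, L s ≤ L (n + s) := by
    intro s
    induction s with
    | zero => omega
    | succ s ih =>
      have e1 := hL s
      have e2 := hL (n + s)
      have e3 := hb s
      rw [add_comm s n] at e3
      rw [← add_assoc]
      omega
  have h2 : ∀ s, L (n + s) ≤ L s ∨ L (n + s) + s ≤ L n + ∑ i ∈ Finset.range s, b i := by
    intro s
    induction s with
    | zero => right; simp
    | succ s ih =>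
      have e1 := hL s
      have e2 := hL (n + s)
      have e3 := hb s
      rw [add_comm s n] at e3
      rw [← add_assoc, Finset.sum_range_succ]
      omega
  have h3 := h1 n
  have h4 := h2 n
  omega

end QueueLength

/-! ### The queue of the sweeps -/

section Queue

variable {n : ℕ} [NeZero n] {U : Type*}

/-- The queue of the sweeps before position `t` (modulo `n`) is visited, in a sweep without end.
Each entry is kept with the time at which it joined. -/
def queueAt (B : Buckets n U) : ℕ → List (Slot n U × ℕ)
  | 0 => []
  | t + 1 => (queueAt B t ++ (B (Fin.ofNat n t)).map (fun s => (s, t))).tail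

/-- The queue at time `t`, after the entries of bucket `t` have joined. -/
def lineAt (B : Buckets n U) (t : ℕ) : List (Slot n U × ℕ) :=
  queueAt B t ++ (B (Fin.ofNat n t)).map (fun s => (s, t))

/-- The slot written at time `t`. -/
def writtenAt (B : Buckets n U) (t : ℕ) : Slot n U := ((lineAt B t).map Prod.fst).headD .free

theorem queueAt_succ (B : Buckets n U) (t : ℕ) : queueAt B (t + 1) = (lineAt B t).tail := rfl

theorem ofNat_add_self (t : ℕ) : Fin.ofNat n (t + n) = Fin.ofNat n t := by
  apply Fin.ext
  simp

theorem ofNat_val (q : Fin n) : Fin.ofNat n q.val = q := by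
  apply Fin.ext
  simp

theorem map_fst_lineAt (B : Buckets n U) (t : ℕ) :
    (lineAt B t).map Prod.fst = (queueAt B t).map Prod.fst ++ B (Fin.ofNat n t) := by
  simp [lineAt, Function.comp_def]

theorem sum_buckets (B : Buckets n U) (f : List (Slot n U) → ℕ) :
    ∑ i ∈ Finset.range n, f (B (Fin.ofNat n i)) = ∑ g, f (B g) := by
  rw [Finset.sum_range]
  exact Finset.sum_congr rfl fun g _ => by rw [ofNat_val]

theorem length_queueAt_succ (B : Buckets n U) (t : ℕ) :
    (queueAt B (t + 1)).length = (queueAt B t).length + (B (Fin.ofNat n t)).length - 1 := by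
  simp [queueAt]

theorem length_lineAt_le {B : Buckets n U} (hB : ∑ g, (B g).length ≤ n) (t : ℕ) :
    (lineAt B t).length ≤ n := by
  have := queue_add_le (n := n) (b := fun t => (B (Fin.ofNat n t)).length)
    (L := fun t => (queueAt B t).length) (Nat.pos_of_ne_zero (NeZero.ne n))
    (fun t => by simp only [ofNat_add_self]) (by rw [sum_buckets B List.length]; exact hB) rfl
    (length_queueAt_succ B) t
  simpa [lineAt] using this

theorem length_queueAt_periodic {B : Buckets n U} (hB : ∑ g, (B g).length ≤ n) :
    (queueAt B (n + n)).length = (queueAt B n).length :=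
  queue_periodic (n := n) (b := fun t => (B (Fin.ofNat n t)).length)
    (L := fun t => (queueAt B t).length)
    (fun t => by simp only [ofNat_add_self]) (by rw [sum_buckets B List.length]; exact hB) rfl
    (length_queueAt_succ B)

/-- No entry waits for `n` steps. -/
theorem age_lineAt {B : Buckets n U} (hB : ∑ g, (B g).length ≤ n) (t : ℕ) :
    ∀ i x, (lineAt B t)[i]? = some x → x.2 ≤ t ∧ t + i < x.2 + n := by
  have key : ∀ t, (∀ i x, (queueAt B t)[i]? = some x → x.2 < t ∧ t + i < x.2 + n) →
      ∀ i x, (lineAt B t)[i]? = some x → x.2 ≤ t ∧ t + i < x.2 + n := by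
    intro t ht i x hx
    have hl := length_lineAt_le hB t
    have hi : i < (lineAt B t).length := (List.getElem?_eq_some_iff.1 hx).1
    unfold lineAt at hx
    rw [List.getElem?_append] at hx
    split_ifs at hx with hlt
    · have := ht i x hx
      omega
    · rw [List.getElem?_map, Option.map_eq_some_iff] at hx
      obtain ⟨s, -, rfl⟩ := hx
      simp only
      omega
  apply key
  induction t with
  | zero => intro i x hx; simp [queueAt] at hx
  | succ t ih =>
    intro i x hx
    rw [queueAt_succ, List.getElem?_tail] at hx
    have := key t ih _ _ hx
    omega

/-- First in, first out. -/
theorem sorted_lineAt (B : Buckets n U) (t : ℕ) :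
    (lineAt B t).Pairwise (fun x y => x.2 ≤ y.2) := by
  have key : ∀ t, (queueAt B t).Pairwise (fun x y => x.2 ≤ y.2) →
      (∀ x ∈ queueAt B t, x.2 ≤ t) → (lineAt B t).Pairwise (fun x y => x.2 ≤ y.2) ∧
        ∀ x ∈ lineAt B t, x.2 ≤ t := by
    intro t h1 h2
    unfold lineAt
    rw [List.pairwise_append]
    refine ⟨⟨h1, ?_, ?_⟩, ?_⟩
    · rw [List.pairwise_map]
      exact List.pairwise_of_forall fun _ _ => le_rfl
    · intro x hx y hy
      obtain ⟨s, -, rfl⟩ := List.mem_map.1 hy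
      exact h2 x hx
    · intro x hx
      rcases List.mem_append.1 hx with hx | hx
      · exact h2 x hx
      · obtain ⟨s, -, rfl⟩ := List.mem_map.1 hx
        exact le_rfl
  suffices h : (queueAt B t).Pairwise (fun x y => x.2 ≤ y.2) ∧ ∀ x ∈ queueAt B t, x.2 ≤ t from
    (key t h.1 h.2).1
  induction t with
  | zero => simp [queueAt]
  | succ t ih =>
    have := key t ih.1 ih.2
    rw [queueAt_succ]
    exact ⟨this.1.tail, fun x hx => (this.2 x (List.mem_of_mem_tail hx)).trans (Nat.le_succ t)⟩

theorem hash_lineAt {h : U → Fin n} {B : Buckets n U}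
    (hB : ∀ g, ∀ s ∈ B g, slotHash h s = some g) (t : ℕ) :
    ∀ x ∈ lineAt B t, slotHash h x.1 = some (Fin.ofNat n x.2) := by
  have key : ∀ t, (∀ x ∈ queueAt B t, slotHash h x.1 = some (Fin.ofNat n x.2)) →
      ∀ x ∈ lineAt B t, slotHash h x.1 = some (Fin.ofNat n x.2) := by
    intro t ht x hx
    rcases List.mem_append.1 hx with hx | hx
    · exact ht x hx
    · obtain ⟨s, hs, rfl⟩ := List.mem_map.1 hx
      exact hB _ s hs
  apply key
  induction t with
  | zero => simp [queueAt]
  | succ t ih => exact fun x hx => key t ih x (List.mem_of_mem_tail hx)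

/-- The entries that arrive in an interval of time, together with those that wait before, are
those written in the meantime, followed by those that wait afterwards. -/
theorem queueAt_append (B : Buckets n U) (t r : ℕ) :
    (queueAt B t).map Prod.fst ++ (List.range r).flatMap (fun i => B (Fin.ofNat n (t + i))) =
      (List.range r).flatMap (fun i => ((lineAt B (t + i)).map Prod.fst).head?.toList) ++
        (queueAt B (t + r)).map Prod.fst := by
  induction r with
  | zero => simp
  | succ r ih =>
    rw [List.range_succ, List.flatMap_append, List.flatMap_append, ← List.append_assoc, ih,
      List.append_assoc, List.append_assoc]
    congr 1
    rw [List.flatMap_singleton, List.flatMap_singleton, ← map_fst_lineAt, ← add_assoc,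
      queueAt_succ]
    rcases lineAt B (t + r) with _ | ⟨x, l⟩ <;> simp

theorem flatMap_buckets (B : Buckets n U) (r : ℕ) :
    (List.range r).flatMap (fun i => B (Fin.ofNat n (n + i)))
      = (List.range r).flatMap (fun i => B (Fin.ofNat n (0 + i))) := by
  congr 1
  funext i
  rw [add_comm n i, ofNat_add_self, zero_add]

/-- The second sweep ends with the same queue as the first one. Both queues are suffixes of the list
of all entries in the order of their hashes, and they have the same length. -/
theorem queueAt_periodic {B : Buckets n U} (hB : ∑ g, (B g).length ≤ n) :
    (queueAt B (n + n)).map Prod.fst = (queueAt B n).map Prod.fst := by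
  have h1 := queueAt_append B 0 n
  have h2 := queueAt_append B n n
  rw [flatMap_buckets] at h2
  set A := (List.range n).flatMap (fun i => B (Fin.ofNat n (0 + i)))
  have hl := length_queueAt_periodic hB
  simp only [queueAt, List.map_nil, List.nil_append, zero_add] at h1
  have hs1 : (queueAt B n).map Prod.fst <:+ A := ⟨_, h1.symm⟩
  have hs2 : (queueAt B (n + n)).map Prod.fst <:+ A := by
    refine List.suffix_of_suffix_length_le (l₃ := (queueAt B n).map Prod.fst ++ A)
      ⟨_, h2.symm⟩ (List.suffix_append _ _) ?_
    have := hs1.length_le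
    simpa [hl] using this
  refine List.IsSuffix.eq_of_length
    (List.suffix_of_suffix_length_le hs2 hs1 (by simp [hl])) (by simp [hl])

/-- The table that the second sweep writes. -/
def layOut (B : Buckets n U) (q : Fin n) : Slot n U := writtenAt B (n + q)

omit [NeZero n] in
theorem sum_map_flatMap_range (f : Slot n U → ℕ) (L : ℕ → List (Slot n U)) (r : ℕ) :
    (((List.range r).flatMap L).map f).sum = ∑ i ∈ Finset.range r, ((L i).map f).sum := by
  induction r with
  | zero => simp
  | succ r ih =>
    rw [List.range_succ, List.flatMap_append, List.map_append, List.sum_append, ih,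
      Finset.sum_range_succ, List.flatMap_singleton]

/-- The second sweep writes each entry of the buckets exactly once. -/
theorem total_layOut {B : Buckets n U} (hB : ∑ g, (B g).length ≤ n) (f : Slot n U → ℕ)
    (hf : f .free = 0) : total f (layOut B) = ∑ g, ((B g).map f).sum := by
  have h2 := queueAt_append B n n
  rw [flatMap_buckets, queueAt_periodic hB] at h2
  have h3 := congrArg (fun l => (l.map f).sum) h2
  simp only [List.map_append, List.sum_append, sum_map_flatMap_range, zero_add] at h3
  rw [sum_buckets B (fun l => (l.map f).sum)] at h3
  have h4 : total f (layOut B) = ∑ i ∈ Finset.range n,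
      ((((lineAt B (n + i)).map Prod.fst).head?.toList).map f).sum := by
    unfold total
    rw [Finset.sum_range]
    refine Finset.sum_congr rfl fun q _ => ?_
    unfold layOut writtenAt
    rcases lineAt B (n + q) with _ | ⟨x, l⟩ <;> simp [hf]
  omega

/-- Neighbouring slots are written at consecutive times. For the first slot of the array and its
cyclic predecessor this holds since a third sweep would repeat the second one. -/
theorem exists_time {B : Buckets n U} (hB : ∑ g, (B g).length ≤ n) (q : Fin n) :
    ∃ t, Fin.ofNat n (t + 1) = q ∧ Fin.ofNat n t = q - 1 ∧ layOut B q = writtenAt B (t + 1) ∧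
      layOut B (q - 1) = writtenAt B t := by
  have hn : 0 < n := Nat.pos_of_ne_zero (NeZero.ne n)
  have hq := q.isLt
  have hp := pred_spec q
  rcases Nat.eq_zero_or_pos q.val with h0 | h0
  · refine ⟨n + (n - 1), ?_, ?_, ?_, ?_⟩
    · apply Fin.ext
      simp only [Fin.val_ofNat]
      rw [h0, show n + (n - 1) + 1 = n + n by omega]
      simp
    · apply Fin.ext
      simp only [Fin.val_ofNat]
      rw [Nat.add_mod_left, Nat.mod_eq_of_lt (by omega)]
      omega
    · unfold layOut writtenAt
      rw [show n + (n - 1) + 1 = n + n by omega, map_fst_lineAt, map_fst_lineAt, h0, add_zero,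
        queueAt_periodic hB, ofNat_add_self]
    · unfold layOut
      congr 1
      omega
  · refine ⟨n + (q.val - 1), ?_, ?_, ?_, ?_⟩
    · apply Fin.ext
      simp only [Fin.val_ofNat]
      rw [show n + (q.val - 1) + 1 = n + q.val by omega, Nat.add_mod_left, Nat.mod_eq_of_lt hq]
    · apply Fin.ext
      simp only [Fin.val_ofNat]
      rw [Nat.add_mod_left, Nat.mod_eq_of_lt (by omega)]
      omega
    · unfold layOut
      congr 1
      omega
    · unfold layOut
      congr 1
      omega

theorem dist_ofNat {j t : ℕ} (h1 : j ≤ t) (h2 : t < j + n) :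
    dist (Fin.ofNat n j) (Fin.ofNat n t) = t - j := by
  have : Fin.ofNat n t = adv (Fin.ofNat n j) (t - j) := by
    apply Fin.ext
    simp only [adv, Fin.add_def, Fin.val_ofNat]
    rw [← Nat.add_mod]
    congr 1
    omega
  rw [this, dist_adv _ (by omega)]

/-- The queue is first in, first out, so an entry that has waited follows one that joined the queue
before it. -/
theorem ordered_layOut {h : U → Fin n} {B : Buckets n U} (hB : ∑ g, (B g).length ≤ n)
    (hh : ∀ g, ∀ s ∈ B g, slotHash h s = some g) : Ordered (layout h (layOut B)) := by
  intro q g hg hd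
  obtain ⟨t, h1, h2, h3, h4⟩ := exists_time hB q
  unfold layout at hg ⊢
  rw [h3] at hg
  rw [h4]
  unfold writtenAt at hg ⊢
  have hdist : ∀ t (x : Slot n U × ℕ) l, lineAt B t = x :: l →
      slotHash h x.1 = some (Fin.ofNat n x.2) ∧ x.2 ≤ t ∧
        dist (Fin.ofNat n x.2) (Fin.ofNat n t) = t - x.2 := by
    intro t x l hl
    have e1 := hash_lineAt hh t x (by simp [hl])
    have e2 := age_lineAt hB t 0 x (by simp [hl])
    exact ⟨e1, e2.1, dist_ofNat e2.1 (by omega)⟩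
  rcases hl : lineAt B (t + 1) with _ | ⟨x, l⟩
  · simp [hl, slotHash] at hg
  · obtain ⟨a1, a2, a3⟩ := hdist _ _ _ hl
    simp only [hl, List.map_cons, List.headD_cons] at hg
    rw [a1, Option.some.injEq] at hg
    subst hg
    rw [h1] at a3
    rcases hQ : queueAt B (t + 1) with _ | ⟨x', l'⟩
    · exfalso
      unfold lineAt at hl
      rw [hQ, List.nil_append] at hl
      have hx : x ∈ (B (Fin.ofNat n (t + 1))).map (fun s => (s, t + 1)) := by
        rw [hl]
        exact List.mem_cons_self
      have hx2 : x.2 = t + 1 := by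
        obtain ⟨s, -, rfl⟩ := List.mem_map.1 hx
        rfl
      omega
    · have hxx : x' = x := by
        unfold lineAt at hl
        rw [hQ, List.cons_append, List.cons.injEq] at hl
        exact hl.1
      subst hxx
      rw [queueAt_succ] at hQ
      rcases hl2 : lineAt B t with _ | ⟨y, l2⟩
      · simp [hl2] at hQ
      · obtain ⟨b1, b2, b3⟩ := hdist _ _ _ hl2
        rw [hl2, List.tail_cons] at hQ
        have hs := sorted_lineAt B t
        rw [hl2, hQ, List.pairwise_cons] at hs
        have hyx := hs.1 x' (by simp)
        rw [h2] at b3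
        refine ⟨Fin.ofNat n y.2, ?_, by omega⟩
        exact b1

/-- One sweep over the array runs the queue for `n` steps. -/
theorem sweep_eq (B : Buckets n U) (s : Sweep n U) (t : ℕ) (ht : Fin.ofNat n t = Fin.ofNat n 0)
    (hs : s.queue = (queueAt B t).map Prod.fst) :
    (sweep B s).queue = (queueAt B (t + n)).map Prod.fst ∧
      (∀ q : Fin n, (sweep B s).table q = writtenAt B (t + q)) ∧
      (sweep B s).steps = s.steps + ∑ g, ((B g).length + 1) := by
  set F : Sweep n U → Fin n → Sweep n U := fun a q =>
      { queue := (a.queue ++ B q).tail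
        table := Function.update a.table q ((a.queue ++ B q).headD .free)
        steps := a.steps + (B q).length + 1 } with hF
  have htr : ∀ r, Fin.ofNat n (t + r) = Fin.ofNat n r := by
    intro r
    have := congrArg Fin.val ht
    simp only [Fin.val_ofNat] at this
    apply Fin.ext
    simp only [Fin.val_ofNat]
    rw [Nat.add_mod, this]
    simp
  have key : ∀ r ≤ n, (((List.finRange n).take r).foldl F s).queue
        = (queueAt B (t + r)).map Prod.fst ∧
      (∀ q : Fin n, q.val < r →
        (((List.finRange n).take r).foldl F s).table q = writtenAt B (t + q)) ∧
      (((List.finRange n).take r).foldl F s).steps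
        = s.steps + ∑ i ∈ Finset.range r, ((B (Fin.ofNat n i)).length + 1) := by
    intro r
    induction r with
    | zero => intro _; simp [hs]
    | succ r ih =>
      intro hr
      obtain ⟨i1, i2, i3⟩ := ih (by omega)
      have hlen : r < (List.finRange n).length := by simp; omega
      rw [List.take_succ_eq_append_getElem hlen, List.foldl_append]
      set a := ((List.finRange n).take r).foldl F s
      have hget : (List.finRange n)[r] = Fin.ofNat n r := by
        apply Fin.ext
        simp [Nat.mod_eq_of_lt (show r < n by omega)]
      rw [hget]
      simp only [List.foldl_cons, List.foldl_nil, hF]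
      have hline : a.queue ++ B (Fin.ofNat n r) = (lineAt B (t + r)).map Prod.fst := by
        rw [map_fst_lineAt, i1, htr]
      refine ⟨?_, ?_, ?_⟩
      · rw [hline, ← add_assoc, queueAt_succ, List.map_tail]
      · intro q hq
        by_cases hqr : q = Fin.ofNat n r
        · have hv : q.val = r := by
            rw [hqr]
            simp [Nat.mod_eq_of_lt (show r < n by omega)]
          rw [hline, hqr, Function.update_self, ← hqr, hv]
          rfl
        · rw [Function.update_of_ne hqr, i2]
          have : q.val ≠ r := by
            intro hv
            apply hqr
            rw [← hv, ofNat_val]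
          omega
      · rw [Finset.sum_range_succ, i3]
        ring
  obtain ⟨k1, k2, k3⟩ := key n le_rfl
  have hall : (List.finRange n).take n = List.finRange n := by
    apply List.take_of_length_le
    simp
  rw [hall] at k1 k2 k3
  rw [sum_buckets B (fun l => l.length + 1)] at k3
  exact ⟨k1, fun q => k2 q q.isLt, k3⟩

end Queue

/-! ### Rebuilds -/

section Buckets

variable {n : ℕ} [NeZero n] {U : Type*}

/-- The total weight of the entries of the buckets. -/
def bucketTotal (f : Slot n U → ℕ) (B : Buckets n U) : ℕ := ∑ g, ((B g).map f).sum

omit [NeZero n] in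
theorem bucketTotal_push (f : Slot n U → ℕ) (B : Buckets n U) (g : Fin n) (s : Slot n U) :
    bucketTotal f (push B g s) = bucketTotal f B + f s := by
  unfold bucketTotal push
  rw [← Finset.add_sum_erase _ _ (Finset.mem_univ g),
    ← Finset.add_sum_erase Finset.univ (fun q => ((B q).map f).sum) (Finset.mem_univ g)]
  have : ∑ x ∈ Finset.univ.erase g, ((Function.update B g (s :: B g) x).map f).sum
      = ∑ x ∈ Finset.univ.erase g, ((B x).map f).sum :=
    Finset.sum_congr rfl fun x hx => by rw [Function.update_of_ne (Finset.ne_of_mem_erase hx)]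
  rw [this, Function.update_self]
  simp
  ring

/-- Each entry is in the bucket of its hash. -/
def Sorted (h : U → Fin n) (B : Buckets n U) : Prop := ∀ g, ∀ s ∈ B g, slotHash h s = some g

omit [NeZero n] in
theorem Sorted.push {h : U → Fin n} {B : Buckets n U} (hB : Sorted h B) {g : Fin n}
    {s : Slot n U} (hs : slotHash h s = some g) : Sorted h (push B g s) := by
  intro g' s' hs'
  unfold Graveyard.push at hs'
  by_cases hg : g' = g
  · subst hg
    rw [Function.update_self, List.mem_cons] at hs'
    rcases hs' with rfl | hs'
    · exact hs
    · exact hB _ _ hs'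
  · rw [Function.update_of_ne hg] at hs'
    exact hB _ _ hs'

/-- The weight `f`, ignoring entries other than keys. -/
def onKeys (f : Slot n U → ℕ) : Slot n U → ℕ
  | .key v => f (.key v)
  | _ => 0

omit [NeZero n] in
theorem gather_spec (h : U → Fin n) (T : Table n U) (B : Buckets n U × ℕ) (hB : Sorted h B.1) :
    Sorted h (gather h T B).1 ∧ (gather h T B).2 = B.2 + n ∧
      ∀ f, bucketTotal f (gather h T B).1 = bucketTotal f B.1 + total (onKeys f) T := by
  have key : ∀ (l : List (Fin n)) (B : Buckets n U × ℕ), Sorted h B.1 →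
      let R := l.foldl (fun a q => match T q with
        | .key u => (push a.1 (h u) (.key u), a.2 + 1)
        | _ => (a.1, a.2 + 1)) B
      Sorted h R.1 ∧ R.2 = B.2 + l.length ∧
        ∀ f, bucketTotal f R.1 = bucketTotal f B.1 + (l.map (fun q => onKeys f (T q))).sum := by
    intro l
    induction l with
    | nil => intro B hB; simp [hB]
    | cons q l ih =>
      intro B hB
      simp only [List.foldl_cons]
      rcases hq : T q with _ | v | g
      · obtain ⟨i1, i2, i3⟩ := ih (B.1, B.2 + 1) hB
        refine ⟨i1, ?_, fun f => ?_⟩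
        · rw [i2, List.length_cons]; ring
        · rw [i3]; simp [hq, onKeys]
      · obtain ⟨i1, i2, i3⟩ := ih (push B.1 (h v) (.key v), B.2 + 1) (hB.push rfl)
        refine ⟨i1, ?_, fun f => ?_⟩
        · rw [i2, List.length_cons]; ring
        · rw [i3, bucketTotal_push]; simp [hq, onKeys, add_assoc]
      · obtain ⟨i1, i2, i3⟩ := ih (B.1, B.2 + 1) hB
        refine ⟨i1, ?_, fun f => ?_⟩
        · rw [i2, List.length_cons]; ring
        · rw [i3]; simp [hq, onKeys]
  obtain ⟨k1, k2, k3⟩ := key (List.finRange n) B hB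
  refine ⟨k1, k2.trans (by simp), fun f => (k3 f).trans ?_⟩
  rw [← List.ofFn_eq_map, List.sum_ofFn]
  rfl

omit [NeZero n] in
theorem plant_spec (h : U → Fin n) (L : List (Fin n)) (B : Buckets n U × ℕ) (hB : Sorted h B.1) :
    Sorted h (plant L B).1 ∧ (plant L B).2 = B.2 + L.length ∧
      ∀ f, bucketTotal f (plant L B).1 = bucketTotal f B.1 + (L.map (fun g => f (.tomb g))).sum := by
  induction L generalizing B with
  | nil => simp [plant, hB]
  | cons g L ih =>
    obtain ⟨i1, i2, i3⟩ := ih (push B.1 g (.tomb g), B.2 + 1) (hB.push rfl)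
    refine ⟨i1, ?_, fun f => ?_⟩
    · change (plant L _).2 = _
      rw [i2, List.length_cons]; ring
    · change bucketTotal f (plant L _).1 = _
      rw [i3, bucketTotal_push]; simp [add_assoc]

theorem sum_map_ite_eq_count {α : Type*} [DecidableEq α] (l : List α) (a : α) :
    (l.map (fun b => if b = a then 1 else 0)).sum = l.count a := by
  induction l with
  | nil => rfl
  | cons b l ih => simp [ih, List.count_cons, add_comm]

variable [DecidableEq U]

/-- A rebuild keeps the keys, creates the tombstones with the prescribed hashes, lays everything
out in the order of the hashes, and takes linear time. -/
theorem rebuild_spec {h : U → Fin n} {T : Table n U} {A : Finset U} (hT : KeysAre T A) :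
    Ordered (layout h (rebuild h T).1) ∧ KeysAre (rebuild h T).1 A ∧
      (∀ g, total (tombWeight g) (rebuild h T).1 = (tombHashes n (n - A.card)).count g) ∧
      (rebuild h T).2 ≤ 8 * n := by
  have hAn := hT.card_le
  set L := tombHashes n (spare T) with hL
  have hLlen : L.length = (n - A.card) / 2 := by
    rw [hL, hT.spare_eq]
    simp [tombHashes]
  obtain ⟨g1, g2, g3⟩ := gather_spec h T (fun _ => [], n + n) (fun _ s hs => by cases hs)
  obtain ⟨p1, p2, p3⟩ := plant_spec h L _ g1
  set B := plant L (gather h T (fun _ => [], n + n)) with hB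
  have hBf : ∀ f, bucketTotal f B.1 = ∑ v ∈ A, f (.key v) + (L.map (fun g => f (.tomb g))).sum := by
    intro f
    rw [p3, g3, hT.total_eq (onKeys f) rfl (fun _ => rfl)]
    simp [bucketTotal, onKeys]
  have hlen : ∑ g, (B.1 g).length = A.card + (n - A.card) / 2 := by
    have := hBf (fun _ => 1)
    simpa [bucketTotal, hLlen] using this
  have hle : ∑ g, (B.1 g).length ≤ n := by omega
  obtain ⟨a1, a2, a3⟩ := sweep_eq B.1
    { queue := [], table := fun _ => .free, steps := B.2 } 0 rfl rfl
  rw [zero_add] at a1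
  obtain ⟨b1, b2, b3⟩ := sweep_eq B.1 _ n (by simp) a1
  have htab : (rebuild h T).1 = layOut B.1 := funext b2
  have hsteps : (rebuild h T).2 = B.2 + ∑ g, ((B.1 g).length + 1) + ∑ g, ((B.1 g).length + 1) := by
    rw [← a3]
    exact b3
  rw [htab]
  refine ⟨ordered_layOut hle p1, ?_, ?_, ?_⟩
  · intro u
    rw [total_layOut hle _ rfl]
    have := hBf (keyWeight u)
    unfold bucketTotal at this
    rw [this]
    simp [keyWeight, Finset.sum_ite_eq']
  · intro g
    rw [total_layOut hle _ rfl]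
    have := hBf (tombWeight g)
    unfold bucketTotal at this
    rw [this, ← hT.spare_eq, ← hL]
    simp [tombWeight, sum_map_ite_eq_count]
  · rw [hsteps, p2, g2, hLlen]
    simp only [Finset.sum_add_distrib, hlen]
    simp
    omega

end Buckets


/-! ### The invariant of a rebuild window -/

section Invariant

variable {n : ℕ} [NeZero n] {U : Type*} [DecidableEq U]

/-- The number of keys in `V` of hash `g`. -/
def hashCount (h : U → Fin n) (V : Finset U) (g : Fin n) : ℕ := (V.filter (fun v => h v = g)).card

omit [NeZero n] [DecidableEq U] in
theorem hashCount_mono (h : U → Fin n) {V W : Finset U} (hVW : V ⊆ W) (g : Fin n) :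
    hashCount h V g ≤ hashCount h W g :=
  Finset.card_le_card (Finset.filter_subset_filter _ hVW)

omit [NeZero n] in
theorem hashCount_union_le (h : U → Fin n) (V W : Finset U) (g : Fin n) :
    hashCount h (V ∪ W) g ≤ hashCount h V g + hashCount h W g := by
  unfold hashCount
  rw [Finset.filter_union]
  exact Finset.card_union_le _ _

omit [NeZero n] in
theorem hashCount_insert (h : U → Fin n) {V : Finset U} {u : U} (hu : u ∉ V) (g : Fin n) :
    hashCount h (insert u V) g = hashCount h V g + if h u = g then 1 else 0 := by
  unfold hashCount
  rw [Finset.filter_insert]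
  split_ifs
  · rw [Finset.card_insert_of_notMem (by simp [hu])]
  · rfl

omit [NeZero n] [DecidableEq U] in
theorem sum_hashCount (h : U → Fin n) (V : Finset U) (P : Fin n → Prop) [DecidablePred P] :
    ∑ g ∈ Finset.univ.filter P, hashCount h V g = (V.filter (fun v => P (h v))).card := by
  unfold hashCount
  simp_rw [Finset.card_filter]
  rw [Finset.sum_comm]
  refine Finset.sum_congr rfl fun v _ => ?_
  rw [Finset.sum_ite_eq]
  simp

omit [NeZero n] [DecidableEq U] in
theorem sum_hashCount_univ (h : U → Fin n) (V : Finset U) : ∑ g, hashCount h V g = V.card := by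
  have := sum_hashCount h V (fun _ => True)
  simpa using this

/-- The number of tombstones of hash `g` that are created by a rebuild of a table of the keys
`A₀`. -/
def newTombs (n : ℕ) [NeZero n] (A₀ : Finset U) (g : Fin n) : ℕ :=
  (tombHashes n (n - A₀.card)).count g

/-- What is known about a rebuild window independently of the hash function: the rebuild took place
with the keys `A₀`, the keys `J` have been inserted or deleted since then, `A` is the set of keys
now, and `c` operations have been counted. -/
structure Phase (n : ℕ) (A₀ J A : Finset U) (c : ℕ) : Prop where
  new : A ⊆ A₀ ∪ J
  old : A₀ ⊆ A ∪ J
  card_le : J.card ≤ c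
  lt : c < windowLength (n - A₀.card)

/-- The invariant of the table during a rebuild window. A tombstone was created by the rebuild or
belongs to a touched key that is absent. The function `F` counts, for each hash `g`, the insertions
of keys with hashes before `g` that made use of tombstones with hashes from `g` on (or of free slots
from `g` on); the entries of hash `g` are at least those after the rebuild, plus what has flowed to
`g + 1`, minus what has flowed to `g`. Since the first tombstone in the order of the hashes is used,
the flow to `g + 1` is positive only if the flow to `g` and the touched keys of hash `g` outnumber
the tombstones of hash `g`; the subtraction of natural numbers expresses this. -/
structure Good (h : U → Fin n) (A₀ J A : Finset U) (c : ℕ) (T : Table n U) : Prop where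
  ordered : Ordered (layout h T)
  keys : KeysAre T A
  tombs_le : ∀ g, total (tombWeight g) T ≤ newTombs n A₀ g + hashCount h (J \ A) g
  flow : ∃ F : Fin n → ℕ, (∀ g, F g ≤ c) ∧
    (∀ g, hashCount h A₀ g + newTombs n A₀ g + F (g + 1) ≤ total (itemWeight h g) T + F g) ∧
    ∀ g, F (g + 1) ≤ F g + hashCount h J g - newTombs n A₀ g

theorem Good.mono {h : U → Fin n} {A₀ J A : Finset U} {c c' : ℕ} {T : Table n U}
    (hG : Good h A₀ J A c T) (hc : c ≤ c') : Good h A₀ J A c' T where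
  ordered := hG.ordered
  keys := hG.keys
  tombs_le := hG.tombs_le
  flow := by
    obtain ⟨F, h1, h2, h3⟩ := hG.flow
    exact ⟨F, fun g => (h1 g).trans hc, h2, h3⟩

theorem good_rebuild {h : U → Fin n} {T : Table n U} {A : Finset U} (hT : KeysAre T A) :
    Good h A ∅ A 0 (rebuild h T).1 := by
  obtain ⟨h1, h2, h3, -⟩ := rebuild_spec (h := h) hT
  refine ⟨h1, h2, fun g => ?_, fun _ => 0, fun _ => le_rfl, fun g => ?_, fun _ => Nat.zero_le _⟩
  · rw [h3]; exact Nat.le_add_right _ _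
  · rw [h2.item_total h g, h3]
    unfold hashCount newTombs
    simp only
    omega

/-- The number of entries of each hash is bounded by that of the tombstones created by the rebuild
and the keys that are present or touched. -/
theorem Good.item_le {h : U → Fin n} {A₀ J A : Finset U} {c : ℕ} {T : Table n U}
    (hG : Good h A₀ J A c T) (hP : Phase n A₀ J A c) (g : Fin n) :
    total (itemWeight h g) T ≤ newTombs n A₀ g + hashCount h (A₀ ∪ J) g := by
  rw [hG.keys.item_total h g]
  have h1 := hG.tombs_le g
  have h2 : hashCount h (J \ A) g + (A.filter (fun v => h v = g)).card
      ≤ hashCount h (A₀ ∪ J) g := by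
    unfold hashCount
    rw [← Finset.card_union_of_disjoint]
    · refine Finset.card_le_card ?_
      rw [← Finset.filter_union]
      refine Finset.filter_subset_filter _ (Finset.union_subset ?_ hP.new)
      exact Finset.sdiff_subset.trans Finset.subset_union_right
    · exact Finset.disjoint_filter_filter Finset.sdiff_disjoint
  omega

omit [NeZero n] in
theorem Phase.card_lt {A₀ J A : Finset U} {c : ℕ} (hP : Phase n A₀ J A c) (hA : A.card < n) :
    A₀.card < n := by
  by_contra hlt
  have h1 := hP.lt
  have h2 := hP.card_le
  have h0 : n - A₀.card = 0 := by omega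
  rw [h0] at h1
  simp only [windowLength] at h1
  have hJ : J = ∅ := Finset.card_eq_zero.1 (by omega)
  have h3 := hP.old
  rw [hJ, Finset.union_empty] at h3
  have := Finset.card_le_card h3
  omega

theorem Good.exists_free {h : U → Fin n} {A₀ J A : Finset U} {c : ℕ} {T : Table n U}
    (hG : Good h A₀ J A c T) (hP : Phase n A₀ J A c) (hA : A.card < n) : ∃ p, T p = .free := by
  by_contra! hne
  have h1 : ∑ g, total (itemWeight h g) T = n := by
    unfold total
    rw [Finset.sum_comm]
    have : ∀ q, ∑ g, itemWeight h g (T q) = 1 := by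
      intro q
      have := hne q
      rcases hq : T q with _ | v | g
      · exact absurd hq this
      · simp [itemWeight, slotHash]
      · simp [itemWeight, slotHash]
    simp [this]
  have h2 : ∑ g, total (itemWeight h g) T
      ≤ ∑ g, (newTombs n A₀ g + hashCount h (A₀ ∪ J) g) :=
    Finset.sum_le_sum fun g _ => hG.item_le hP g
  rw [Finset.sum_add_distrib, sum_hashCount_univ] at h2
  unfold newTombs at h2
  rw [sum_count_tombHashes_univ] at h2
  have h3 := Finset.card_union_le A₀ J
  have h4 := hP.card_lt hA
  have h5 := hP.lt
  have h6 := hP.card_le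
  simp only [windowLength] at h5
  omega

/-- A deletion turns a key into a tombstone of the same hash: only the set of touched keys changes.
-/
theorem Good.delete {h : U → Fin n} {A₀ J A : Finset U} {c : ℕ} {T : Table n U}
    (hG : Good h A₀ J A c T) (u : U) :
    Good h A₀ (insert u J) (A.erase u) (c + 1) (deleteKey h T u) := by
  have hl := layout_deleteKey hG.ordered hG.keys u
  refine ⟨by rw [hl]; exact hG.ordered, keysAre_deleteKey hG.ordered hG.keys u, ?_, ?_⟩
  · intro g
    have h1 := hG.tombs_le g
    by_cases hu : u ∈ A
    · obtain ⟨q, hq, he⟩ := deleteKey_of_mem hG.ordered hG.keys hu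
      rw [he]
      have h2 := total_update (tombWeight g) T q (.tomb (h u))
      have h3 : insert u J \ A.erase u = insert u (J \ A) := by
        ext v
        simp only [Finset.mem_sdiff, Finset.mem_insert, Finset.mem_erase]
        by_cases hv : v = u <;> simp [hv]
      rw [h3, hashCount_insert h (by simp [hu])]
      rw [hq] at h2
      simp only [tombWeight] at h2
      omega
    · rw [deleteKey_of_not_mem hG.keys hu]
      refine h1.trans (Nat.add_le_add_left (hashCount_mono h ?_ g) _)
      rw [Finset.erase_eq_of_notMem hu]
      exact Finset.sdiff_subset_sdiff (Finset.subset_insert _ _) le_rfl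
  · obtain ⟨F, f1, f2, f3⟩ := hG.flow
    refine ⟨F, fun g => (f1 g).trans (Nat.le_succ c), fun g => ?_, fun g => ?_⟩
    · have : total (itemWeight h g) (deleteKey h T u) = total (itemWeight h g) T := by
        unfold total itemWeight
        refine Finset.sum_congr rfl fun q _ => ?_
        rw [show slotHash h (deleteKey h T u q) = slotHash h (T q) from congrFun hl q]
      rw [this]
      exact f2 g
    · have := f3 g
      have := hashCount_mono h (Finset.subset_insert u J) g
      omega

theorem dist_succ (s g : Fin n) :
    dist s (g + 1) = if dist s g + 1 < n then dist s g + 1 else 0 := by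
  have h1 := dist_spec s g
  have h2 := dist_spec s (g + 1)
  have h3 := succ_spec g
  have := g.isLt
  have := (g + 1).isLt
  have := s.isLt
  split_ifs <;> omega

/-- An insertion contributes to the flow at all hashes after that of the key, up to the landing
point. No tombstones are left before the landing point, hence the flow stays controlled there. -/
theorem Good.insert {h : U → Fin n} {A₀ J A : Finset U} {c : ℕ} {T : Table n U}
    (hG : Good h A₀ J A c T) (hP : Phase n A₀ J A c) (hA : A.card < n) {u : U} (hu : u ∉ A) :
    Good h A₀ (insert u J) (insert u A) (c + 1) (insertKey h T u) := by
  obtain ⟨p, hp⟩ := hG.exists_free hP hA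
  obtain ⟨j, k, ho, hI⟩ := exists_insertsAt (h := h) hp u
  have hK := keysAre_insertKey hG.keys hu ho hI
  have htomb : ∀ g, total (tombWeight g) (insertKey h T u) + tombWeight g (T (adv (h u) k))
      = total (tombWeight g) T := fun g => total_insertKey ho hI (tombWeight g)
  have hitem : ∀ g, total (itemWeight h g) (insertKey h T u) + itemWeight h g (T (adv (h u) k))
      = total (itemWeight h g) T + if h u = g then 1 else 0 := by
    intro g
    rw [total_insertKey ho hI (itemWeight h g)]
    simp [itemWeight, slotHash]
  have hcases := hI.landing_cases hG.ordered
  have hnt : ∀ r g, T r = .tomb g → dist (h u) (landing h T u k) ≤ dist (h u) g :=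
    fun r g hr => hI.no_tomb hG.ordered hp hr
  generalize landing h T u k = z at hcases hnt
  have hno : ∀ g, dist (h u) g < dist (h u) z → total (tombWeight g) T = 0 := by
    intro g hg
    rw [tombWeight_total_eq_zero]
    intro r hr
    have := hnt r g hr
    omega
  refine ⟨ordered_insertKey hp hG.ordered ho hI, hK, ?_, ?_⟩
  · intro g
    have h1 := hG.tombs_le g
    have h2 := htomb g
    have h3 : Insert.insert u J \ Insert.insert u A = (J \ A).erase u := by
      ext v
      simp only [Finset.mem_sdiff, Finset.mem_insert, Finset.mem_erase]
      by_cases hv : v = u <;> simp [hv]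
    rw [h3]
    by_cases hc : u ∈ J \ A ∧ h u = g
    · obtain ⟨hc1, rfl⟩ := hc
      have h4 := hashCount_insert h (Finset.notMem_erase u (J \ A)) (h u)
      rw [Finset.insert_erase hc1, if_pos rfl] at h4
      -- a tombstone of the hash of `u`, if there is one, is used
      rcases Nat.eq_zero_or_pos (total (tombWeight (h u)) T) with h5 | h5
      · omega
      · have h6 : ¬ total (tombWeight (h u)) T = 0 := by omega
        rw [tombWeight_total_eq_zero] at h6
        push Not at h6
        obtain ⟨r, hr⟩ := h6
        have h7 := hnt r _ hr
        rw [dist_self] at h7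
        have h8 : tombWeight (h u) (T (adv (h u) k)) = 1 := by
          rcases hcases with ⟨e1, -, e3⟩ | ⟨g', e1, e2, -⟩
          · exfalso
            have hk0 : k = 0 := by omega
            rw [hk0, adv_zero] at e1
            have := hG.ordered.lt_dist_free (p := h u) (q := r) (g := h u)
              (by simp [layout, e1, slotHash]) (by simp [layout, hr, slotHash])
            omega
          · rw [e2] at h7
            have := dist_eq_zero (Nat.le_zero.1 h7)
            rw [e1, this]
            simp [tombWeight]
        omega
    · have h4 : hashCount h ((J \ A).erase u) g = hashCount h (J \ A) g := by
        by_cases hm : u ∈ J \ A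
        · have h5 := hashCount_insert h (Finset.notMem_erase u (J \ A)) g
          rw [Finset.insert_erase hm, if_neg (fun e => hc ⟨hm, e⟩)] at h5
          omega
        · rw [Finset.erase_eq_of_notMem hm]
      omega
  · obtain ⟨F, f1, f2, f3⟩ := hG.flow
    have hzn := (dist_spec (h u) z).1
    have ha : ∀ g, hashCount h A₀ g + newTombs n A₀ g +
        (F (g + 1) + if 1 ≤ dist (h u) (g + 1) ∧ dist (h u) (g + 1) ≤ dist (h u) z then 1 else 0) ≤
        total (itemWeight h g) (insertKey h T u) +
        (F g + if 1 ≤ dist (h u) g ∧ dist (h u) g ≤ dist (h u) z then 1 else 0) := by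
      intro g
      have h1 := f2 g
      have h2 := hitem g
      have h3 := dist_succ (h u) g
      have h4 : itemWeight h g (T (adv (h u) k)) ≤ if g = z then 1 else 0 := by
        rcases hcases with ⟨e1, -, -⟩ | ⟨g', e1, e2, -⟩
        · simp [e1, itemWeight, slotHash]
        · rw [e1, e2]
          simp [itemWeight, slotHash, eq_comm]
      by_cases hg0 : h u = g
      · have h5 : dist (h u) g = 0 := by rw [hg0, dist_self]
        rw [if_pos hg0] at h2
        by_cases hgz : g = z
        · rw [← hgz]
          split_ifs at h3 h4 ⊢ <;> omega
        · rw [if_neg hgz] at h4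
          split_ifs <;> omega
      · have h5 : 0 < dist (h u) g := by
          rw [Nat.pos_iff_ne_zero]
          exact fun e => hg0 (dist_eq_zero e)
        rw [if_neg hg0] at h2
        by_cases hgz : g = z
        · rw [if_pos hgz] at h4
          rw [← hgz]
          split_ifs at h3 ⊢ <;> omega
        · rw [if_neg hgz] at h4
          have h6 : dist (h u) g ≠ dist (h u) z := fun e => hgz (dist_inj e)
          split_ifs at h3 ⊢ <;> omega
    refine ⟨fun g => F g + if 1 ≤ dist (h u) g ∧ dist (h u) g ≤ dist (h u) z then 1 else 0,
      fun g => ?_, ha, fun g => ?_⟩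
    · have := f1 g
      simp only
      split_ifs <;> omega
    · have h1 := ha g
      have h2 := f3 g
      have h3 := dist_succ (h u) g
      have h4 := hashCount_mono h (Finset.subset_insert u J) g
      simp only
      by_cases hg : 1 ≤ dist (h u) (g + 1) ∧ dist (h u) (g + 1) ≤ dist (h u) z
      · have h5 : dist (h u) g < dist (h u) z := by split_ifs at h3 <;> omega
        have h6 := hno g h5
        have h7 := htomb g
        have h8 := hK.item_total h g
        have h9 : hashCount h (Insert.insert u A) g ≤
            hashCount h A₀ g + hashCount h (Insert.insert u J) g := by
          refine (hashCount_mono h ?_ g).trans (hashCount_union_le h A₀ _ g)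
          rw [Finset.union_insert]
          exact Finset.insert_subset_insert _ hP.new
        unfold hashCount at h1 h9 ⊢
        omega
      · rw [if_neg hg]
        omega

end Invariant


/-! ### Executions and the amortized cost of rebuilds -/

section Runs

variable {n : ℕ} {U : Type*} [DecidableEq U]

/-- The keys present after an operation. -/
def after (A : Finset U) : Op U → Finset U
  | .insert u => insert u A
  | .delete u => A.erase u
  | .query _ => A

/-- The keys inserted or deleted since the last rebuild, after one more operation. -/
def touched (J : Finset U) : Op U → Finset U
  | .insert u => insert u J
  | .delete u => insert u J
  | .query _ => J

theorem contents_take_succ (S : List (Op U)) {t : ℕ} (ht : t < S.length) :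
    contents (S.take (t + 1)) = after (contents (S.take t)) S[t] := by
  rw [List.take_succ_eq_append_getElem ht]
  unfold contents
  rw [List.foldl_append]
  simp only [List.foldl_cons, List.foldl_nil]
  rcases S[t] with u | u | u <;> rfl

/-- The condition on an operation of an admissible workload. -/
def Allowed (n : ℕ) (A : Finset U) (o : Op U) : Prop :=
  ∀ u, o = .insert u → u ∉ A ∧ A.card < n

theorem Phase.apply {A₀ J A : Finset U} {c c' : ℕ} (hP : Phase n A₀ J A c) (o : Op U) {cq : Bool}
    (hc' : c' = c + weight cq o) (hlt : c' < windowLength (n - A₀.card)) :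
    Phase n A₀ (touched J o) (after A o) c' := by
  subst hc'
  have h1 := hP.new
  have h2 := hP.old
  have h3 := hP.card_le
  rcases o with u | u | u
  · refine ⟨?_, ?_, (Finset.card_insert_le _ _).trans (Nat.add_le_add_right h3 1), hlt⟩
    · intro v hv
      have := @h1 v
      simp only [after, touched, Finset.mem_insert, Finset.mem_union] at *
      tauto
    · intro v hv
      have := @h2 v hv
      simp only [after, touched, Finset.mem_insert, Finset.mem_union] at *
      tauto
  · refine ⟨?_, ?_, (Finset.card_insert_le _ _).trans (Nat.add_le_add_right h3 1), hlt⟩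
    · intro v hv
      have := @h1 v
      simp only [after, touched, Finset.mem_insert, Finset.mem_union, Finset.mem_erase] at *
      tauto
    · intro v hv
      have := @h2 v hv
      simp only [after, touched, Finset.mem_insert, Finset.mem_union, Finset.mem_erase] at *
      tauto
  · exact ⟨h1, h2, h3.trans (Nat.le_add_right _ _), hlt⟩

theorem phase_start {A : Finset U} : Phase n A ∅ A 0 :=
  ⟨Finset.subset_union_left, Finset.subset_union_left, le_rfl, by simp [windowLength]⟩

variable [NeZero n]

theorem Good.apply {h : U → Fin n} {A₀ J A : Finset U} {c : ℕ} {T : Table n U}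
    (hG : Good h A₀ J A c T) (hP : Phase n A₀ J A c) (cq : Bool) {o : Op U}
    (ho : Allowed n A o) :
    Good h A₀ (touched J o) (after A o) (c + weight cq o) (applyOp h T o) := by
  rcases o with u | u | u
  · obtain ⟨h1, h2⟩ := ho u rfl
    exact hG.insert hP h2 h1
  · exact hG.delete u
  · exact hG.mono (Nat.le_add_right _ _)

/-- The state is in the given phase of a rebuild window. -/
structure Tracks (h : U → Fin n) (s : State n U) (A₀ J A : Finset U) (c : ℕ) : Prop where
  count : s.count = c
  window : s.window = windowLength (n - A₀.card)
  good : Good h A₀ J A c s.table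

theorem tracks_fresh {h : U → Fin n} {T : Table n U} {A : Finset U} (hT : KeysAre T A) :
    Tracks h (fresh h T) A ∅ A 0 :=
  ⟨rfl, by simp [fresh, hT.spare_eq], good_rebuild hT⟩

omit [NeZero n] in
theorem keysAre_free : KeysAre (fun _ => .free : Table n U) ∅ := by
  intro u
  simp [total, keyWeight]

theorem Tracks.step {h : U → Fin n} {s : State n U} {A₀ J A : Finset U} {c : ℕ}
    (hs : Tracks h s A₀ J A c) (hP : Phase n A₀ J A c) {cq : Bool} {o : Op U}
    (ho : Allowed n A o) :
    if windowLength (n - A₀.card) ≤ c + weight cq o then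
      Tracks h (step cq h s o) (after A o) ∅ (after A o) 0
    else Tracks h (step cq h s o) A₀ (touched J o) (after A o) (c + weight cq o) := by
  have hg := hs.good.apply hP cq ho
  unfold Graveyard.step rebuildDue
  rw [hs.count, hs.window]
  simp only [decide_eq_true_eq]
  split_ifs with hd
  · exact tracks_fresh hg.keys
  · exact ⟨rfl, rfl, hg⟩

theorem run_take_succ (cq : Bool) (h : U → Fin n) (S : List (Op U)) {t : ℕ} (ht : t < S.length) :
    run cq h (S.take (t + 1)) = step cq h (run cq h (S.take t)) S[t] := by
  rw [List.take_succ_eq_append_getElem ht]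
  unfold run
  rw [List.foldl_append]
  rfl

/-- The phase of the rebuild window does not depend on the hash function. -/
theorem exists_tracks {S : List (Op U)} (hS : Admissible n S) (cq : Bool) {t : ℕ}
    (ht : t ≤ S.length) :
    ∃ A₀ J c, Phase n A₀ J (contents (S.take t)) c ∧
      ∀ h : U → Fin n, Tracks h (run cq h (S.take t)) A₀ J (contents (S.take t)) c := by
  induction t with
  | zero =>
    refine ⟨∅, ∅, 0, phase_start, fun h => ?_⟩
    exact tracks_fresh keysAre_free
  | succ t ih =>
    obtain ⟨A₀, J, c, hP, hT⟩ := ih (by omega)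
    have hall : Allowed n (contents (S.take t)) S[t] := fun u hu => hS ⟨t, ht⟩ u hu
    simp_rw [run_take_succ cq _ S ht, contents_take_succ S ht]
    by_cases hd : windowLength (n - A₀.card) ≤ c + weight cq S[t]
    · refine ⟨_, ∅, 0, phase_start, fun h => ?_⟩
      have := (hT h).step hP (cq := cq) hall
      rwa [if_pos hd] at this
    · refine ⟨A₀, _, _, hP.apply (cq := cq) S[t] rfl (not_le.1 hd), fun h => ?_⟩
      have := (hT h).step hP (cq := cq) hall
      rwa [if_neg hd] at this

theorem load_spec {k : ℕ} {x : ℝ} (hx : 1 ≤ x) (hk : (k : ℝ) / n = 1 - 1 / x) :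
    k < n ∧ x * ((n : ℝ) - k) = n := by
  have hn : (0 : ℝ) < n := Nat.cast_pos.2 (Nat.pos_of_ne_zero (NeZero.ne n))
  have hx0 : 0 < x := by linarith
  have h1 : x * ((n : ℝ) - k) = n := by
    field_simp at hk
    linarith
  refine ⟨?_, h1⟩
  by_contra hlt
  have : (n : ℝ) ≤ k := by exact_mod_cast not_lt.1 hlt
  nlinarith

omit [NeZero n] [DecidableEq U] in
theorem weight_le_one (cq : Bool) (o : Op U) : weight cq o ≤ 1 := by
  rcases o with u | u | u <;> simp [weight]
  split_ifs <;> simp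

omit [NeZero n] in
/-- During a rebuild window the number of slots without a key grows by a quarter at most. -/
theorem Phase.spare_le {A₀ J A : Finset U} {c : ℕ} (hP : Phase n A₀ J A c) (hA : A.card < n) :
    4 * (n - A.card) ≤ 5 * (n - A₀.card) := by
  have h1 := hP.lt
  have h2 := hP.card_le
  have h3 := (Finset.card_le_card hP.old).trans (Finset.card_union_le _ _)
  have h4 := hP.card_lt hA
  simp only [windowLength] at h1
  omega

/-- The operations of a rebuild window pay for the rebuild at its end: those counted so far have
saved up an amount proportional to their number, `64 n / f₀` each, where `f₀` slots held no key at
the last rebuild. -/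
theorem sum_rebuildTimeAt_le {S : List (Op U)} (hS : Admissible n S) (cq : Bool) (h : U → Fin n)
    (x : Fin S.length → ℝ) (hx : ∀ t, 1 ≤ x t ∧ loadAt n S t = 1 - 1 / x t) :
    ((∑ t, rebuildTimeAt cq h S t : ℕ) : ℝ) ≤ 80 * ∑ t, x t := by
  have hn : (0 : ℝ) < n := Nat.cast_pos.2 (Nat.pos_of_ne_zero (NeZero.ne n))
  set r : ℕ → ℕ := fun i => if hi : i < S.length then rebuildTimeAt cq h S ⟨i, hi⟩ else 0 with hr
  set y : ℕ → ℝ := fun i => if hi : i < S.length then x ⟨i, hi⟩ else 0 with hy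
  have key : ∀ t ≤ S.length, ∃ A₀ J c, Phase n A₀ J (contents (S.take t)) c ∧
      Tracks h (run cq h (S.take t)) A₀ J (contents (S.take t)) c ∧
      (∑ i ∈ Finset.range t, (r i : ℝ)) + 64 * c * (n / ((n - A₀.card : ℕ) : ℝ))
        ≤ 80 * ∑ i ∈ Finset.range t, y i := by
    intro t
    induction t with
    | zero =>
      intro _
      exact ⟨∅, ∅, 0, phase_start, tracks_fresh keysAre_free, by simp⟩
    | succ t ih =>
      intro ht
      obtain ⟨A₀, J, c, hP, hT, hle⟩ := ih (by omega)
      have hall : Allowed n (contents (S.take t)) S[t] := fun u hu => hS ⟨t, ht⟩ u hu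
      obtain ⟨hx1, hx2⟩ := hx ⟨t, ht⟩
      obtain ⟨hA, hxn⟩ := load_spec hx1 hx2
      have hyt : y t = x ⟨t, ht⟩ := by simp only [hy]; rw [dif_pos]
      have hsp := hP.spare_le hA
      have hf0 := hP.card_lt hA
      have hw := weight_le_one cq S[t]
      have hst := hT.step hP (cq := cq) hall
      set f₀ := n - A₀.card with hf
      have hf0' : (0 : ℝ) < (f₀ : ℝ) := by
        have : 0 < f₀ := by omega
        exact_mod_cast this
      have hyn : 64 * ((n : ℝ) / f₀) ≤ 80 * y t := by
        have h1 : 4 * ((n : ℝ) - (contents (S.take t)).card) ≤ 5 * f₀ := by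
          rw [← Nat.cast_sub hA.le]
          exact_mod_cast hsp
        have h2 : (n : ℝ) / f₀ ≤ 5 / 4 * y t := by
          rw [div_le_iff₀ hf0', hyt]
          simp only at hxn
          nlinarith
        linarith
      rw [run_take_succ cq h S ht, contents_take_succ S ht]
      by_cases hd : windowLength f₀ ≤ c + weight cq S[t]
      · rw [if_pos hd] at hst
        refine ⟨_, ∅, 0, phase_start, hst, ?_⟩
        have hrt : r t ≤ 8 * n := by
          simp only [hr]
          rw [dif_pos (show t < S.length from ht)]
          unfold rebuildTimeAt
          split_ifs
          · exact (rebuild_spec (hT.good.apply hP cq hall).keys).2.2.2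
          · exact Nat.zero_le _
        have hrt' : (r t : ℝ) ≤ 8 * n := by exact_mod_cast hrt
        -- the factor 8, not 4, makes up for the rounding of the window length
        have hfc : f₀ ≤ 8 * (c + 1) := by
          simp only [windowLength] at hd
          omega
        have hfc' : (f₀ : ℝ) ≤ 8 * (c + 1) := by exact_mod_cast hfc
        have h8 : 8 * (n : ℝ) ≤ 64 * (c + 1) * (n / f₀) := by
          rw [mul_div_assoc', le_div_iff₀ hf0']
          nlinarith
        rw [Finset.sum_range_succ, Finset.sum_range_succ]
        simp only [Nat.cast_zero, mul_zero, zero_mul, add_zero]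
        nlinarith
      · rw [if_neg hd] at hst
        refine ⟨A₀, _, _, hP.apply (cq := cq) S[t] rfl (not_le.1 hd), hst, ?_⟩
        have hrt : r t = 0 := by
          simp only [hr]
          rw [dif_pos (show t < S.length from ht)]
          unfold rebuildTimeAt rebuildDue
          simp only [hT.count, hT.window, decide_eq_true_eq]
          exact if_neg hd
        rw [Finset.sum_range_succ, Finset.sum_range_succ, hrt]
        have hw' : (weight cq S[t] : ℝ) ≤ 1 := by exact_mod_cast hw
        have h9 : (0 : ℝ) ≤ n / f₀ := by positivity
        push_cast
        nlinarith
  obtain ⟨A₀, J, c, -, -, hle⟩ := key S.length le_rfl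
  have h1 : ∑ i ∈ Finset.range S.length, (r i : ℝ) = ((∑ t, rebuildTimeAt cq h S t : ℕ) : ℝ) := by
    rw [Finset.sum_range, Nat.cast_sum]
    exact Finset.sum_congr rfl fun t _ => by simp [hr]
  have h2 : ∑ i ∈ Finset.range S.length, y i = ∑ t, x t := by
    rw [Finset.sum_range]
    exact Finset.sum_congr rfl fun t _ => by simp [hy]
  rw [h1, h2] at hle
  have : 0 ≤ 64 * (c : ℝ) * (n / ((n - A₀.card : ℕ) : ℝ)) := by positivity
  linarith

end Runs


/-! ### Queues of keys on the circle -/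

section Excess

variable {n : ℕ} [NeZero n] {U : Type*}

/-- The largest excess of the number of keys of `V` with hashes in an arc `[q - l, q)` over `μ l`,
for arcs of any length `l < n`: the length at `q` of a queue of the keys that is served at
rate `μ`. -/
noncomputable def excess (h : U → Fin n) (V : Finset U) (μ : ℝ) (q : Fin n) : ℝ :=
  (Finset.range n).sup' ⟨0, Finset.mem_range.2 (Nat.pos_of_ne_zero (NeZero.ne n))⟩
    (fun l => ((V.filter (fun v => 1 ≤ dist (h v) q ∧ dist (h v) q ≤ l)).card : ℝ) - μ * l)

theorem le_excess (h : U → Fin n) (V : Finset U) (μ : ℝ) (q : Fin n) {l : ℕ} (hl : l < n) :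
    ((V.filter (fun v => 1 ≤ dist (h v) q ∧ dist (h v) q ≤ l)).card : ℝ) ≤
      excess h V μ q + μ * l := by
  have := Finset.le_sup' (fun l : ℕ =>
    ((V.filter (fun v => 1 ≤ dist (h v) q ∧ dist (h v) q ≤ l)).card : ℝ) - μ * l)
    (Finset.mem_range.2 hl)
  unfold excess
  linarith

theorem excess_le {h : U → Fin n} {V : Finset U} {μ : ℝ} {q : Fin n} {a : ℝ}
    (ha : ∀ l < n, ((V.filter (fun v => 1 ≤ dist (h v) q ∧ dist (h v) q ≤ l)).card : ℝ) - μ * l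
      ≤ a) : excess h V μ q ≤ a :=
  Finset.sup'_le _ _ fun l hl => ha l (Finset.mem_range.1 hl)

theorem excess_nonneg (h : U → Fin n) (V : Finset U) (μ : ℝ) (q : Fin n) :
    0 ≤ excess h V μ q := by
  have h1 := le_excess h V μ q (l := 0) (Nat.pos_of_ne_zero (NeZero.ne n))
  have h2 : (0 : ℝ) ≤ (V.filter (fun v => 1 ≤ dist (h v) q ∧ dist (h v) q ≤ 0)).card :=
    Nat.cast_nonneg _
  simp only [Nat.cast_zero, mul_zero, add_zero] at h1
  linarith

theorem excess_mono (h : U → Fin n) {V W : Finset U} (hVW : V ⊆ W) (μ : ℝ) (q : Fin n) :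
    excess h V μ q ≤ excess h W μ q := by
  refine excess_le fun l hl => ?_
  have h1 := le_excess h W μ q hl
  have h2 : ((V.filter (fun v => 1 ≤ dist (h v) q ∧ dist (h v) q ≤ l)).card : ℝ) ≤
      (W.filter (fun v => 1 ≤ dist (h v) q ∧ dist (h v) q ≤ l)).card := by
    exact_mod_cast Finset.card_le_card (Finset.filter_subset_filter _ hVW)
  linarith

theorem excess_congr {h h' : U → Fin n} {V : Finset U} (hh : ∀ v ∈ V, h v = h' v) (μ : ℝ)
    (q : Fin n) : excess h V μ q = excess h' V μ q := by
  unfold excess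
  congr 1
  funext l
  congr 3
  exact Finset.filter_congr fun v hv => by rw [hh v hv]

omit [NeZero n] in
theorem hashCount_congr {h h' : U → Fin n} {V : Finset U} (hh : ∀ v ∈ V, h v = h' v)
    (q : Fin n) : hashCount h V q = hashCount h' V q := by
  unfold hashCount
  congr 1
  exact Finset.filter_congr fun v hv => by rw [hh v hv]

/-- The evolution of the queue from one position to the next. -/
theorem excess_succ_le (h : U → Fin n) (V : Finset U) (μ : ℝ) (q : Fin n) :
    excess h V μ (q + 1) ≤ max 0 (excess h V μ q + hashCount h V q - μ) := by
  classical
  refine excess_le fun l hl => ?_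
  rcases l with _ | l
  · have h1 : V.filter (fun v => 1 ≤ dist (h v) (q + 1) ∧ dist (h v) (q + 1) ≤ 0) = ∅ := by
      refine Finset.filter_false_of_mem fun v _ => by omega
    rw [h1]
    simp
  · refine le_max_of_le_right ?_
    have h1 := le_excess h V μ q (l := l) (by omega)
    have h2 : (V.filter (fun v => 1 ≤ dist (h v) (q + 1) ∧ dist (h v) (q + 1) ≤ l + 1)).card ≤
        (V.filter (fun v => 1 ≤ dist (h v) q ∧ dist (h v) q ≤ l)).card + hashCount h V q := by
      unfold hashCount
      refine (Finset.card_le_card ?_).trans (Finset.card_union_le _ _)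
      intro v hv
      simp only [Finset.mem_filter, Finset.mem_union] at hv ⊢
      obtain ⟨hv1, hv2, hv3⟩ := hv
      rcases Nat.eq_zero_or_pos (dist (h v) q) with h0 | h0
      · exact Or.inr ⟨hv1, dist_eq_zero h0⟩
      · left
        rw [dist_succ] at hv2 hv3
        split_ifs at hv2 hv3
        · exact ⟨hv1, h0, by omega⟩
        · omega
    have h2' : ((V.filter (fun v => 1 ≤ dist (h v) (q + 1) ∧
        dist (h v) (q + 1) ≤ l + 1)).card : ℝ) ≤
        (V.filter (fun v => 1 ≤ dist (h v) q ∧ dist (h v) q ≤ l)).card + hashCount h V q := by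
      exact_mod_cast h2
    push_cast
    linarith

/-- Comparing the sum of the squares of the excesses at all positions with itself, shifted by
one. -/
theorem sum_excess_le (h : U → Fin n) (V : Finset U) (μ : ℝ) :
    2 * μ * ∑ q, excess h V μ q - 2 * ∑ q, excess h V μ q * hashCount h V q ≤
      ∑ q, (hashCount h V q : ℝ) * hashCount h V q - 2 * μ * V.card + n * μ ^ 2 := by
  have h1 : ∑ q, excess h V μ (q + 1) ^ 2 = ∑ q, excess h V μ q ^ 2 :=
    Equiv.sum_comp (Equiv.addRight (1 : Fin n)) (fun q => excess h V μ q ^ 2)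
  have h2 : ∑ q, excess h V μ (q + 1) ^ 2 ≤
      ∑ q, (excess h V μ q + hashCount h V q - μ) ^ 2 := by
    refine Finset.sum_le_sum fun q _ => ?_
    have e1 := excess_succ_le h V μ q
    have e2 := excess_nonneg h V μ (q + 1)
    rcases max_cases 0 (excess h V μ q + hashCount h V q - μ) with ⟨e3, e4⟩ | ⟨e3, e4⟩
    · rw [e3] at e1
      have : excess h V μ (q + 1) = 0 := le_antisymm e1 e2
      rw [this, zero_pow two_ne_zero]
      positivity
    · rw [e3] at e1
      exact pow_le_pow_left₀ e2 e1 2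
  have h3 : ∑ q, (excess h V μ q + hashCount h V q - μ) ^ 2 = ∑ q, excess h V μ q ^ 2
      + 2 * ∑ q, excess h V μ q * hashCount h V q - 2 * μ * ∑ q, excess h V μ q
      + ∑ q, (hashCount h V q : ℝ) * hashCount h V q - 2 * μ * ∑ q, (hashCount h V q : ℝ)
      + n * μ ^ 2 := by
    have : (n : ℝ) * μ ^ 2 = ∑ _q : Fin n, μ ^ 2 := by simp
    rw [this]
    simp only [Finset.mul_sum]
    rw [← Finset.sum_add_distrib, ← Finset.sum_sub_distrib, ← Finset.sum_add_distrib,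
      ← Finset.sum_sub_distrib, ← Finset.sum_add_distrib]
    exact Finset.sum_congr rfl fun q _ => by ring
  have h4 : ∑ q, (hashCount h V q : ℝ) = V.card := by
    rw [← Nat.cast_sum, sum_hashCount_univ]
  rw [h4] at h3
  linarith

omit [NeZero n] in
theorem sum_mul_hashCount (h : U → Fin n) (V : Finset U) (F : Fin n → ℝ) :
    ∑ q, F q * hashCount h V q = ∑ v ∈ V, F (h v) := by
  unfold hashCount
  simp_rw [Finset.card_filter, Nat.cast_sum, Finset.mul_sum]
  rw [Finset.sum_comm]
  refine Finset.sum_congr rfl fun v _ => ?_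
  simp

variable [DecidableEq U]

/-- A key does not contribute to the excess at its own hash. -/
theorem excess_erase (h : U → Fin n) (V : Finset U) (μ : ℝ) (u : U) :
    excess h V μ (h u) = excess h (V.erase u) μ (h u) := by
  unfold excess
  congr 1
  funext l
  congr 3
  ext v
  simp only [Finset.mem_filter, Finset.mem_erase]
  constructor
  · rintro ⟨h1, h2⟩
    refine ⟨⟨?_, h1⟩, h2⟩
    rintro rfl
    rw [dist_self] at h2
    omega
  · rintro ⟨⟨-, h1⟩, h2⟩
    exact ⟨h1, h2⟩

end Excess

/-! ### Expected queue lengths for fully random hashes -/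

section Expectation

variable {n : ℕ} [NeZero n] {U : Type*} {Ω : Type*} [MeasurableSpace Ω]
  {P : Measure Ω} [IsProbabilityMeasure P] {h : Ω → U → Fin n}

omit [NeZero n] in
theorem exists_eq_of_dependsOn {β : Type*} {Φ : (U → Fin n) → β} {V : Finset U}
    (hΦ : DependsOn Φ (V : Set U)) (hn : 0 < n) :
    ∃ Ψ : (V → Fin n) → β, ∀ g, Φ g = Ψ (fun v => g v) := by
  classical
  refine ⟨fun φ => Φ (fun u => if hu : u ∈ V then φ ⟨u, hu⟩ else ⟨0, hn⟩), fun g => ?_⟩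
  refine hΦ fun v hv => ?_
  rw [dif_pos (by simpa using hv)]

/-- A function of the hashes of finitely many keys takes finitely many values. -/
theorem FullyRandom.integrable (hh : FullyRandom P h) {Φ : (U → Fin n) → ℝ} {V : Finset U}
    (hΦ : DependsOn Φ (V : Set U)) : Integrable (fun ω => Φ (h ω)) P := by
  obtain ⟨Ψ, hΨ⟩ := exists_eq_of_dependsOn hΦ (Nat.pos_of_ne_zero (NeZero.ne n))
  simp_rw [hΨ]
  have hm : Measurable (fun ω (v : V) => h ω v) := measurable_pi_lambda _ fun v => hh.measurable v
  have : IsProbabilityMeasure (P.map (fun ω (v : V) => h ω v)) :=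
    Measure.isProbabilityMeasure_map hm.aemeasurable
  exact Integrable.comp_measurable (g := Ψ) Integrable.of_finite hm

omit [NeZero n] [IsProbabilityMeasure P] in
theorem FullyRandom.integral_ite (hh : FullyRandom P h) (u : U) (q : Fin n) :
    ∫ ω, (if h ω u = q then (1 : ℝ) else 0) ∂P = 1 / n := by
  rw [← hh.uniform u q]
  have hm : MeasurableSet {ω | h ω u = q} := hh.measurable u (measurableSet_singleton q)
  rw [← integral_indicator_one hm]
  refine integral_congr_ae (.of_forall fun ω => ?_)
  simp [Set.indicator_apply]

/-- The hash of a key is independent of the hashes of the other keys, and uniform: it can be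
replaced by an average over all positions. -/
theorem FullyRandom.integral_hash (hh : FullyRandom P h) {V : Finset U} {u : U} (hu : u ∉ V)
    {Φ : (U → Fin n) → Fin n → ℝ} (hΦ : ∀ q, DependsOn (fun g => Φ g q) (V : Set U)) :
    Integrable (fun ω => Φ (h ω) (h ω u)) P ∧
      ∫ ω, Φ (h ω) (h ω u) ∂P = 1 / n * ∑ q, ∫ ω, Φ (h ω) q ∂P := by
  classical
  have hint : Integrable (fun ω => Φ (h ω) (h ω u)) P := by
    refine hh.integrable (Φ := fun g => Φ g (g u)) (V := insert u V) fun g g' hg => ?_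
    have h1 : g u = g' u := hg u (by simp)
    have h2 := hΦ (g' u) (x := g) (y := g') fun v hv => hg v (by simp at hv ⊢; exact Or.inr hv)
    simp only at h2 ⊢
    rw [h1, h2]
  refine ⟨hint, ?_⟩
  have hsum : ∀ ω, Φ (h ω) (h ω u) = ∑ q, Φ (h ω) q * (if h ω u = q then (1 : ℝ) else 0) := by
    intro ω
    simp
  have hqi : ∀ q, Integrable (fun ω => Φ (h ω) q * (if h ω u = q then (1 : ℝ) else 0)) P := by
    intro q
    refine hh.integrable (Φ := fun g => Φ g q * (if g u = q then (1 : ℝ) else 0))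
      (V := insert u V) fun g g' hg => ?_
    have h1 : g u = g' u := hg u (by simp)
    have h2 := hΦ q (x := g) (y := g') fun v hv => hg v (by simp at hv ⊢; exact Or.inr hv)
    simp only at h2 ⊢
    rw [h1, h2]
  simp_rw [hsum]
  rw [integral_finsetSum _ fun q _ => hqi q, Finset.mul_sum]
  refine Finset.sum_congr rfl fun q _ => ?_
  obtain ⟨Ψ, hΨ⟩ := exists_eq_of_dependsOn (hΦ q) (Nat.pos_of_ne_zero (NeZero.ne n))
  have hm : Measurable (fun ω (v : V) => h ω v) := measurable_pi_lambda _ fun v => hh.measurable v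
  have hmu : Measurable (fun ω (v : ({u} : Finset U)) => h ω v) :=
    measurable_pi_lambda _ fun v => hh.measurable v
  have hind := hh.indep.indepFun_finset V {u} (Finset.disjoint_singleton_right.2 hu) hh.measurable
  have := hind.integral_fun_comp_mul_comp (f := Ψ)
    (g := fun φ => if φ ⟨u, by simp⟩ = q then (1 : ℝ) else 0) hm.aemeasurable hmu.aemeasurable
    (Measurable.of_discrete).aestronglyMeasurable (Measurable.of_discrete).aestronglyMeasurable
  simp_rw [hΨ]
  rw [this, hh.integral_ite u q, mul_comm]

omit [NeZero n] [IsProbabilityMeasure P] in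
theorem FullyRandom.neg (hh : FullyRandom P h) : FullyRandom P (fun ω u => -(h ω u)) where
  measurable u := (Measurable.of_discrete (f := fun q : Fin n => -q)).comp (hh.measurable u)
  uniform u i := by
    rw [← hh.uniform u (-i)]
    congr 1
    ext ω
    simp [neg_eq_iff_eq_neg]
  indep := hh.indep.comp (fun _ q => -q) fun _ => Measurable.of_discrete

theorem dependsOn_excess (V : Finset U) (μ : ℝ) (q : Fin n) :
    DependsOn (fun g : U → Fin n => excess g V μ q) (V : Set U) :=
  fun _ _ hg => excess_congr (fun v hv => hg v (by simpa using hv)) μ q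

omit [NeZero n] in
theorem dependsOn_hashCount (V : Finset U) (q : Fin n) :
    DependsOn (fun g : U → Fin n => (hashCount g V q : ℝ)) (V : Set U) :=
  fun _ _ hg => by
    simp only
    rw [hashCount_congr fun v hv => hg v (by simpa using hv)]

theorem FullyRandom.integral_hashCount (hh : FullyRandom P h) {V : Finset U} {u : U}
    (hu : u ∉ V) :
    Integrable (fun ω => (hashCount (h ω) V (h ω u) : ℝ)) P ∧
      ∫ ω, (hashCount (h ω) V (h ω u) : ℝ) ∂P = V.card / n := by
  obtain ⟨h1, h2⟩ := hh.integral_hash hu (Φ := fun g q => (hashCount g V q : ℝ))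
    (dependsOn_hashCount V)
  refine ⟨h1, ?_⟩
  rw [h2, ← integral_finsetSum _ fun q _ => hh.integrable (dependsOn_hashCount V q)]
  have : ∀ ω, ∑ q, (hashCount (h ω) V q : ℝ) = V.card := by
    intro ω
    rw [← Nat.cast_sum, sum_hashCount_univ]
  simp only [this, integral_const, probReal_univ, smul_eq_mul]
  ring

/-- The expected length of a queue at the hash of a key, if the load `|V| / n` is smaller than the
rate `μ` by at least `δ`. -/
theorem FullyRandom.integral_excess (hh : FullyRandom P h) {V : Finset U} {u : U} (hu : u ∉ V)
    {μ δ : ℝ} (hδ : 0 < δ) (hV : V.card ≤ n * (μ - δ)) (hμ : μ ≤ 1) :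
    Integrable (fun ω => excess (h ω) V μ (h ω u)) P ∧
      ∫ ω, excess (h ω) V μ (h ω u) ∂P ≤ V.card / (2 * δ * n) + 1 / 2 := by
  classical
  have hn : (0 : ℝ) < n := Nat.cast_pos.2 (Nat.pos_of_ne_zero (NeZero.ne n))
  obtain ⟨hint, heq⟩ := hh.integral_hash hu (Φ := fun g q => excess g V μ q)
    (dependsOn_excess V μ)
  refine ⟨hint, ?_⟩
  rw [heq]
  set A := ∑ q, ∫ ω, excess (h ω) V μ q ∂P with hA
  have hA0 : 0 ≤ A := Finset.sum_nonneg fun q _ =>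
    integral_nonneg fun ω => excess_nonneg _ _ _ _
  have hiE : ∀ q, Integrable (fun ω => excess (h ω) V μ q) P :=
    fun q => hh.integrable (dependsOn_excess V μ q)
  have hiV : ∀ v ∈ V, Integrable (fun ω => excess (h ω) V μ (h ω v)) P ∧
      ∫ ω, excess (h ω) V μ (h ω v) ∂P ≤ 1 / n * A := by
    intro v _
    simp_rw [fun ω => excess_erase (h ω) V μ v]
    obtain ⟨e1, e2⟩ := hh.integral_hash (Finset.notMem_erase v V)
      (Φ := fun g q => excess g (V.erase v) μ q) (dependsOn_excess _ μ)
    refine ⟨e1, ?_⟩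
    rw [e2]
    refine mul_le_mul_of_nonneg_left (Finset.sum_le_sum fun q _ => ?_) (by positivity)
    exact integral_mono (hh.integrable (dependsOn_excess _ μ q)) (hiE q)
      fun ω => excess_mono _ (Finset.erase_subset _ _) _ _
  have hiB : ∀ v ∈ V, Integrable (fun ω => (hashCount (h ω) V (h ω v) : ℝ)) P ∧
      ∫ ω, (hashCount (h ω) V (h ω v) : ℝ) ∂P ≤ 1 + V.card / n := by
    intro v hv
    have e0 : ∀ ω, (hashCount (h ω) V (h ω v) : ℝ)
        = 1 + hashCount (h ω) (V.erase v) (h ω v) := by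
      intro ω
      have := hashCount_insert (h ω) (Finset.notMem_erase v V) (h ω v)
      rw [Finset.insert_erase hv, if_pos rfl] at this
      rw [this]
      push_cast
      ring
    obtain ⟨e1, e2⟩ := hh.integral_hashCount (Finset.notMem_erase v V)
    simp_rw [e0]
    refine ⟨(integrable_const _).add e1, ?_⟩
    rw [integral_add (integrable_const _) e1, e2]
    simp only [integral_const, probReal_univ, smul_eq_mul, mul_one]
    have : ((V.erase v).card : ℝ) ≤ V.card := by
      exact_mod_cast Finset.card_le_card (Finset.erase_subset v V)
    gcongr
  -- integrate the inequality between the squares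
  have hpt : ∀ ω, 2 * μ * ∑ q, excess (h ω) V μ q ≤
      2 * ∑ v ∈ V, excess (h ω) V μ (h ω v) + (∑ v ∈ V, (hashCount (h ω) V (h ω v) : ℝ)
        + (n * μ ^ 2 - 2 * μ * V.card)) := by
    intro ω
    have h1 := sum_excess_le (h ω) V μ
    rw [sum_mul_hashCount (h ω) V (fun q => excess (h ω) V μ q),
      sum_mul_hashCount (h ω) V (fun q => (hashCount (h ω) V q : ℝ))] at h1
    linarith
  have hi1 : Integrable (fun ω => 2 * ∑ v ∈ V, excess (h ω) V μ (h ω v)) P :=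
    (integrable_finsetSum _ fun v hv => (hiV v hv).1).const_mul _
  have hi2 : Integrable (fun ω => ∑ v ∈ V, (hashCount (h ω) V (h ω v) : ℝ)) P :=
    integrable_finsetSum _ fun v hv => (hiB v hv).1
  have hi3 : Integrable (fun ω => ∑ v ∈ V, (hashCount (h ω) V (h ω v) : ℝ)
      + (n * μ ^ 2 - 2 * μ * V.card)) P := hi2.add (integrable_const _)
  have hI := integral_mono ((integrable_finsetSum _ fun q _ => hiE q).const_mul (2 * μ))
    (hi1.add hi3) hpt
  simp only [Pi.add_apply] at hI
  rw [integral_add hi1 hi3, integral_add hi2 (integrable_const _),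
    integral_const_mul, integral_const_mul, integral_finsetSum _ fun q _ => hiE q,
    integral_finsetSum _ fun v hv => (hiV v hv).1,
    integral_finsetSum _ fun v hv => (hiB v hv).1, integral_const] at hI
  simp only [probReal_univ, smul_eq_mul, one_mul] at hI
  have hs1 : ∑ v ∈ V, ∫ ω, excess (h ω) V μ (h ω v) ∂P ≤ V.card * (1 / n * A) := by
    rw [← nsmul_eq_mul]
    exact Finset.sum_le_card_nsmul _ _ _ fun v hv => (hiV v hv).2
  have hs2 : ∑ v ∈ V, ∫ ω, (hashCount (h ω) V (h ω v) : ℝ) ∂P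
      ≤ V.card * (1 + V.card / n) := by
    rw [← nsmul_eq_mul]
    exact Finset.sum_le_card_nsmul _ _ _ fun v hv => (hiB v hv).2
  obtain ⟨lam, hlam⟩ : ∃ lam : ℝ, lam = V.card / n := ⟨_, rfl⟩
  rw [← hlam] at hs2
  have hVl : (V.card : ℝ) = n * lam := by
    rw [hlam, mul_div_cancel₀ _ hn.ne']
  have hlam0 : 0 ≤ lam := hlam ▸ div_nonneg (Nat.cast_nonneg _) hn.le
  have hgap : δ ≤ μ - lam := by
    rw [hVl] at hV
    have := le_of_mul_le_mul_left hV hn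
    linarith
  set B := 1 / (n : ℝ) * A with hB
  have hAB : A = n * B := by rw [hB]; field_simp
  rw [← hA, hVl] at hI
  rw [hVl] at hs1 hs2
  rw [hVl]
  have hmain : 2 * (μ - lam) * B ≤ lam + (μ - lam) ^ 2 := by
    have : n * (2 * (μ - lam) * B) ≤ n * (lam + (μ - lam) ^ 2) := by
      rw [hAB] at hI
      nlinarith
    exact le_of_mul_le_mul_left this hn
  have hg0 : 0 < μ - lam := by linarith
  have h1 : B ≤ (lam + (μ - lam) ^ 2) / (2 * (μ - lam)) := by
    rw [le_div_iff₀ (by positivity)]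
    linarith
  calc B ≤ (lam + (μ - lam) ^ 2) / (2 * (μ - lam)) := h1
    _ = lam / (2 * (μ - lam)) + (μ - lam) / 2 := by field_simp
    _ ≤ lam / (2 * δ) + 1 / 2 := by
        gcongr
        linarith
    _ = n * lam / (2 * δ * n) + 1 / 2 := by
        rw [mul_comm (n : ℝ) lam, mul_div_mul_right _ _ hn.ne']

end Expectation


/-! ### Keys and new tombstones in arcs -/

section Arcs

variable {n : ℕ} [NeZero n] {U : Type*}

/-- The largest excess over `μ l` of the number of keys of `V` with hashes in an arc of `l` hashes
that follows `q`. -/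
noncomputable def forwardExcess (h : U → Fin n) (V : Finset U) (μ : ℝ) (q : Fin n) : ℝ :=
  excess (fun v => -(h v)) V μ (-q)

theorem card_le_forwardExcess (h : U → Fin n) (V : Finset U) (μ : ℝ) (q : Fin n) {l : ℕ}
    (hl : l < n) : ((V.filter (fun v => dist q (h v) ≤ l)).card : ℝ) ≤
      hashCount h V q + forwardExcess h V μ q + μ * l := by
  classical
  have h1 := le_excess (fun v => -(h v)) V μ (-q) hl
  simp only [dist_neg] at h1
  have h2 : (V.filter (fun v => dist q (h v) ≤ l)).card ≤ hashCount h V q +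
      (V.filter (fun v => 1 ≤ dist q (h v) ∧ dist q (h v) ≤ l)).card := by
    unfold hashCount
    refine (Finset.card_le_card ?_).trans (Finset.card_union_le _ _)
    intro v hv
    simp only [Finset.mem_filter, Finset.mem_union] at hv ⊢
    rcases Nat.eq_zero_or_pos (dist q (h v)) with h0 | h0
    · exact Or.inl ⟨hv.1, (dist_eq_zero h0).symm⟩
    · exact Or.inr ⟨hv.1, h0, hv.2⟩
  have h2' : ((V.filter (fun v => dist q (h v) ≤ l)).card : ℝ) ≤ hashCount h V q +
      (V.filter (fun v => 1 ≤ dist q (h v) ∧ dist q (h v) ≤ l)).card := by exact_mod_cast h2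
  unfold forwardExcess
  linarith

theorem back_arc_eq (q : Fin n) {l : ℕ} (hl : l < n) :
    Finset.univ.filter (fun g : Fin n => 1 ≤ dist g q ∧ dist g q ≤ l) =
      Finset.univ.filter (fun g : Fin n => dist (adv q (n - l)) g < l) := by
  refine Finset.filter_congr fun g _ => ?_
  have h1 := dist_spec g q
  have h2 := dist_spec (adv q (n - l)) g
  have h3 := adv_spec q (k := n - l) (by omega)
  have := g.isLt
  have := q.isLt
  have := (adv q (n - l)).isLt
  omega

/-- A flow that changes by at most `b g - a g` at each `g` of an arc changes by at most the
difference of the sums over the arc. -/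
theorem telescope_arc {a b F : Fin n → ℕ} {q : Fin n} {l : ℕ} (hl : l < n)
    (hF : ∀ g, dist q g < l → a g + F (g + 1) ≤ F g + b g) :
    ∑ g ∈ Finset.univ.filter (fun g => dist q g < l), a g + F (adv q l) ≤
      F q + ∑ g ∈ Finset.univ.filter (fun g => dist q g < l), b g := by
  induction l with
  | zero => simp [adv_zero]
  | succ l ih =>
    have h1 := ih (by omega) fun g hg => hF g (by omega)
    have h2 := dist_adv q (k := l) (by omega)
    have h3 := hF (adv q l) (by omega)
    rw [← adv_succ] at h3
    have h4 : Finset.univ.filter (fun g => dist q g < l + 1) =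
        insert (adv q l) (Finset.univ.filter (fun g => dist q g < l)) := by
      ext g
      simp only [Finset.mem_filter, Finset.mem_univ, true_and, Finset.mem_insert]
      constructor
      · intro hg
        rcases Nat.lt_or_ge (dist q g) l with h5 | h5
        · exact Or.inr h5
        · exact Or.inl (dist_inj (g := q) (by omega))
      · rintro (rfl | hg) <;> omega
    have h5 : adv q l ∉ Finset.univ.filter (fun g => dist q g < l) := by simp [h2]
    rw [h4, Finset.sum_insert h5, Finset.sum_insert h5]
    omega

/-- An arc of `l` hashes has `l f / (2 n)` new tombstones, up to an error of three, where `f` is the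
number of slots without a key at the time of the rebuild. -/
theorem arc_newTombs {A₀ : Finset U} (s : Fin n) {l : ℕ} (hl : l ≤ n) :
    (l : ℝ) * ((n - A₀.card : ℕ) / (2 * n)) - 3 ≤
        (∑ g ∈ Finset.univ.filter (fun g : Fin n => dist s g < l), newTombs n A₀ g : ℕ) ∧
      ((∑ g ∈ Finset.univ.filter (fun g : Fin n => dist s g < l), newTombs n A₀ g : ℕ) : ℝ) ≤
        l * ((n - A₀.card : ℕ) / (2 * n)) + 3 := by
  have hn : (0 : ℝ) < n := Nat.cast_pos.2 (Nat.pos_of_ne_zero (NeZero.ne n))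
  obtain ⟨h1, h2⟩ := arc_tombHashes (n := n) (f := n - A₀.card) s hl
  change _ ≤ 2 * n * (∑ g ∈ Finset.univ.filter (fun g : Fin n => dist s g < l), newTombs n A₀ g)
    + 6 * n at h1
  change 2 * n * (∑ g ∈ Finset.univ.filter (fun g : Fin n => dist s g < l), newTombs n A₀ g)
    ≤ _ at h2
  generalize (∑ g ∈ Finset.univ.filter (fun g : Fin n => dist s g < l), newTombs n A₀ g) = X
    at h1 h2 ⊢
  generalize n - A₀.card = f at h1 h2 ⊢
  have h1' : (l : ℝ) * f ≤ 2 * n * X + 6 * n := by exact_mod_cast h1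
  have h2' : 2 * n * (X : ℝ) ≤ l * f + 6 * n := by exact_mod_cast h2
  have e : (l : ℝ) * (f / (2 * n)) = l * f / (2 * n) := by ring
  rw [e]
  constructor
  · rw [sub_le_iff_le_add, div_le_iff₀ (by positivity)]
    linarith
  · rw [← sub_le_iff_le_add, le_div_iff₀ (by positivity)]
    linarith

end Arcs

/-! ### Running times in terms of queue lengths -/

section Times

variable {n : ℕ} [NeZero n] {U : Type*} [DecidableEq U] {h : U → Fin n} {A₀ J A : Finset U}
  {c : ℕ} {T : Table n U}

/-- The displacement beyond the hash of `u` of entries with smaller hashes is bounded by the length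
of a queue of keys; the tombstones take a share of `f / (2 n)` from the rate of service. -/
theorem Good.offset_le (hG : Good h A₀ J A c T) (hP : Phase n A₀ J A c) (hA : A.card < n) (u : U)
    {j : ℕ} (hj : j < n) {g : Fin n} (hg : layout h T (adv (h u) j) = some g)
    (hd : j < dist g (adv (h u) j)) :
    (j : ℝ) ≤ excess h ((A₀ ∪ J).erase u) (1 - (n - A₀.card : ℕ) / (2 * n)) (h u) + 2 := by
  classical
  obtain ⟨p, hp⟩ := hG.exists_free hP hA
  obtain ⟨l, hl, hcard⟩ := hG.ordered.crossing (p := p) (by simp [layout, hp, slotHash]) hj hg hd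
  rw [card_layout_eq h T (fun g' => 1 ≤ dist g' (h u) ∧ dist g' (h u) ≤ l)] at hcard
  have h1 := hcard.trans (Finset.sum_le_sum fun g _ => hG.item_le hP g)
  rw [Finset.sum_add_distrib, sum_hashCount, back_arc_eq (h u) hl] at h1
  have h2 := (arc_newTombs (A₀ := A₀) (adv (h u) (n - l)) hl.le).2
  have h3 := le_excess h (A₀ ∪ J) (1 - (n - A₀.card : ℕ) / (2 * n)) (h u) hl
  rw [excess_erase] at h3
  have h1' : (l : ℝ) + j + 1 ≤ (∑ g ∈ Finset.univ.filter
      (fun g : Fin n => dist (adv (h u) (n - l)) g < l), newTombs n A₀ g : ℕ) +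
      (((A₀ ∪ J).filter (fun v => 1 ≤ dist (h v) (h u) ∧ dist (h v) (h u) ≤ l)).card : ℝ) := by
    exact_mod_cast h1
  linarith

/-- The touched keys in an arc that follows the hash of `u`. -/
theorem card_touched_le (h : U → Fin n) (J : Finset U) (μ : ℝ) (hμ : 0 ≤ μ) (u : U) {V : Finset U}
    (hJV : J ⊆ V) {l : ℕ} (hl : l ≤ n) :
    ((J.filter (fun v => dist (h u) (h v) < l)).card : ℝ) ≤
      1 + hashCount h (V.erase u) (h u) + forwardExcess h (J.erase u) μ (h u) + μ * l := by
  have hR : 0 ≤ forwardExcess h (J.erase u) μ (h u) := excess_nonneg _ _ _ _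
  rcases l with _ | l
  · simp only [not_lt_zero, Finset.filter_false, Finset.card_empty, Nat.cast_zero, mul_zero]
    positivity
  · have h1 := card_le_forwardExcess h (J.erase u) μ (h u) (l := l) (by omega)
    have h2 := hashCount_mono h (Finset.erase_subset_erase u hJV) (h u)
    have h3 : (J.filter (fun v => dist (h u) (h v) < l + 1)).card ≤
        ((J.erase u).filter (fun v => dist (h u) (h v) ≤ l)).card + 1 := by
      refine (Finset.card_le_card (t := insert u
        ((J.erase u).filter (fun v => dist (h u) (h v) ≤ l))) ?_).trans
        (Finset.card_insert_le _ _)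
      intro v hv
      simp only [Finset.mem_filter, Finset.mem_insert, Finset.mem_erase] at hv ⊢
      by_cases hvu : v = u
      · exact Or.inl hvu
      · exact Or.inr ⟨⟨hvu, hv.1⟩, by omega⟩
    have h2' : (hashCount h (J.erase u) (h u) : ℝ) ≤ hashCount h (V.erase u) (h u) := by
      exact_mod_cast h2
    have h3' : ((J.filter (fun v => dist (h u) (h v) < l + 1)).card : ℝ) ≤
        ((J.erase u).filter (fun v => dist (h u) (h v) ≤ l)).card + 1 := by exact_mod_cast h3
    push_cast
    linarith

/-- A query passes entries with smaller hashes, keys of equal hash, and tombstones. -/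
theorem Good.queryTime_le (hG : Good h A₀ J A c T) (hP : Phase n A₀ J A c) (hA : A.card < n)
    (u : U) :
    (queryTime h T u : ℝ) ≤
      8 * (excess h ((A₀ ∪ J).erase u) (1 - (n - A₀.card : ℕ) / (2 * n)) (h u) +
        forwardExcess h (J.erase u) (3 * (n - A₀.card : ℕ) / (8 * n)) (h u) +
        2 * hashCount h ((A₀ ∪ J).erase u) (h u)) + 57 := by
  classical
  have hn : (0 : ℝ) < n := Nat.cast_pos.2 (Nat.pos_of_ne_zero (NeZero.ne n))
  obtain ⟨p, hp⟩ := hG.exists_free hP hA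
  have hpn := (dist_spec (h u) p).1
  obtain ⟨K, hK⟩ : ∃ K, queryOffset h T u = some K := by
    unfold queryOffset
    rw [← Option.isSome_iff_exists, List.find?_isSome]
    refine ⟨dist (h u) p, by simpa using hpn, ?_⟩
    unfold queryStops
    rw [probe_eq, adv_dist, hp]
  have hKt : queryTime h T u = K + 1 := by simp [queryTime, hK]
  unfold queryOffset at hK
  rw [List.find?_range_eq_some] at hK
  obtain ⟨-, hKn, hK⟩ := hK
  rw [List.mem_range] at hKn
  have hexamined : ∀ i < K, (∃ v, T (adv (h u) i) = .key v ∧ v ≠ u ∧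
      i ≤ dist (h v) (adv (h u) i)) ∨ ∃ g, T (adv (h u) i) = .tomb g :=
    fun i hi => not_queryStops (by simpa using hK i hi)
  set W := excess h ((A₀ ∪ J).erase u) (1 - (n - A₀.card : ℕ) / (2 * n)) (h u) with hW
  have hW0 : 0 ≤ W := excess_nonneg _ _ _ _
  -- the offsets of entries with hashes before that of `u`, of keys of the same hash, and of
  -- tombstones with hashes from that of `u` on
  set S₁ := Finset.range (⌊W + 2⌋₊ + 1) with hS₁
  set S₂ := (Finset.range K).filter (fun i => ∃ v, T (adv (h u) i) = .key v ∧ v ≠ u ∧ h v = h u)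
    with hS₂
  set S₃ := (Finset.range K).filter (fun i => ∃ g, T (adv (h u) i) = .tomb g ∧ dist (h u) g < K)
    with hS₃
  have hcover : Finset.range K ⊆ S₁ ∪ S₂ ∪ S₃ := by
    intro i hi
    rw [Finset.mem_range] at hi
    have hiu := dist_adv (h u) (k := i) (by omega)
    simp only [Finset.mem_union, hS₁, hS₂, hS₃, Finset.mem_filter, Finset.mem_range]
    rcases hexamined i hi with ⟨v, hv, hvu, hvd⟩ | ⟨g, hg⟩
    · rcases Nat.eq_or_lt_of_le hvd with h1 | h1
      · exact Or.inl (Or.inr ⟨hi, v, hv, hvu, (dist_inj_left (hiu.trans h1)).symm⟩)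
      · refine Or.inl (Or.inl (Nat.lt_succ_of_le (Nat.le_floor ?_)))
        exact hG.offset_le hP hA u (by omega) (g := h v) (by simp [layout, hv, slotHash]) h1
    · rcases Nat.lt_or_ge i (dist g (adv (h u) i)) with h1 | h1
      · refine Or.inl (Or.inl (Nat.lt_succ_of_le (Nat.le_floor ?_)))
        exact hG.offset_le hP hA u (by omega) (g := g) (by simp [layout, hg, slotHash]) h1
      · refine Or.inr ⟨hi, g, hg, ?_⟩
        have e1 := dist_spec (h u) (adv (h u) i)
        have e2 := dist_spec g (adv (h u) i)
        have e3 := dist_spec (h u) g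
        have := g.isLt
        have := (h u).isLt
        have := (adv (h u) i).isLt
        omega
  have hc₁ : (S₁.card : ℝ) ≤ W + 3 := by
    rw [hS₁, Finset.card_range]
    push_cast
    have := Nat.floor_le (show 0 ≤ W + 2 by linarith)
    linarith
  have hc₂ : S₂.card ≤ hashCount h ((A₀ ∪ J).erase u) (h u) := by
    have hex : ∀ i ∈ S₂, ∃ v, T (adv (h u) i) = .key v ∧ v ≠ u ∧ h v = h u :=
      fun i hi => (Finset.mem_filter.1 hi).2
    have : Nonempty U := ⟨u⟩
    choose! v hv using hex
    refine Finset.card_le_card_of_injOn v ?_ ?_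
    · intro i hi
      obtain ⟨e1, e2, e3⟩ := hv i hi
      simp only [Finset.coe_filter, Set.mem_ofPred_eq, Finset.mem_erase]
      exact ⟨⟨e2, hP.new (hG.keys.mem e1)⟩, e3⟩
    · intro i hi i' hi' hii
      have e1 := (hv i hi).1
      have e2 := (hv i' hi').1
      rw [hii] at e1
      have e3 := hG.keys.slot_unique e1 e2
      have e4 : i < K := Finset.mem_range.1 (Finset.mem_filter.1 hi).1
      have e5 : i' < K := Finset.mem_range.1 (Finset.mem_filter.1 hi').1
      rw [← dist_adv (h u) (k := i) (by omega), e3, dist_adv (h u) (k := i') (by omega)]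
  have hc₃ : S₃.card ≤ ∑ g ∈ Finset.univ.filter (fun g => dist (h u) g < K), newTombs n A₀ g +
      (J.filter (fun v => dist (h u) (h v) < K)).card := by
    have e1 : S₃.card ≤ (Finset.univ.filter
        (fun r => ∃ g, T r = .tomb g ∧ dist (h u) g < K)).card := by
      refine Finset.card_le_card_of_injOn (adv (h u)) ?_ ?_
      · intro i hi
        simpa using (Finset.mem_filter.1 hi).2
      · intro i hi i' hi' hii
        have e4 : i < K := Finset.mem_range.1 (Finset.mem_filter.1 hi).1
        have e5 : i' < K := Finset.mem_range.1 (Finset.mem_filter.1 hi').1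
        rw [← dist_adv (h u) (k := i) (by omega), hii, dist_adv (h u) (k := i') (by omega)]
    rw [card_tomb_eq T (fun g => dist (h u) g < K)] at e1
    refine e1.trans ((Finset.sum_le_sum fun g _ => hG.tombs_le g).trans ?_)
    rw [Finset.sum_add_distrib, sum_hashCount]
    exact Nat.add_le_add_left (Finset.card_le_card
      (Finset.filter_subset_filter _ Finset.sdiff_subset)) _
  have hKc : K ≤ S₁.card + S₂.card + S₃.card := by
    have := Finset.card_le_card hcover
    rw [Finset.card_range] at this
    have e1 := Finset.card_union_le (S₁ ∪ S₂) S₃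
    have e2 := Finset.card_union_le S₁ S₂
    omega
  have hKc' : (K : ℝ) ≤ S₁.card + S₂.card + S₃.card := by exact_mod_cast hKc
  have hc₂' : (S₂.card : ℝ) ≤ hashCount h ((A₀ ∪ J).erase u) (h u) := by exact_mod_cast hc₂
  have hc₃' : (S₃.card : ℝ) ≤ (∑ g ∈ Finset.univ.filter (fun g => dist (h u) g < K),
      newTombs n A₀ g : ℕ) + ((J.filter (fun v => dist (h u) (h v) < K)).card : ℝ) := by
    exact_mod_cast hc₃
  have hT := (arc_newTombs (A₀ := A₀) (h u) hKn.le).2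
  have hJ := card_touched_le h J (3 * (n - A₀.card : ℕ) / (8 * n)) (by positivity) u
    (V := A₀ ∪ J) Finset.subset_union_right hKn.le
  have hf : ((n - A₀.card : ℕ) : ℝ) / n ≤ 1 := by
    rw [div_le_one hn]
    exact_mod_cast Nat.sub_le _ _
  -- the tombstones in `S₃` make up at most a share of `1 / 2 + 3 / 8` of the slots
  have hf' : (K : ℝ) * ((n - A₀.card : ℕ) / (2 * n)) + 3 * (n - A₀.card : ℕ) / (8 * n) * K
      ≤ 7 / 8 * K := by
    have e : (K : ℝ) * ((n - A₀.card : ℕ) / (2 * n)) + 3 * (n - A₀.card : ℕ) / (8 * n) * K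
      = 7 / 8 * (K * (((n - A₀.card : ℕ) : ℝ) / n)) := by
      field_simp
      ring
    rw [e]
    have : (K : ℝ) * (((n - A₀.card : ℕ) : ℝ) / n) ≤ K * 1 := by gcongr
    linarith
  rw [hKt]
  push_cast
  linarith

/-- The flow of insertions past the hash of `u` is bounded by the length of a queue of touched keys
that is served by the tombstones. -/
theorem flow_le (hP : Phase n A₀ J A c) {F : Fin n → ℕ} (hc : ∀ g, F g ≤ c)
    (hF : ∀ g, F (g + 1) ≤ F g + hashCount h J g - newTombs n A₀ g) (u : U) :
    (F (h u) : ℝ) ≤ excess h (J.erase u) ((n - A₀.card : ℕ) / (2 * n)) (h u) + 3 := by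
  have hstep : ∀ g, 0 < F (g + 1) → newTombs n A₀ g + F (g + 1) ≤ F g + hashCount h J g := by
    intro g hg
    have := hF g
    omega
  -- the flow vanishes somewhere, as there are more new tombstones than touched keys
  obtain ⟨z, hz⟩ : ∃ z, F z = 0 := by
    by_contra! hne
    have h1 : ∑ g, (newTombs n A₀ g + F (g + 1)) ≤ ∑ g, (F g + hashCount h J g) :=
      Finset.sum_le_sum fun g _ => hstep g (Nat.pos_of_ne_zero (hne _))
    rw [Finset.sum_add_distrib, Finset.sum_add_distrib, sum_hashCount_univ] at h1
    have h2 : ∑ g, F (g + 1) = ∑ g, F g := Equiv.sum_comp (Equiv.addRight (1 : Fin n)) F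
    have h3 : ∑ g, newTombs n A₀ g = (n - A₀.card) / 2 := sum_count_tombHashes_univ _
    have h4 := hne (h u)
    have h5 := hc (h u)
    have h6 := hP.lt
    have h7 := hP.card_le
    simp only [windowLength] at h6
    omega
  -- after the last such position before the hash of `u`, the flow is positive
  obtain ⟨z, hz, hmin⟩ : ∃ z, F z = 0 ∧ ∀ z', F z' = 0 → dist z (h u) ≤ dist z' (h u) := by
    obtain ⟨z', h1, h2⟩ := Finset.exists_min_image (Finset.univ.filter (fun z => F z = 0))
      (fun z => dist z (h u)) ⟨z, by simp [hz]⟩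
    exact ⟨z', by simpa using h1, fun z'' h => h2 z'' (by simpa using h)⟩
  have hl := (dist_spec z (h u)).1
  have h1 := telescope_arc (a := newTombs n A₀) (b := hashCount h J) (F := F) (q := z) hl
    (fun g hg => hstep g (by
      by_contra h0
      have e := hmin (g + 1) (by omega)
      have e1 := dist_spec z g
      have e2 := dist_spec z (h u)
      have e3 := dist_spec (g + 1) (h u)
      have e4 := succ_spec g
      have := g.isLt
      have := (h u).isLt
      have := z.isLt
      have := (g + 1).isLt
      omega))
  rw [adv_dist, hz, sum_hashCount, zero_add] at h1
  have h2 := (arc_newTombs (A₀ := A₀) z hl.le).1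
  have h3 := le_excess h J ((n - A₀.card : ℕ) / (2 * n)) (h u) hl
  rw [excess_erase] at h3
  have h4 : (J.filter (fun v => dist z (h v) < dist z (h u))).card ≤
      (J.filter (fun v => 1 ≤ dist (h v) (h u) ∧ dist (h v) (h u) ≤ dist z (h u))).card := by
    refine Finset.card_le_card fun v hv => ?_
    rw [Finset.mem_filter] at hv ⊢
    refine ⟨hv.1, ?_⟩
    have e1 := dist_spec z (h v)
    have e2 := dist_spec z (h u)
    have e3 := dist_spec (h v) (h u)
    have := (h v).isLt
    have := (h u).isLt
    have := z.isLt
    omega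
  have h5 : ((∑ g ∈ Finset.univ.filter (fun g : Fin n => dist z g < dist z (h u)),
      newTombs n A₀ g : ℕ) : ℝ) + F (h u) ≤
      (J.filter (fun v => 1 ≤ dist (h v) (h u) ∧ dist (h v) (h u) ≤ dist z (h u))).card := by
    exact_mod_cast h1.trans h4
  linarith

/-- An insertion passes entries with smaller hashes and then keys up to the first tombstone, which
is not far since the tombstones outnumber the insertions of the rebuild window in every long arc. -/
theorem Good.insertTime_le (hG : Good h A₀ J A c T) (hP : Phase n A₀ J A c) (hA : A.card < n)
    {u : U} (hu : u ∉ A) :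
    (insertTime h T u : ℝ) ≤
      excess h ((A₀ ∪ J).erase u) (1 - (n - A₀.card : ℕ) / (2 * n)) (h u) +
      hashCount h ((A₀ ∪ J).erase u) (h u) + forwardExcess h ((A₀ ∪ J).erase u) 1 (h u) + 4 +
      8 * (n / (n - A₀.card : ℕ)) * (excess h (J.erase u) ((n - A₀.card : ℕ) / (2 * n)) (h u) +
        hashCount h ((A₀ ∪ J).erase u) (h u) +
        forwardExcess h (J.erase u) (3 * (n - A₀.card : ℕ) / (8 * n)) (h u) + 7) := by
  have hn : (0 : ℝ) < n := Nat.cast_pos.2 (Nat.pos_of_ne_zero (NeZero.ne n))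
  obtain ⟨p, hp⟩ := hG.exists_free hP hA
  obtain ⟨j, k, ho, hI⟩ := exists_insertsAt (h := h) hp u
  have hjk := hI.le
  have hkn := hI.lt
  have htime : insertTime h T u = k + 1 := by simp [insertTime, ho]
  have hj : (j : ℝ) ≤
      excess h ((A₀ ∪ J).erase u) (1 - (n - A₀.card : ℕ) / (2 * n)) (h u) + 3 := by
    have hW0 := excess_nonneg h ((A₀ ∪ J).erase u) (1 - (n - A₀.card : ℕ) / (2 * n)) (h u)
    rcases j with _ | j
    · push_cast
      linarith
    · obtain ⟨g, hg, hd⟩ := hI.before j (by omega)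
      have := hG.offset_le hP hA u (by omega) hg hd
      push_cast
      linarith
  have hk := hI.le_card hG.ordered hG.keys
  have hno : ∀ g, dist (h u) g < dist (h u) (landing h T u k) → total (tombWeight g) T = 0 := by
    intro g hg
    rw [tombWeight_total_eq_zero]
    intro r hr
    have := hI.no_tomb hG.ordered hp hr
    omega
  have hln := (dist_spec (h u) (landing h T u k)).1
  generalize dist (h u) (landing h T u k) = l at hk hno hln
  have hV : ((A.filter (fun v => dist (h u) (h v) ≤ l)).card : ℝ) ≤
      hashCount h ((A₀ ∪ J).erase u) (h u) + forwardExcess h ((A₀ ∪ J).erase u) 1 (h u) + l := by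
    have h1 := card_le_forwardExcess h ((A₀ ∪ J).erase u) 1 (h u) hln
    have h2 : ((A.filter (fun v => dist (h u) (h v) ≤ l)).card : ℝ) ≤
        (((A₀ ∪ J).erase u).filter (fun v => dist (h u) (h v) ≤ l)).card := by
      have : A ⊆ (A₀ ∪ J).erase u := fun v hv =>
        Finset.mem_erase.2 ⟨fun e => hu (e ▸ hv), hP.new hv⟩
      exact_mod_cast Finset.card_le_card (Finset.filter_subset_filter _ this)
    linarith
  obtain ⟨F, f1, f2, f3⟩ := hG.flow
  have hFu := flow_le (h := h) hP f1 f3 u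
  -- all new tombstones with hashes before the landing point have been used up
  have htel := telescope_arc (a := newTombs n A₀) (b := hashCount h J) (F := F) (q := h u) hln
    (fun g hg => by
      have e1 := f2 g
      have e2 := hG.keys.item_total h g
      rw [hno g hg] at e2
      have e3 := (hashCount_mono h hP.new g).trans (hashCount_union_le h A₀ J g)
      unfold hashCount at *
      omega)
  rw [sum_hashCount] at htel
  have htel' : ((∑ g ∈ Finset.univ.filter (fun g : Fin n => dist (h u) g < l),
      newTombs n A₀ g : ℕ) : ℝ) ≤ F (h u) + (J.filter (fun v => dist (h u) (h v) < l)).card := by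
    exact_mod_cast (Nat.le_add_right _ _).trans htel
  have hT := (arc_newTombs (A₀ := A₀) (h u) hln.le).1
  have hJ := card_touched_le h J (3 * (n - A₀.card : ℕ) / (8 * n)) (by positivity) u
    (V := A₀ ∪ J) Finset.subset_union_right hln.le
  have hf0 : (0 : ℝ) < (n - A₀.card : ℕ) := by
    have := hP.card_lt hA
    have : 0 < n - A₀.card := by omega
    exact_mod_cast this
  rw [htime]
  have hk' : (k : ℝ) ≤ j + (A.filter (fun v => dist (h u) (h v) ≤ l)).card := by exact_mod_cast hk
  generalize excess h (J.erase u) ((n - A₀.card : ℕ) / (2 * n)) (h u) = W₂ at *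
  generalize forwardExcess h (J.erase u) (3 * (n - A₀.card : ℕ) / (8 * n)) (h u) = R at *
  generalize ((n - A₀.card : ℕ) : ℝ) = f at *
  -- new tombstones have density `f / (2 n)`, and `3 f / (8 n)` is allowed for the touched keys
  have hl : (l : ℝ) ≤ 8 * (n / f) * (W₂ + hashCount h ((A₀ ∪ J).erase u) (h u) + R + 7) := by
    have e1 : (l : ℝ) * (f / (2 * n)) - 3 * f / (8 * n) * l = l * (f / (8 * n)) := by
      field_simp
      ring
    have e2 : (l : ℝ) * (f / (8 * n)) ≤ W₂ + hashCount h ((A₀ ∪ J).erase u) (h u) + R + 7 := by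
      linarith
    have e3 : (l : ℝ) = 8 * (n / f) * (l * (f / (8 * n))) := by
      field_simp
    rw [e3]
    gcongr
  push_cast
  linarith

end Times


/-! ### Dependence on finitely many hashes -/

section Dependence

variable {n : ℕ} [NeZero n] {U : Type*} [DecidableEq U]

theorem queryStops_congr {g g' : U → Fin n} {T : Table n U} {u : U}
    (hT : ∀ q v, T q = .key v → g v = g' v) (hu : g u = g' u) :
    queryStops g T u = queryStops g' T u := by
  funext k
  unfold queryStops
  simp only [probe_eq, hu]
  rcases hk : T (adv (g' u) k) with _ | v | a
  · rfl
  · simp only [hT _ v hk]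
    congr!
  · rfl

omit [DecidableEq U] in
theorem belongs_congr {g g' : U → Fin n} {T : Table n U} {u : U}
    (hT : ∀ q v, T q = .key v → g v = g' v) (hu : g u = g' u) :
    belongs g T u = belongs g' T u := by
  funext k
  unfold belongs
  simp only [probe_eq, hu]
  rcases hk : T (adv (g' u) k) with _ | v | a
  · rfl
  · simp only [hT _ v hk]
    congr!
  · rfl

omit [DecidableEq U] in
theorem insertOffsets_congr {g g' : U → Fin n} {T : Table n U} {u : U}
    (hT : ∀ q v, T q = .key v → g v = g' v) (hu : g u = g' u) :
    insertOffsets g T u = insertOffsets g' T u := by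
  unfold insertOffsets
  rw [belongs_congr hT hu]
  simp only [probe_eq, hu]

/-- The key of an operation. -/
def Op.target : Op U → U
  | .insert u => u
  | .delete u => u
  | .query u => u

theorem opTime_congr {g g' : U → Fin n} {T : Table n U} {o : Op U}
    (hT : ∀ q v, T q = .key v → g v = g' v) (hu : g o.target = g' o.target) :
    opTime g T o = opTime g' T o := by
  rcases o with u | u | u <;> simp only [Op.target] at hu
  · simp only [opTime, insertTime, insertOffsets_congr hT hu]
  · simp only [opTime, queryTime, queryOffset, queryStops_congr hT hu]
  · simp only [opTime, queryTime, queryOffset, queryStops_congr hT hu]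

theorem applyOp_congr {g g' : U → Fin n} {T : Table n U} {o : Op U}
    (hT : ∀ q v, T q = .key v → g v = g' v) (hu : g o.target = g' o.target) :
    applyOp g T o = applyOp g' T o := by
  rcases o with u | u | u
  · simp only [Op.target] at hu
    simp only [applyOp, insertKey, insertOffsets_congr hT hu, hu]
  · simp only [Op.target] at hu
    simp only [applyOp, deleteKey, queryOffset, queryStops_congr hT hu, probe_eq, hu]
  · rfl

omit [DecidableEq U] in
theorem fresh_congr {g g' : U → Fin n} {T : Table n U}
    (hT : ∀ q v, T q = .key v → g v = g' v) : fresh g T = fresh g' T := by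
  have hga : gather g T = gather g' T := by
    funext B
    unfold gather
    congr 1
    funext a q
    rcases hq : T q with _ | v | b
    · rfl
    · simp only
      rw [hT q v hq]
    · rfl
  unfold fresh rebuild
  rw [hga]

/-- The keys that occur in a workload. -/
def targets (S : List (Op U)) : Finset U := (S.map Op.target).toFinset

theorem contents_subset (S : List (Op U)) {t : ℕ} (ht : t ≤ S.length) :
    contents (S.take t) ⊆ targets S := by
  induction t with
  | zero => simp [contents]
  | succ t ih =>
    rw [contents_take_succ S ht]
    have h1 := ih (by omega)
    have h2 : (S[t]).target ∈ targets S := by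
      unfold targets
      rw [List.mem_toFinset]
      exact List.mem_map_of_mem (List.getElem_mem ht)
    generalize S[t] = o at h2
    rcases o with u | u | u
    · exact Finset.insert_subset h2 h1
    · exact (Finset.erase_subset _ _).trans h1
    · exact h1

/-- The execution of a workload depends on the hashes of finitely many keys only. -/
theorem run_congr {S : List (Op U)} (hS : Admissible n S) (cq : Bool) {g g' : U → Fin n}
    (hg : ∀ v ∈ targets S, g v = g' v) {t : ℕ} (ht : t ≤ S.length) :
    run cq g (S.take t) = run cq g' (S.take t) := by
  induction t with
  | zero => exact fresh_congr fun q v hv => by cases hv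
  | succ t ih =>
    have h1 := ih (by omega)
    have hall : Allowed n (contents (S.take t)) S[t] := fun u hu => hS ⟨t, ht⟩ u hu
    obtain ⟨A₀, J, c, hP, hT⟩ := exists_tracks hS cq (t := t) (by omega)
    have hG := (hT g).good
    have hk := (hG.apply hP cq hall).keys
    have hsub := contents_subset S ht
    rw [contents_take_succ S ht] at hsub
    have h2 : (S[t]).target ∈ targets S := by
      unfold targets
      rw [List.mem_toFinset]
      exact List.mem_map_of_mem (List.getElem_mem ht)
    rw [run_take_succ cq _ S ht, run_take_succ cq _ S ht, ← h1]
    have h3 : applyOp g (run cq g (S.take t)).table S[t]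
        = applyOp g' (run cq g (S.take t)).table S[t] :=
      applyOp_congr (fun q v hv => hg v (contents_subset S (by omega) (hG.keys.mem hv)))
        (hg _ h2)
    unfold step
    rw [← h3, fresh_congr fun q v hv => hg v (hsub (hk.mem hv))]

/-- In particular, the running times are measurable, whatever the universe is. -/
theorem dependsOn_timeAt {S : List (Op U)} (hS : Admissible n S) (cq : Bool) (t : Fin S.length) :
    DependsOn (fun g : U → Fin n => (timeAt cq g S t : ℝ)) (targets S : Set U) := by
  intro g g' hg
  have hg' : ∀ v ∈ targets S, g v = g' v := fun v hv => hg v (by simpa using hv)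
  obtain ⟨A₀, J, c, hP, hT⟩ := exists_tracks hS cq t.isLt.le
  have h2 : (S[t]).target ∈ targets S := by
    unfold targets
    rw [List.mem_toFinset]
    exact List.mem_map_of_mem (List.getElem_mem t.isLt)
  simp only [timeAt]
  rw [← run_congr hS cq hg' t.isLt.le, opTime_congr (fun q v hv =>
    hg' v (contents_subset S t.isLt.le ((hT g).good.keys.mem hv))) (hg' _ h2)]

end Dependence

/-! ### Expected running times -/

section ExpectedTime

variable {n : ℕ} [NeZero n] {U : Type*} [DecidableEq U] {Ω : Type*} [MeasurableSpace Ω]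
  {P : Measure Ω} [IsProbabilityMeasure P] {h : Ω → U → Fin n} {A₀ J A : Finset U} {c : ℕ}

/-- The expected lengths of the queues that bound the running times. If `f` slots held no key at the
last rebuild, at most `f / 4` keys have been touched since then. So the density of the touched keys
is at most `f / (4 n)`, and that of the old and touched keys together is at most
`1 - 3 f / (4 n)`; all rates of service exceed these by at least `f / (8 n)`. -/
theorem integral_queues (hh : FullyRandom P h) (hP : Phase n A₀ J A c) (hA : A.card < n) (u : U) :
    (Integrable (fun ω => excess (h ω) ((A₀ ∪ J).erase u)
        (1 - (n - A₀.card : ℕ) / (2 * n)) (h ω u)) P ∧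
      ∫ ω, excess (h ω) ((A₀ ∪ J).erase u) (1 - (n - A₀.card : ℕ) / (2 * n)) (h ω u) ∂P
        ≤ 2 * (n / (n - A₀.card : ℕ)) + 1 / 2) ∧
    (Integrable (fun ω => forwardExcess (h ω) (J.erase u)
        (3 * (n - A₀.card : ℕ) / (8 * n)) (h ω u)) P ∧
      ∫ ω, forwardExcess (h ω) (J.erase u) (3 * (n - A₀.card : ℕ) / (8 * n)) (h ω u) ∂P
        ≤ 3 / 2) ∧
    (Integrable (fun ω => excess (h ω) (J.erase u) ((n - A₀.card : ℕ) / (2 * n)) (h ω u)) P ∧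
      ∫ ω, excess (h ω) (J.erase u) ((n - A₀.card : ℕ) / (2 * n)) (h ω u) ∂P ≤ 1) ∧
    (Integrable (fun ω => forwardExcess (h ω) ((A₀ ∪ J).erase u) 1 (h ω u)) P ∧
      ∫ ω, forwardExcess (h ω) ((A₀ ∪ J).erase u) 1 (h ω u) ∂P
        ≤ 2 * (n / (n - A₀.card : ℕ)) + 1 / 2) ∧
    (Integrable (fun ω => (hashCount (h ω) ((A₀ ∪ J).erase u) (h ω u) : ℝ)) P ∧
      ∫ ω, (hashCount (h ω) ((A₀ ∪ J).erase u) (h ω u) : ℝ) ∂P ≤ 1) := by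
  have hn : (0 : ℝ) < n := Nat.cast_pos.2 (Nat.pos_of_ne_zero (NeZero.ne n))
  have hA₀ := hP.card_lt hA
  have hf0 : (0 : ℝ) < (n - A₀.card : ℕ) := by
    have : 0 < n - A₀.card := by omega
    exact_mod_cast this
  have hfn : ((n - A₀.card : ℕ) : ℝ) ≤ n := by exact_mod_cast Nat.sub_le _ _
  have hJ : (4 : ℝ) * (J.erase u).card ≤ (n - A₀.card : ℕ) := by
    have h1 := hP.lt
    have h2 := hP.card_le
    have h3 := Finset.card_le_card (Finset.erase_subset u J)
    simp only [windowLength] at h1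
    have : 4 * (J.erase u).card ≤ n - A₀.card := by omega
    exact_mod_cast this
  have hV : (4 : ℝ) * ((A₀ ∪ J).erase u).card + 3 * (n - A₀.card : ℕ) ≤ 4 * n := by
    have h1 := hP.lt
    have h2 := hP.card_le
    have h3 := Finset.card_le_card (Finset.erase_subset u (A₀ ∪ J))
    have h4 := Finset.card_union_le A₀ J
    simp only [windowLength] at h1
    have : 4 * ((A₀ ∪ J).erase u).card + 3 * (n - A₀.card) ≤ 4 * n := by omega
    exact_mod_cast this
  have huJ := Finset.notMem_erase u J
  have huV := Finset.notMem_erase u (A₀ ∪ J)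
  generalize (A₀ ∪ J).erase u = V at *
  generalize J.erase u = K at *
  generalize ((n - A₀.card : ℕ) : ℝ) = f at *
  have hV0 : (V.card : ℝ) ≤ n := by linarith
  have hVb : (V.card : ℝ) / (2 * (f / (4 * n)) * n) ≤ 2 * (n / f) := by
    calc (V.card : ℝ) / (2 * (f / (4 * n)) * n) = 2 * (V.card / f) := by
          field_simp
          ring
      _ ≤ 2 * (n / f) := by gcongr
  refine ⟨?_, ?_, ?_, ?_, ?_⟩
  · obtain ⟨e1, e2⟩ := hh.integral_excess huV (μ := 1 - f / (2 * n)) (δ := f / (4 * n))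
      (by positivity) (by
        have : n * (1 - f / (2 * n) - f / (4 * n)) = n - 3 / 4 * f := by
          field_simp
          ring
        rw [this]
        linarith) (by
        have : 0 ≤ f / (2 * n) := by positivity
        linarith)
    exact ⟨e1, e2.trans (by linarith)⟩
  · obtain ⟨e1, e2⟩ := hh.neg.integral_excess huJ (μ := 3 * f / (8 * n)) (δ := f / (8 * n))
      (by positivity) (by
        have : n * (3 * f / (8 * n) - f / (8 * n)) = f / 4 := by
          field_simp
          ring
        rw [this]
        linarith) (by
        rw [div_le_one (by positivity)]
        linarith)
    refine ⟨e1, e2.trans ?_⟩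
    have : (K.card : ℝ) / (2 * (f / (8 * n)) * n) ≤ 1 := by
      rw [div_le_one (by positivity)]
      have : 2 * (f / (8 * n)) * n = f / 4 := by
        field_simp
        ring
      rw [this]
      linarith
    linarith
  · obtain ⟨e1, e2⟩ := hh.integral_excess huJ (μ := f / (2 * n)) (δ := f / (4 * n))
      (by positivity) (by
        have : n * (f / (2 * n) - f / (4 * n)) = f / 4 := by
          field_simp
          ring
        rw [this]
        linarith) (by
        rw [div_le_one (by positivity)]
        linarith)
    refine ⟨e1, e2.trans ?_⟩
    have : (K.card : ℝ) / (2 * (f / (4 * n)) * n) ≤ 1 / 2 := by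
      rw [div_le_iff₀ (by positivity)]
      have : 1 / 2 * (2 * (f / (4 * n)) * n) = f / 4 := by
        field_simp
      rw [this]
      linarith
    linarith
  · obtain ⟨e1, e2⟩ := hh.neg.integral_excess huV (μ := 1) (δ := f / (4 * n))
      (by positivity) (by
        have : n * (1 - f / (4 * n)) = n - f / 4 := by
          field_simp
        rw [this]
        linarith) le_rfl
    exact ⟨e1, e2.trans (by linarith)⟩
  · obtain ⟨e1, e2⟩ := hh.integral_hashCount huV
    refine ⟨e1, e2.trans_le ?_⟩
    rw [div_le_one hn]
    exact hV0

/-- The expected running time of an operation, in terms of the number of slots without a key at the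
time of the last rebuild. -/
theorem integral_opTime_le (hh : FullyRandom P h) (hP : Phase n A₀ J A c) (hA : A.card < n)
    {T : Ω → Table n U} (hG : ∀ ω, Good (h ω) A₀ J A c (T ω)) {o : Op U} (ho : Allowed n A o)
    (hint : Integrable (fun ω => (opTime (h ω) (T ω) o : ℝ)) P) :
    ∫ ω, (opTime (h ω) (T ω) o : ℝ) ∂P ≤ 105 * (n / (n - A₀.card : ℕ)) := by
  have hA₀ := hP.card_lt hA
  have hf0 : (0 : ℝ) < (n - A₀.card : ℕ) := by
    have : 0 < n - A₀.card := by omega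
    exact_mod_cast this
  have hy : 1 ≤ (n : ℝ) / (n - A₀.card : ℕ) := by
    rw [one_le_div hf0]
    exact_mod_cast Nat.sub_le _ _
  have hquery : ∀ u, (∀ ω, opTime (h ω) (T ω) o = queryTime (h ω) (T ω) u) →
      ∫ ω, (opTime (h ω) (T ω) o : ℝ) ∂P ≤ 105 * (n / (n - A₀.card : ℕ)) := by
    intro u hu
    obtain ⟨⟨i1, b1⟩, ⟨i2, b2⟩, -, -, ⟨i5, b5⟩⟩ := integral_queues hh hP hA u
    have i12 := i1.add i2
    have i125 := i12.add (i5.const_mul 2)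
    refine (integral_mono hint ((i125.const_mul 8).add (integrable_const (57 : ℝ)))
      fun ω => ?_).trans ?_
    · simp only [hu ω]
      exact (hG ω).queryTime_le hP hA u
    · rw [integral_add' (i125.const_mul 8) (integrable_const _), integral_const_mul,
        integral_add' i12 (i5.const_mul 2), integral_add' i1 i2, integral_const_mul,
        integral_const, probReal_univ, one_smul]
      linarith
  rcases o with u | u | u
  · obtain ⟨⟨i1, b1⟩, ⟨i2, b2⟩, ⟨i3, b3⟩, ⟨i4, b4⟩, ⟨i5, b5⟩⟩ := integral_queues hh hP hA u
    have i15 := i1.add i5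
    have i154 := i15.add i4
    have ia := i154.add (integrable_const (4 : ℝ))
    have i35 := i3.add i5
    have i352 := i35.add i2
    have ib := i352.add (integrable_const (7 : ℝ))
    refine (integral_mono hint (ia.add (ib.const_mul (8 * (n / (n - A₀.card : ℕ)))))
      fun ω => ?_).trans ?_
    · exact (hG ω).insertTime_le hP hA (ho u rfl).1
    · rw [integral_add' ia (ib.const_mul _), integral_const_mul,
        integral_add' i154 (integrable_const _), integral_add' i15 i4, integral_add' i1 i5,
        integral_add' i352 (integrable_const _), integral_add' i35 i2, integral_add' i3 i5,
        integral_const, integral_const, probReal_univ, one_smul, one_smul]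
      generalize (n : ℝ) / (n - A₀.card : ℕ) = y at *
      nlinarith
  · exact hquery u fun ω => rfl
  · exact hquery u fun ω => rfl

/-- The constant is due to `105 * (5 / 4) ≤ 132`. -/
theorem integral_timeAt_le (hh : FullyRandom P h) {S : List (Op U)} (hS : Admissible n S)
    (cq : Bool) (t : Fin S.length) {x : ℝ} (hx : 1 ≤ x) (hl : loadAt n S t = 1 - 1 / x) :
    Integrable (fun ω => (timeAt cq (h ω) S t : ℝ)) P ∧
      ∫ ω, (timeAt cq (h ω) S t : ℝ) ∂P ≤ 132 * x := by
  have hint := hh.integrable (dependsOn_timeAt hS cq t)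
  refine ⟨hint, ?_⟩
  obtain ⟨hA, hxn⟩ := load_spec hx hl
  obtain ⟨A₀, J, c, hP, hT⟩ := exists_tracks hS cq t.isLt.le
  have h1 := integral_opTime_le hh hP hA (fun ω => (hT (h ω)).good) (o := S[t])
    (fun u hu => hS t u hu) hint
  refine h1.trans ?_
  have hA₀ := hP.card_lt hA
  have hf0 : (0 : ℝ) < (n - A₀.card : ℕ) := by
    have : 0 < n - A₀.card := by omega
    exact_mod_cast this
  have hsp : 4 * ((n : ℝ) - (contents (S.take t)).card) ≤ 5 * (n - A₀.card : ℕ) := by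
    rw [← Nat.cast_sub hA.le]
    exact_mod_cast hP.spare_le hA
  have h2 : (n : ℝ) / (n - A₀.card : ℕ) ≤ 5 / 4 * x := by
    rw [div_le_iff₀ hf0]
    nlinarith
  linarith

end ExpectedTime

end Graveyard

theorem mainTheorem2 :
    ∃ C : ℝ, 0 < C ∧
      ∀ (n : ℕ) [NeZero n] (U : Type*) [DecidableEq U] (cq : Bool)
        (S : List (Graveyard.Op U)), Graveyard.Admissible n S →
        (∀ (Ω : Type*) [MeasurableSpace Ω] (P : MeasureTheory.Measure Ω)
            [MeasureTheory.IsProbabilityMeasure P] (h : Ω → U → Fin n),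
            Graveyard.FullyRandom P h →
            ∀ (t : Fin S.length) (x : ℝ), 1 ≤ x → Graveyard.loadAt n S t = 1 - 1 / x →
              MeasureTheory.Integrable (fun ω => (Graveyard.timeAt cq (h ω) S t : ℝ)) P ∧
              ∫ ω, (Graveyard.timeAt cq (h ω) S t : ℝ) ∂P ≤ C * x) ∧
        (∀ (h : U → Fin n) (x : Fin S.length → ℝ),
            (∀ t, 1 ≤ x t ∧ Graveyard.loadAt n S t = 1 - 1 / x t) →
            ((∑ t, Graveyard.rebuildTimeAt cq h S t : ℕ) : ℝ) ≤ C * ∑ t, x t) := by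
  refine ⟨132, by norm_num, fun n _ U _ cq S hS => ⟨?_, ?_⟩⟩
  · intro Ω _ P _ h hh t x hx hl
    exact Graveyard.integral_timeAt_le hh hS cq t hx hl
  · intro h x hx
    have h1 := Graveyard.sum_rebuildTimeAt_le hS cq h x hx
    have h2 : 0 ≤ ∑ t, x t := Finset.sum_nonneg fun t _ => by linarith [(hx t).1]
    linarith
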